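/- **Setting.** Let $\phi,\psi\in L^2(\mathbb R)$ (complex-valued) and $\langle f,g\rangle=\int_{\mathbb R} f\overline g$. Let $\widetilde A f=xf+\langle f,\psi\rangle\phi$ with domain $\{f\in L^2(\mathbb R): xf\in L^2(\mathbb R),\ \lim_{R\to\infty}\int_{-R}^R f=0\}$, and let $\widetilde A^*$ be its adjoint. For $u\in\mathrm{Dom}(\widetilde A^*)$ let $\Gamma_1u=\lim_{R\to\infty}\int_{-R}^R u$ and let $\Gamma_2u$ be the unique constant $c$ with $xu-c\in L^2(\mathbb R)$. For $B\in\mathbb C$ let $A_B$ be the restriction of $\widetilde A^*$ to $\ker(\Gamma_1-B\Gamma_2)$. For $\mu\in\rho(A_B)$ let $S_{\mu,B}$ be the solution operator: $u=S_{\mu,B}a$ is the solution of $(\widetilde A^*-\mu)u=0$, $(\Gamma_1-B\Gamma_2)u=a$. Put $$\mathcal S_B=\mathrm{Span}_{\delta\in\rho(A_B)}(A_B-\delta)^{-1}\,\mathrm{Ran}(S_{\mu_0,B})\quad(\mu_0\in\rho(A_B)\text{ fixed}),\qquad \mathcal T_B=\mathrm{Span}_{\mu\in\rho(A_B)}\mathrm{Ran}(S_{\mu,B}).$$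 Assume that $\rho(A_B)$ meets both the open upper and the open lower half-plane (which is the case for every $B\ne\pm\pi i$), and let the detectable subspace $\overline{\mathcal S}$ be either $\overline{\mathcal S_B}$ (for any choice of $\mu_0$) or $\overline{\mathcal T_B}$. For $f\in L^p(\mathbb R)$, $1<p<\infty$, let $P_\pm f(k)=\pm\frac1{2\pi i}\lim_{\varepsilon\downarrow0}\int_{\mathbb R}\frac{f(x)}{x-(k\pm i\varepsilon)}\,dx$ (limit in $L^p(\mathbb R)$) be the Riesz projections. **Theorem.** Assume in addition that $\psi\in L^\infty$, or that $\phi,\psi\in L^4$. For $u\in L^2(\mathbb R)$ the expression $$Lu=[-P_+(\psi\overline\phi)+P_+(\overline\phi)\psi]\,u+\overline\phi\,[\psi P_--P_-\psi]\,u$$ is in $L^1(\mathbb R)$. Let $L$ also denote the operator on $L^2(\mathbb R)$ given by it on its maximal domain $\mathrm{Dom}(L)=\{u\in L^2(\mathbb R): Lu\in L^2(\mathbb R)\}$. Then $$\overline{\mathcal S}\ne L^2(\mathbb R)\iff \tfrac1{2\pi i}\in\sigma_p(L),\qquad\text{and}\qquad \overline{\mathcal S}^{\perp}=\{g\in L^2(\mathbb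 R):\ \overline g\in\ker(L-\tfrac1{2\pi i})\}.$$ Furthermore, let $\eta\in L^\infty(\mathbb R)$ satisfy $\eta(k)\ne0$ for a.e. $k$ and $\eta[-P_+(\psi\overline\phi)+P_+(\overline\phi)\psi],\ \eta\psi\overline\phi,\ \eta\overline\phi\in L^\infty(\mathbb R)$. Then $$\mathcal Lu=\eta\Big[-\frac1{2\pi i}-P_+(\psi\overline\phi)+P_+(\overline\phi)\psi\Big]u+\eta\overline\phi\,[\psi P_--P_-\psi]\,u,\qquad \mathrm{Dom}(\mathcal L)=\{u\in L^2(\mathbb R):\ \eta\overline\phi\,P_-(\psi u)\in L^2(\mathbb R)\},$$ is a well-defined, densely defined operator in $L^2(\mathbb R)$, and $$\overline{\mathcal S}\ne L^2(\mathbb R)\iff 0\in\sigma_p(\mathcal L),\qquad \overline{\mathcal S}^{\perp}=\{g\in L^2(\mathbb R):\ \overline g\in\ker\mathcal L\}.$$ If $\psi\in L^\infty$, then $\mathrm{Dom}(\mathcal L)=L^2(\mathbb R)$. -/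

import Mathlib

open MeasureTheory Filter Topology
open scoped ENNReal ComplexConjugate

noncomputable section

namespace Friedrichs

/-- The Hilbert space `L²(ℝ)` of complex-valued functions. Note that Mathlib's inner product is
conjugate-linear in its first variable, so that `⟨f, φ⟩ = ∫ f conj φ` is `inner ℂ φ f`. -/
abbrev L2R : Type := Lp ℂ 2 (volume : Measure ℝ)

/-! ### Unbounded operators on `L²(ℝ)`, represented by their graphs -/

/-- A (possibly unbounded) operator on `L²(ℝ)`, given by its graph: `(u, v) ∈ T` means that
`u` is in the domain of `T` and `T u = v`. -/
abbrev Operator : Type := Set (L2R × L2R)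

/-- The domain of an operator. -/
def Operator.domain (T : Operator) : Set L2R := {u | ∃ v, (u, v) ∈ T}

/-- The adjoint of a (densely defined) operator: `f ∈ Dom T*` and `T* f = h` if and only if
`⟨T u, f⟩ = ⟨u, h⟩` for all `u ∈ Dom T`. -/
def Operator.adjoint (T : Operator) : Operator :=
  {p | ∀ q ∈ T, inner ℂ q.2 p.1 = inner ℂ q.1 p.2}

/-- The kernel of `T - z`. -/
def Operator.kerSub (T : Operator) (z : ℂ) : Set L2R := {u | (u, z • u) ∈ T}

/-- The point spectrum of `T`. -/
def Operator.pointSpectrum (T : Operator) : Set ℂ := {z | ∃ u ∈ T.kerSub z, u ≠ 0}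

/-- The resolvent set of `T`: the numbers `z` for which `T - z` is a bijection of `Dom T` onto
`L²(ℝ)` with a bounded inverse `R`. -/
def Operator.resolventSet (T : Operator) : Set ℂ :=
  {z | ∃ R : L2R →L[ℂ] L2R,
    (∀ g : L2R, (R g, g + z • R g) ∈ T) ∧ ∀ u v : L2R, (u, v) ∈ T → R (v - z • u) = u}

/-! ### The Friedrichs model -/

/-- `Γ₁ u = a`: the symmetric integrals of `u` converge to `a`. -/
def HasTraceOne (u : L2R) (a : ℂ) : Prop :=
  Tendsto (fun R : ℝ => ∫ x in (-R)..R, u x) atTop (𝓝 a)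

/-- `Γ₂ u = c`: the (unique) constant `c` with `x u(x) - c ∈ L²(ℝ)`. -/
def HasTraceTwo (u : L2R) (c : ℂ) : Prop :=
  MemLp (fun x : ℝ => (x : ℂ) * u x - c) 2 volume

/-- The operator `f ↦ x f + ⟨f, φ⟩ ψ` with domain
`{f ∈ L² | x f ∈ L², lim_{R → ∞} ∫_{-R}^R f = 0}`. -/
def opA (φ ψ : L2R) : Operator :=
  {p | HasTraceTwo p.1 0 ∧ HasTraceOne p.1 0 ∧
    ∀ᵐ x : ℝ, p.2 x = (x : ℂ) * p.1 x + inner ℂ φ p.1 * ψ x}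

/-- The operator `Ã`, in which `φ` and `ψ` have changed places. -/
def opATilde (φ ψ : L2R) : Operator := opA ψ φ

/-- `(Γ₁ - B Γ₂) u = a`. -/
def HasBoundaryValue (B : ℂ) (u : L2R) (a : ℂ) : Prop :=
  ∃ a₁ a₂ : ℂ, HasTraceOne u a₁ ∧ HasTraceTwo u a₂ ∧ a₁ - B * a₂ = a

/-- `A_B`, the restriction of `Ã*` to `ker (Γ₁ - B Γ₂)`. -/
def opAB (φ ψ : L2R) (B : ℂ) : Operator :=
  {p | p ∈ (opATilde φ ψ).adjoint ∧ HasBoundaryValue B p.1 0}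

/-- The range of the solution operator `S_{μ,B}`, which maps `a` to the solution `u` of
`(Ã* - μ) u = 0`, `(Γ₁ - B Γ₂) u = a`. -/
def ranSolution (φ ψ : L2R) (B μ : ℂ) : Set L2R :=
  {u | ∃ a : ℂ, u ∈ (opATilde φ ψ).adjoint.kerSub μ ∧ HasBoundaryValue B u a}

/-- The closure of `𝒮_B`, the span of the `(A_B - δ)⁻¹ Ran S_{μ₀,B}` over all `δ ∈ ρ(A_B)`. -/
def closureS (φ ψ : L2R) (B μ₀ : ℂ) : Submodule ℂ L2R :=
  (Submodule.span ℂ {v : L2R | ∃ δ ∈ (opAB φ ψ B).resolventSet, ∃ h ∈ ranSolution φ ψ B μ₀,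
    (v, h + δ • v) ∈ opAB φ ψ B}).topologicalClosure

/-- The closure of `𝒯_B`, the span of the `Ran S_{μ,B}` over all `μ ∈ ρ(A_B)`. -/
def closureT (φ ψ : L2R) (B : ℂ) : Submodule ℂ L2R :=
  (Submodule.span ℂ {u : L2R | ∃ μ ∈ (opAB φ ψ B).resolventSet,
    u ∈ ranSolution φ ψ B μ}).topologicalClosure

/-! ### Riesz projections -/

/-- The Cauchy transform `∫ f(x) / (x - z) dx`. -/
def cauchyTransform (f : ℝ → ℂ) (z : ℂ) : ℂ := ∫ x : ℝ, f x / ((x : ℂ) - z)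

/-- For `s = 1` (`s = -1`): `F` is the Riesz projection `P₊ f` (`P₋ f`) of a function `f ∈ L^p`,
`1 < p < ∞`, that is, `F(k)` is the limit in `L^p(ℝ)` of
`± (2 π i)⁻¹ ∫ f(x) / (x - (k ± i ε)) dx` as `ε ↓ 0`. The limits for different `p` agree a.e. -/
def IsRieszProj (s : ℝ) (f F : ℝ → ℂ) : Prop :=
  ∃ p : ℝ≥0∞, 1 < p ∧ p < ∞ ∧ MemLp f p volume ∧ MemLp F p volume ∧
    Tendsto (fun ε : ℝ => eLpNorm (fun k : ℝ =>
      (s : ℂ) / (2 * Real.pi * Complex.I) *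
        cauchyTransform f ((k : ℂ) + (s : ℂ) * (ε : ℂ) * Complex.I) - F k) p volume)
      (𝓝[>] 0) (𝓝 0)

open Classical in
/-- The Riesz projection of `f`, a function determined up to equality a.e. -/
def rieszProj (s : ℝ) (f : ℝ → ℂ) : ℝ → ℂ :=
  if h : ∃ F, IsRieszProj s f F then h.choose else 0

/-- The Riesz projection `P₊`. -/
def rieszPlus (f : ℝ → ℂ) : ℝ → ℂ := rieszProj 1 f

/-- The Riesz projection `P₋`. -/
def rieszMinus (f : ℝ → ℂ) : ℝ → ℂ := rieszProj (-1) f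

/-! ### The operators `L` and `𝓛` -/

/-- The function `- P₊(ψ conj φ) + P₊(conj φ) ψ`. -/
def multiplier (φ ψ : L2R) (k : ℝ) : ℂ :=
  -rieszPlus (fun x => ψ x * conj (φ x)) k + rieszPlus (fun x => conj (φ x)) k * ψ k

/-- The expression `L u = [- P₊(ψ conj φ) + P₊(conj φ) ψ] u + conj φ [ψ P₋ - P₋ ψ] u`. -/
def exprL (φ ψ u : L2R) (k : ℝ) : ℂ :=
  multiplier φ ψ k * u k +
    conj (φ k) * (ψ k * rieszMinus u k - rieszMinus (fun x => ψ x * u x) k)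

/-- The operator `L` with its maximal domain `{u ∈ L² | L u ∈ L²}`. -/
def opL (φ ψ : L2R) : Operator := {p | ∀ᵐ k : ℝ, p.2 k = exprL φ ψ p.1 k}

/-- The set `{u ∈ L² | η conj φ P₋(ψ u) ∈ L²}`. -/
def domCalL (φ ψ : L2R) (η : ℝ → ℂ) : Set L2R :=
  {u | MemLp (fun k => η k * conj (φ k) * rieszMinus (fun x => ψ x * u x) k) 2 volume}

/-- The operator `𝓛 u = η [- 1/(2πi) - P₊(ψ conj φ) + P₊(conj φ) ψ] u + η conj φ [ψ P₋ - P₋ ψ] u`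
with domain `domCalL φ ψ η`. -/
def opCalL (φ ψ : L2R) (η : ℝ → ℂ) : Operator :=
  {p | p.1 ∈ domCalL φ ψ η ∧ ∀ᵐ k : ℝ, p.2 k =
    η k * (-(1 / (2 * Real.pi * Complex.I)) + multiplier φ ψ k) * p.1 k +
      η k * conj (φ k) * (ψ k * rieszMinus p.1 k - rieszMinus (fun x => ψ x * p.1 x) k)}

end Friedrichs

end

open MeasureTheory Filter Topology
open scoped ENNReal ComplexConjugate

noncomputable section

namespace Friedrichs

/-! ### The Cauchy transform off the real line -/

/-! Write `C f(z) = ∫ f(x) / (x - z) dx` for nonreal `z`. The orthogonal complement of the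
detectable subspace and the kernel of `L - 1/(2πi)` are both described by the vanishing of one
function that is holomorphic off the real line and built from Cauchy transforms.

Operator side. The adjoint acts as `Ã* u = x u - c + ⟨u, φ⟩ ψ` with a constant `c`
(`mem_adjoint_iff`), so for nonreal `μ` a solution of `(Ã* - μ) v = 0` is `c / (x - μ) - ⟨v, φ⟩ ψ /
(x - μ)`. Pairing with `φ` determines `⟨v, φ⟩`, and then `D(μ) ⟨v, g⟩ = c N(μ)`, where `D = 1 + C(ψ
φ̄)` is `perturbation` and `N = C(ḡ) D - C(φ̄) C(ψ ḡ)` is `pairing` (`exists_perturbation_mul_eq`).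
Since `D` tends to `1` along the imaginary axis, its zeros are isolated. As the resolvent set is
open and meets both half-planes, the identity theorem shows that `g` is orthogonal to all solutions
if and only if `N = 0` off the real line. The resolvent `R` of `A_B` carries a solution `u` at `μ₀`
to the solution `u + (μ - μ₀) R u` at `μ`, with the same boundary value `a`. Hence orthogonality to
the span defining `𝒮_B` makes `⟨v, g⟩` equal to a constant `k` along this family, so that `a N = k
E` with `E` the `boundaryFactor`. At `± i ∞` the left side tends to `0` and `E` to `± π i - B`.
These limits cannot both vanish, so `k = 0` and again `N = 0`
(`mem_orthogonal_iff_pairing_eq_zero`).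

Function side. Splitting each function as `f = P₊ f + P₋ f` turns `L u` into `P₊φ̄ P₊(ψu) - P₊(ψφ̄)
P₊u + P₋(ψφ̄) P₋u - P₋φ̄ P₋(ψu)`. By Cauchy's formula `C(P₊a P₊b)` is `C(a) C(b) / (2πi)` in the
upper half-plane and `0` in the lower one, with the mirrored statement for `P₋`. Therefore `C(u /
(2πi) - L u) = N / (2πi)` for `u = ḡ` (`cauchyTransform_exprL`), and injectivity of `C` identifies
`N = 0` with the eigenvalue equation.

These products require Riesz projections on `L²`, `L⁴` and `L^{4/3}`. Their boundedness is M.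
Riesz's theorem, proved by contour integration of `Fⁿ` for `n = 2, 4` and by duality for `4/3`. The
operator `𝓛` is `η (L - 1/(2πi))` with a domain that loses no element of the kernel. -/

lemma abs_im_le_norm_ofReal_sub (x : ℝ) (z : ℂ) : |z.im| ≤ ‖(x : ℂ) - z‖ := by
  simpa using Complex.abs_im_le_norm ((x : ℂ) - z)

lemma norm_ofReal_sub_pos {z : ℂ} (hz : z.im ≠ 0) (x : ℝ) : 0 < ‖(x : ℂ) - z‖ :=
  (abs_pos.2 hz).trans_le (abs_im_le_norm_ofReal_sub x z)

lemma ofReal_sub_ne_zero {z : ℂ} (hz : z.im ≠ 0) (x : ℝ) : (x : ℂ) - z ≠ 0 :=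
  norm_pos_iff.1 (norm_ofReal_sub_pos hz x)

/-- Cauchy kernels at two points are comparable uniformly in `x`. This is why absolute convergence
of the Cauchy transform at `i` alone can serve as the definition of `CauchyIntegrable`. -/
lemma norm_ofReal_sub_le {z : ℂ} (w : ℂ) (hz : z.im ≠ 0) (x : ℝ) :
    ‖(x : ℂ) - w‖ ≤ (1 + ‖z - w‖ / |z.im|) * ‖(x : ℂ) - z‖ := by
  have h1 : ‖(x : ℂ) - w‖ ≤ ‖(x : ℂ) - z‖ + ‖z - w‖ := by
    simpa using norm_add_le ((x : ℂ) - z) (z - w)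
  have h2 := abs_im_le_norm_ofReal_sub x z
  have h3 : ‖z - w‖ = ‖z - w‖ / |z.im| * |z.im| := by
    field_simp [abs_pos.2 hz]
  have h4 : ‖z - w‖ / |z.im| * |z.im| ≤ ‖z - w‖ / |z.im| * ‖(x : ℂ) - z‖ := by gcongr
  linarith

lemma continuous_inv_ofReal_sub {z : ℂ} (hz : z.im ≠ 0) :
    Continuous fun x : ℝ => ((x : ℂ) - z)⁻¹ :=
  (Complex.continuous_ofReal.sub continuous_const).inv₀ (ofReal_sub_ne_zero hz)

lemma norm_inv_ofReal_sub_le {z : ℂ} (hz : z.im ≠ 0) (x : ℝ) : ‖((x : ℂ) - z)⁻¹‖ ≤ |z.im|⁻¹ := by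
  rw [norm_inv]
  exact inv_anti₀ (abs_pos.2 hz) (abs_im_le_norm_ofReal_sub x z)

/-- The functions `f` for which the Cauchy transform converges absolutely off the real line. -/
def CauchyIntegrable (f : ℝ → ℂ) : Prop := Integrable fun x : ℝ => f x / ((x : ℂ) - Complex.I)

namespace CauchyIntegrable

variable {f g : ℝ → ℂ}

lemma integrable (hf : CauchyIntegrable f) {z : ℂ} (hz : z.im ≠ 0) :
    Integrable fun x : ℝ => f x / ((x : ℂ) - z) := by
  have h : Integrable fun x : ℝ =>
      f x / ((x : ℂ) - Complex.I) * (((x : ℂ) - Complex.I) * ((x : ℂ) - z)⁻¹) := by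
    refine Integrable.mul_bdd (c := 1 + ‖z - Complex.I‖ / |z.im|) hf
      (((Complex.continuous_ofReal.sub continuous_const).mul
        (continuous_inv_ofReal_sub hz)).aestronglyMeasurable) (ae_of_all _ fun x => ?_)
    rw [norm_mul, norm_inv, ← div_eq_mul_inv, div_le_iff₀ (norm_ofReal_sub_pos hz x)]
    exact norm_ofReal_sub_le _ hz x
  refine h.congr (ae_of_all _ fun x => ?_)
  have h1 := ofReal_sub_ne_zero (z := Complex.I) (by simp) x
  have h2 := ofReal_sub_ne_zero hz x
  field_simp

lemma add (hf : CauchyIntegrable f) (hg : CauchyIntegrable g) :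
    CauchyIntegrable fun x => f x + g x := by
  have := Integrable.add hf hg
  refine this.congr (ae_of_all _ fun x => ?_)
  simp [add_div]

lemma const_mul (hf : CauchyIntegrable f) (c : ℂ) : CauchyIntegrable fun x => c * f x := by
  simpa [CauchyIntegrable, mul_div_assoc] using Integrable.const_mul hf c

/-- Differentiation under the integral. For `w` in the ball of radius `|Im z| / 2`, one factor of
`(x - w)⁻²` is compared with the kernel at `z` (at the cost of a factor `2`) and the other is
bounded by `2 / |Im z|`, which gives an integrable majorant. -/
lemma hasDerivAt (hf : CauchyIntegrable f) {z : ℂ} (hz : z.im ≠ 0) :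
    HasDerivAt (cauchyTransform f) (∫ x : ℝ, f x / ((x : ℂ) - z) ^ 2) z := by
  have hr : 0 < |z.im| / 2 := by positivity
  have him : ∀ w ∈ Metric.ball z (|z.im| / 2), |z.im| / 2 ≤ |w.im| := by
    intro w hw
    have h1 : |w.im - z.im| ≤ ‖w - z‖ := by simpa using Complex.abs_im_le_norm (w - z)
    rw [Metric.mem_ball, dist_eq_norm] at hw
    have h2 := abs_sub_abs_le_abs_sub z.im w.im
    rw [abs_sub_comm] at h2
    linarith
  have hne : ∀ w ∈ Metric.ball z (|z.im| / 2), w.im ≠ 0 := fun w hw =>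
    abs_pos.1 (hr.trans_le (him w hw))
  have hm : ∀ w : ℂ, w.im ≠ 0 → AEStronglyMeasurable (fun x : ℝ => f x / ((x : ℂ) - w)) volume :=
    fun w hw => (hf.integrable hw).aestronglyMeasurable
  refine (hasDerivAt_integral_of_dominated_loc_of_deriv_le
    (F := fun (w : ℂ) (x : ℝ) => f x / ((x : ℂ) - w))
    (F' := fun (w : ℂ) (x : ℝ) => f x / ((x : ℂ) - w) ^ 2)
    (bound := fun x : ℝ => ‖f x / ((x : ℂ) - z)‖ * (2 * (|z.im| / 2)⁻¹))
    (Metric.ball_mem_nhds z hr) ?_ (hf.integrable hz) ?_ ?_ ?_ ?_).2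
  · filter_upwards [Metric.ball_mem_nhds z hr] with w hw using hm w (hne w hw)
  · have : (fun x : ℝ => f x / ((x : ℂ) - z) ^ 2) =
        fun x : ℝ => f x / ((x : ℂ) - z) * ((x : ℂ) - z)⁻¹ := by
      ext x
      rw [sq, ← div_div, div_eq_mul_inv (f x / _)]
    rw [this]
    exact (hm z hz).mul (continuous_inv_ofReal_sub hz).aestronglyMeasurable
  · refine ae_of_all _ fun x w hw => ?_
    have h0 := norm_ofReal_sub_pos (hne w hw) x
    have h1 := norm_ofReal_sub_pos hz x
    have h2 : ‖(x : ℂ) - z‖ ≤ 2 * ‖(x : ℂ) - w‖ := by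
      refine (norm_ofReal_sub_le z (hne w hw) x).trans ?_
      gcongr
      have h3 : ‖w - z‖ ≤ |w.im| := by
        have hw' := hw
        rw [Metric.mem_ball, dist_eq_norm] at hw'
        exact hw'.le.trans (him w hw)
      have : ‖w - z‖ / |w.im| ≤ 1 := div_le_one_of_le₀ h3 (abs_nonneg _)
      linarith
    have h4 : ‖(x : ℂ) - w‖⁻¹ ≤ 2 * ‖(x : ℂ) - z‖⁻¹ := by
      rw [← div_eq_mul_inv, le_div_iff₀ h1, inv_mul_le_iff₀ h0]
      linarith
    have h5 : ‖(x : ℂ) - w‖⁻¹ ≤ (|z.im| / 2)⁻¹ :=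
      inv_anti₀ hr ((him w hw).trans (abs_im_le_norm_ofReal_sub x w))
    calc ‖f x / ((x : ℂ) - w) ^ 2‖ = ‖f x‖ * (‖(x : ℂ) - w‖⁻¹ * ‖(x : ℂ) - w‖⁻¹) := by
          rw [norm_div, norm_pow, sq, div_eq_mul_inv, mul_inv]
      _ ≤ ‖f x‖ * (2 * ‖(x : ℂ) - z‖⁻¹ * (|z.im| / 2)⁻¹) := by gcongr
      _ = _ := by rw [norm_div, div_eq_mul_inv]; ring
  · exact (hf.integrable hz).norm.mul_const _
  · refine ae_of_all _ fun x w hw => ?_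
    have h0 := ofReal_sub_ne_zero (hne w hw) x
    have := ((hasDerivAt_id w).const_sub (x : ℂ)).inv h0 |>.const_mul (f x)
    simpa [div_eq_mul_inv] using this

lemma differentiableOn (hf : CauchyIntegrable f) {U : Set ℂ} (hU : ∀ z ∈ U, z.im ≠ 0) :
    DifferentiableOn ℂ (cauchyTransform f) U := fun z hz =>
  (hf.hasDerivAt (hU z hz)).differentiableAt.differentiableWithinAt

/-- For `y ≥ 1` the kernel at `± i y` is dominated by the kernel at `i`, so dominated convergence
applies. This decay along the imaginary axis fixes the limits of all the holomorphic functions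
below. -/
lemma tendsto_zero (hf : CauchyIntegrable f) {s : ℝ} (hs : |s| = 1) :
    Tendsto (fun y : ℝ => cauchyTransform f ((s * y : ℝ) * Complex.I)) atTop (𝓝 0) := by
  have h0 : (∫ _ : ℝ, (0 : ℂ)) = 0 := by simp
  rw [← h0]
  have him : ∀ y : ℝ, 1 ≤ y → (((s * y : ℝ) : ℂ) * Complex.I).im ≠ 0 := by
    intro y hy h
    have : s * y = 0 := by simpa using h
    rcases mul_eq_zero.1 this with h | h
    · simp [h] at hs
    · linarith
  refine tendsto_integral_filter_of_dominated_convergence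
    (fun x : ℝ => ‖f x / ((x : ℂ) - Complex.I)‖) ?_ ?_ hf.norm ?_
  · filter_upwards [eventually_ge_atTop 1] with y hy using
      (hf.integrable (him y hy)).aestronglyMeasurable
  · filter_upwards [eventually_ge_atTop 1] with y hy
    refine ae_of_all _ fun x => ?_
    rw [norm_div, norm_div]
    have : ‖(x : ℂ) - Complex.I‖ ≤ ‖(x : ℂ) - (s * y : ℝ) * Complex.I‖ := by
      rw [Complex.norm_def, Complex.norm_def]
      refine Real.sqrt_le_sqrt ?_
      have hs2 : s ^ 2 = 1 := by rw [← sq_abs, hs, one_pow]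
      simp only [Complex.normSq_apply]
      have h1 : s * y * (s * y) = s ^ 2 * (y * y) := by ring
      simp [h1, hs2]
      nlinarith
    gcongr
    exact norm_ofReal_sub_pos (by simp) x
  · refine ae_of_all _ fun x => ?_
    refine squeeze_zero_norm' (a := fun y : ℝ => ‖f x‖ / y) ?_
      (tendsto_const_nhds.div_atTop tendsto_id)
    filter_upwards [eventually_ge_atTop 1] with y hy
    rw [norm_div]
    have h1 := abs_im_le_norm_ofReal_sub x (((s * y : ℝ) : ℂ) * Complex.I)
    have h2 : |(((s * y : ℝ) : ℂ) * Complex.I).im| = y := by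
      have : (((s * y : ℝ) : ℂ) * Complex.I).im = s * y := by simp
      rw [this, abs_mul, hs, one_mul, abs_of_nonneg (by linarith)]
    rw [h2] at h1
    gcongr
end CauchyIntegrable

lemma cauchyTransform_congr {f g : ℝ → ℂ} (h : f =ᵐ[volume] g) :
    cauchyTransform f = cauchyTransform g := by
  ext z
  exact integral_congr_ae (h.mono fun x hx => by simp [hx])

lemma cauchyTransform_add {f g : ℝ → ℂ} (hf : CauchyIntegrable f) (hg : CauchyIntegrable g)
    {z : ℂ} (hz : z.im ≠ 0) :
    cauchyTransform (fun x => f x + g x) z = cauchyTransform f z + cauchyTransform g z := by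
  simp only [cauchyTransform, add_div]
  exact integral_add (hf.integrable hz) (hg.integrable hz)

lemma cauchyTransform_sub {f g : ℝ → ℂ} (hf : CauchyIntegrable f) (hg : CauchyIntegrable g)
    {z : ℂ} (hz : z.im ≠ 0) :
    cauchyTransform (fun x => f x - g x) z = cauchyTransform f z - cauchyTransform g z := by
  simp only [cauchyTransform, sub_div]
  exact integral_sub (hf.integrable hz) (hg.integrable hz)

lemma cauchyTransform_const_mul (c : ℂ) (f : ℝ → ℂ) (z : ℂ) :
    cauchyTransform (fun x => c * f x) z = c * cauchyTransform f z := by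
  simp only [cauchyTransform, mul_div_assoc]
  exact integral_const_mul _ _

lemma cauchyTransform_conj (f : ℝ → ℂ) (z : ℂ) :
    cauchyTransform (fun x => conj (f x)) (conj z) = conj (cauchyTransform f z) := by
  simp only [cauchyTransform]
  rw [← integral_conj]
  simp

/-! ### The Cauchy kernel in `L^q` and Hölder bounds -/

lemma one_add_abs_le (x : ℝ) {z : ℂ} (hz : z.im ≠ 0) :
    1 + |x| ≤ 2 * (1 + ‖z - Complex.I‖ / |z.im|) * ‖(x : ℂ) - z‖ := by
  have h1 := norm_ofReal_sub_le Complex.I hz x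
  have h2 : |x| ≤ ‖(x : ℂ) - Complex.I‖ := by
    simpa using Complex.abs_re_le_norm ((x : ℂ) - Complex.I)
  have h3 : 1 ≤ ‖(x : ℂ) - Complex.I‖ := by
    simpa using Complex.abs_im_le_norm ((x : ℂ) - Complex.I)
  linarith

lemma memLp_inv_ofReal_sub {z : ℂ} (hz : z.im ≠ 0) {q : ℝ≥0∞} (hq : 1 < q) :
    MemLp (fun x : ℝ => ((x : ℂ) - z)⁻¹) q volume := by
  have hm : AEStronglyMeasurable (fun x : ℝ => ((x : ℂ) - z)⁻¹) volume :=
    (continuous_inv_ofReal_sub hz).aestronglyMeasurable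
  rcases eq_or_ne q ∞ with rfl | hq'
  · exact memLp_top_of_bound hm _ (ae_of_all _ (norm_inv_ofReal_sub_le hz))
  have hq1 : 1 < q.toReal := by
    rw [← ENNReal.toReal_one]
    exact (ENNReal.toReal_lt_toReal ENNReal.one_ne_top hq').2 hq
  have h1 : MemLp (fun x : ℝ => (1 + ‖x‖)⁻¹) q volume := by
    rw [← integrable_norm_rpow_iff (Measurable.aestronglyMeasurable (by fun_prop))
      (by positivity) hq']
    refine (integrable_one_add_norm (E := ℝ) (μ := volume) (r := q.toReal) (by simpa)).congr
      (ae_of_all _ fun x => ?_)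
    have : 0 < 1 + ‖x‖ := by positivity
    have h2 : ‖(1 + ‖x‖)⁻¹‖ = (1 + ‖x‖)⁻¹ := Real.norm_of_nonneg (by positivity)
    simp only [h2]
    rw [Real.rpow_neg this.le, Real.inv_rpow this.le]
  refine MemLp.of_le_mul (c := 2 * (1 + ‖z - Complex.I‖ / |z.im|)) h1 hm (ae_of_all _ fun x => ?_)
  have : 0 < 1 + ‖x‖ := by positivity
  have h2 : ‖(1 + ‖x‖)⁻¹‖ = (1 + ‖x‖)⁻¹ := Real.norm_of_nonneg (by positivity)
  rw [norm_inv, h2, ← div_eq_mul_inv, le_div_iff₀ this,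
    inv_mul_le_iff₀ (norm_ofReal_sub_pos hz x), mul_comm]
  exact one_add_abs_le x hz

lemma one_lt_conjExponent {p : ℝ≥0∞} (hp' : p ≠ ∞) : 1 < p.conjExponent := by
  unfold ENNReal.conjExponent
  refine ENNReal.lt_add_right ENNReal.one_ne_top ?_
  simp [hp']

lemma cauchyIntegrable_of_memLp {f : ℝ → ℂ} {p : ℝ≥0∞} (hp : 1 ≤ p) (hp' : p ≠ ∞)
    (hf : MemLp f p volume) : CauchyIntegrable f := by
  have : p.HolderConjugate p.conjExponent := ENNReal.HolderConjugate.conjExponent hp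
  have h := memLp_inv_ofReal_sub (z := Complex.I) (by simp) (one_lt_conjExponent hp')
  exact (hf.integrable_mul h).congr (ae_of_all _ fun x => (div_eq_mul_inv _ _).symm)

lemma norm_cauchyTransform_le {f : ℝ → ℂ} {p : ℝ≥0∞} (hp : 1 ≤ p) (hp' : p ≠ ∞)
    (hf : MemLp f p volume) {z : ℂ} (hz : z.im ≠ 0) :
    ENNReal.ofReal ‖cauchyTransform f z‖ ≤
      eLpNorm f p volume * eLpNorm (fun x : ℝ => ((x : ℂ) - z)⁻¹) p.conjExponent volume := by
  have : p.HolderConjugate p.conjExponent := ENNReal.HolderConjugate.conjExponent hp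
  have h := memLp_inv_ofReal_sub hz (one_lt_conjExponent hp')
  have h2 := eLpNorm_smul_le_mul_eLpNorm (p := p) (q := p.conjExponent) (r := 1) h.1 hf.1
  refine le_trans ?_ h2
  rw [ofReal_norm, eLpNorm_one_eq_lintegral_enorm]
  simpa [cauchyTransform, div_eq_mul_inv] using
    enorm_integral_le_lintegral_enorm (μ := volume) (fun x : ℝ => f x / ((x : ℂ) - z))

/-! ### Principal values of the Cauchy kernel -/

/-- Since `Im z ≠ 0`, the path `x - z` stays off the branch cut and the principal logarithm is an
antiderivative. -/
lemma intervalIntegral_inv_ofReal_sub {z : ℂ} (hz : z.im ≠ 0) (a b : ℝ) :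
    ∫ x in a..b, ((x : ℂ) - z)⁻¹ = Complex.log (b - z) - Complex.log (a - z) := by
  refine intervalIntegral.integral_eq_sub_of_hasDerivAt
    (f := fun x : ℝ => Complex.log ((x : ℂ) - z)) (fun x _ => ?_)
    ((continuous_inv_ofReal_sub hz).intervalIntegrable _ _)
  have h1 : HasDerivAt (fun x : ℝ => (x : ℂ) - z) 1 x := (Complex.ofRealCLM.hasDerivAt (x := x)).sub_const z
  have h2 := h1.clog_real (Or.inr (by simpa using hz))
  simpa using h2

/-- The principal value of `∫ 1 / (x - z) dx`. -/
lemma tendsto_integral_inv_ofReal_sub {z : ℂ} (hz : z.im ≠ 0) :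
    Tendsto (fun R : ℝ => ∫ x in (-R)..R, ((x : ℂ) - z)⁻¹) atTop
      (𝓝 (Real.sign z.im * Real.pi * Complex.I)) := by
  have hlim : Tendsto (fun R : ℝ => z / (R : ℂ)) atTop (𝓝 0) := by
    refine tendsto_zero_iff_norm_tendsto_zero.2 ?_
    simp only [norm_div, Complex.norm_real]
    exact tendsto_const_nhds.div_atTop (tendsto_norm_atTop_atTop)
  have h1 : Tendsto (fun R : ℝ => Complex.log (1 - z / R)) atTop (𝓝 0) := by
    have hc : ContinuousAt Complex.log 1 := continuousAt_clog (by simp)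
    have := hc.tendsto.comp (by simpa using hlim.const_sub 1 : Tendsto (fun R : ℝ => 1 - z / (R : ℂ)) atTop (𝓝 1))
    simpa [Function.comp_def] using this
  have h2' : Tendsto (fun R : ℝ => -1 - z / (R : ℂ)) atTop (𝓝 (-1)) := by
    simpa using hlim.const_sub (-1)
  have him : ∀ R : ℝ, (-1 - z / (R : ℂ)).im = -(z.im / R) := by
    intro R
    simp [Complex.div_ofReal_im]
  -- The point `-1 - z / R` approaches the branch cut from the side opposite to the sign of `Im z`;
  -- this one-sided limit of the logarithm is the source of `± π i`.
  have h2 : Tendsto (fun R : ℝ => Complex.log (-1 - z / R)) atTop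
      (𝓝 (-(Real.sign z.im * Real.pi * Complex.I))) := by
    rcases lt_or_gt_of_ne hz with h | h
    · have := Complex.tendsto_log_nhdsWithin_im_nonneg_of_re_neg_of_im_zero (z := -1)
        (by simp) (by simp)
      rw [Real.sign_of_neg h]
      have e : -(((-1 : ℝ) : ℂ) * Real.pi * Complex.I) = Real.pi * Complex.I := by simp
      rw [e]
      refine Tendsto.comp (g := Complex.log) (y := 𝓝[{w : ℂ | 0 ≤ w.im}] (-1))
        (by simpa using this) (tendsto_nhdsWithin_iff.2 ⟨h2', ?_⟩)
      filter_upwards [eventually_gt_atTop 0] with R hR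
      simp only [him]
      have := div_neg_of_neg_of_pos h hR
      linarith
    · have := Complex.tendsto_log_nhdsWithin_im_neg_of_re_neg_of_im_zero (z := -1)
        (by simp) (by simp)
      rw [Real.sign_of_pos h]
      have e : -(((1 : ℝ) : ℂ) * Real.pi * Complex.I) = -(Real.pi * Complex.I) := by simp
      rw [e]
      refine Tendsto.comp (g := Complex.log) (y := 𝓝[{w : ℂ | w.im < 0}] (-1))
        (by simpa using this) (tendsto_nhdsWithin_iff.2 ⟨h2', ?_⟩)
      filter_upwards [eventually_gt_atTop 0] with R hR
      simp only [him]
      have := div_pos h hR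
      linarith
  have h3 := h1.sub h2
  rw [zero_sub, neg_neg] at h3
  refine h3.congr' ?_
  filter_upwards [eventually_gt_atTop 0] with R hR
  rw [intervalIntegral_inv_ofReal_sub hz]
  have hR' : (R : ℂ) ≠ 0 := by exact_mod_cast hR.ne'
  have e1 : (R : ℂ) - z = (R : ℂ) * (1 - z / R) := by field_simp
  have e2 : ((-R : ℝ) : ℂ) - z = (R : ℂ) * (-1 - z / R) := by
    push_cast
    field_simp
  rw [e1, e2, Complex.log_ofReal_mul hR, Complex.log_ofReal_mul hR]
  · ring
  · intro h0
    have := him R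
    rw [h0] at this
    have h4 : z.im / R = 0 := by simpa using this.symm
    exact (div_ne_zero hz hR.ne') h4
  · intro h0
    have h4 : (1 - z / (R : ℂ)).im = -(z.im / R) := by simp [Complex.div_ofReal_im]
    rw [h0] at h4
    have h5 : z.im / R = 0 := by simpa using h4.symm
    exact (div_ne_zero hz hR.ne') h5

lemma integrable_inv_mul_inv {z w : ℂ} (hz : z.im ≠ 0) (hw : w.im ≠ 0) :
    Integrable fun x : ℝ => ((x : ℂ) - z)⁻¹ * ((x : ℂ) - w)⁻¹ :=
  MemLp.integrable_mul (p := 2) (q := 2) (memLp_inv_ofReal_sub hz (by norm_num))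
    (memLp_inv_ofReal_sub hw (by norm_num))

/-- Partial fractions turn the product into a difference of two kernels, each of which has a known
principal value. -/
lemma integral_inv_mul_inv {z w : ℂ} (hz : z.im ≠ 0) (hw : w.im ≠ 0) (hzw : z ≠ w) :
    ∫ x : ℝ, ((x : ℂ) - z)⁻¹ * ((x : ℂ) - w)⁻¹ =
      (Real.sign z.im - Real.sign w.im) * Real.pi * Complex.I / (z - w) := by
  have h1 := intervalIntegral_tendsto_integral (integrable_inv_mul_inv hz hw)
    tendsto_neg_atTop_atBot tendsto_id
  have h2 := ((tendsto_integral_inv_ofReal_sub hz).sub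
    (tendsto_integral_inv_ofReal_sub hw)).div_const (z - w)
  refine (tendsto_nhds_unique h1 (h2.congr fun R => ?_)).trans (by ring)
  rw [← intervalIntegral.integral_sub ((continuous_inv_ofReal_sub hz).intervalIntegrable _ _)
    ((continuous_inv_ofReal_sub hw).intervalIntegrable _ _), ← intervalIntegral.integral_div]
  refine intervalIntegral.integral_congr fun x _ => ?_
  have e1 := ofReal_sub_ne_zero hz x
  have e2 := ofReal_sub_ne_zero hw x
  have e3 := sub_ne_zero.2 hzw
  field_simp
  ring

/-! ### Poisson integrals of continuous functions with compact support -/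

/-- The Cauchy distribution, with density `1 / (π (1 + s²))`. -/
def cauchyLaw : Measure ℝ := ProbabilityTheory.cauchyMeasure 0 1

instance : IsProbabilityMeasure cauchyLaw := by
  unfold cauchyLaw
  infer_instance

lemma integral_cauchyLaw (g : ℝ → ℂ) :
    ∫ s, g s ∂cauchyLaw = ∫ s : ℝ, (Real.pi⁻¹ * (s ^ 2 + 1)⁻¹) • g s := by
  rw [cauchyLaw, ProbabilityTheory.cauchyMeasure_of_scale_ne_zero _ one_ne_zero,
    integral_withDensity_eq_integral_toReal_smul (by fun_prop)
      (ae_of_all _ fun x => by simp [ProbabilityTheory.cauchyPDF])]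
  refine integral_congr_ae (ae_of_all _ fun s => ?_)
  simp only [ProbabilityTheory.cauchyPDF]
  rw [ENNReal.toReal_ofReal (ProbabilityTheory.cauchyPDF_pos 0 one_ne_zero s).le]
  simp [ProbabilityTheory.cauchyPDFReal_def]

/-- The Poisson integral `k ↦ ∫ h(k + ε s) / (π (1 + s²)) ds`. -/
def poisson (ε : ℝ) (h : ℝ → ℂ) (k : ℝ) : ℂ := ∫ s, h (k + ε * s) ∂cauchyLaw

/-- Minkowski's inequality for averages with respect to a probability measure, as a consequence of
Jensen's inequality. -/
lemma eLpNorm_integral_rpow_le {ν : Measure ℝ} [IsProbabilityMeasure ν] {H : ℝ → ℝ → ℂ}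
    (hH : Continuous (Function.uncurry H)) {p : ℝ≥0∞} (hp : 1 ≤ p) (hp' : p ≠ ∞) :
    eLpNorm (fun k => ∫ s, H k s ∂ν) p volume ^ p.toReal ≤
      ∫⁻ s, eLpNorm (fun k => H k s) p volume ^ p.toReal ∂ν := by
  have hp0 : p ≠ 0 := (zero_lt_one.trans_le hp).ne'
  have hpr : 0 < p.toReal := ENNReal.toReal_pos hp0 hp'
  have hpow : ∀ {μ : Measure ℝ} (g : ℝ → ℂ),
      eLpNorm g p μ ^ p.toReal = ∫⁻ x, ‖g x‖ₑ ^ p.toReal ∂μ := by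
    intro μ g
    rw [eLpNorm_eq_lintegral_rpow_enorm_toReal hp0 hp', ← ENNReal.rpow_mul,
      one_div_mul_cancel hpr.ne', ENNReal.rpow_one]
  simp only [hpow]
  rw [← lintegral_lintegral_swap (f := fun k s => ‖H k s‖ₑ ^ p.toReal)
    (Continuous.aemeasurable (by
      simp only [Function.uncurry_def] at hH ⊢
      exact ENNReal.continuous_rpow_const.comp hH.enorm))]
  refine lintegral_mono fun k => ?_
  rw [← hpow]
  have hk : Continuous (H k) := hH.comp (by fun_prop : Continuous fun s => (k, s))
  gcongr
  refine le_trans ?_ (eLpNorm_le_eLpNorm_of_exponent_le hp hk.aestronglyMeasurable)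
  rw [eLpNorm_one_eq_lintegral_enorm]
  exact enorm_integral_le_lintegral_enorm _

lemma eLpNorm_translate {h : ℝ → ℂ} (hc : Continuous h) (p : ℝ≥0∞) (t : ℝ) :
    eLpNorm (fun k => h (k + t)) p volume = eLpNorm h p volume :=
  eLpNorm_comp_measurePreserving hc.aestronglyMeasurable
    (measurePreserving_add_right (volume : Measure ℝ) t)

lemma continuous_poisson_integrand {h : ℝ → ℂ} (hc : Continuous h) (ε : ℝ) :
    Continuous (Function.uncurry fun k s : ℝ => h (k + ε * s)) := by
  simp only [Function.uncurry_def]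
  fun_prop

lemma eLpNorm_poisson_le {h : ℝ → ℂ} (hc : Continuous h) {p : ℝ≥0∞} (hp : 1 ≤ p) (hp' : p ≠ ∞)
    (ε : ℝ) : eLpNorm (poisson ε h) p volume ≤ eLpNorm h p volume := by
  have hpr : 0 < p.toReal := ENNReal.toReal_pos (zero_lt_one.trans_le hp).ne' hp'
  have h1 := eLpNorm_integral_rpow_le (ν := cauchyLaw) (continuous_poisson_integrand hc ε) hp hp'
  simp only [eLpNorm_translate hc, lintegral_const, measure_univ, mul_one] at h1
  exact (ENNReal.rpow_le_rpow_iff hpr).1 h1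

/-- Continuity of translations in `L^p`, the input for the approximate identity given by the Poisson
kernel. -/
lemma tendsto_eLpNorm_translate_sub {h : ℝ → ℂ} (hc : Continuous h) (hs : HasCompactSupport h)
    {p : ℝ≥0∞} (hp : 1 ≤ p) (hp' : p ≠ ∞) :
    Tendsto (fun t => eLpNorm (fun k => h (k + t) - h k) p volume) (𝓝 0) (𝓝 0) := by
  have : Fact (1 ≤ p) := ⟨hp⟩
  have hmem : MemLp h p volume := hc.memLp_of_hasCompactSupport hs
  have h1 := Filter.Tendsto.compMeasurePreservingLp (μ := (volume : Measure ℝ))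
    (ν := (volume : Measure ℝ)) (l := 𝓝 (0 : ℝ))
    (f := fun _ => hmem.toLp h) (f₀ := hmem.toLp h)
    (g := fun t => (⟨fun k => k + t, by fun_prop⟩ : C(ℝ, ℝ)))
    (g₀ := (⟨fun k => k + 0, by fun_prop⟩ : C(ℝ, ℝ))) tendsto_const_nhds
    ((ContinuousMap.continuous_of_continuous_uncurry _
      (by simp only [Function.uncurry_def]; exact continuous_snd.add continuous_fst)).tendsto 0)
    (fun t => measurePreserving_add_right volume t) (measurePreserving_add_right volume 0) hp'
  rw [Lp.tendsto_Lp_iff_tendsto_eLpNorm'] at h1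
  refine h1.congr fun t => eLpNorm_congr_ae ?_
  have e1 : ∀ t : ℝ, (Lp.compMeasurePreserving (fun k => k + t)
      (measurePreserving_add_right volume t) (hmem.toLp h)) =ᵐ[volume] fun k => h (k + t) := by
    intro t
    refine (Lp.coeFn_compMeasurePreserving _ _).trans ?_
    exact (measurePreserving_add_right volume t).quasiMeasurePreserving.ae_eq hmem.coeFn_toLp
  filter_upwards [e1 t, e1 0] with k h2 h3
  simp only [Pi.sub_apply]
  erw [h2, h3]
  simp

/-- The Poisson integral averages translates, so Minkowski's inequality bounds the error by the
average over `s` of the translation errors by `ε s`. These tend to `0` and are dominated by twice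
the norm of `h`. -/
lemma tendsto_eLpNorm_poisson_sub {h : ℝ → ℂ} (hc : Continuous h) (hs : HasCompactSupport h)
    {p : ℝ≥0∞} (hp : 1 ≤ p) (hp' : p ≠ ∞) :
    Tendsto (fun ε => eLpNorm (fun k => poisson ε h k - h k) p volume) (𝓝 0) (𝓝 0) := by
  have hp0 : p ≠ 0 := (zero_lt_one.trans_le hp).ne'
  have hpr : 0 < p.toReal := ENNReal.toReal_pos hp0 hp'
  have hmem : MemLp h p volume := hc.memLp_of_hasCompactSupport hs
  have hcont : ∀ ε : ℝ, Continuous (Function.uncurry fun k s : ℝ => h (k + ε * s) - h k) := by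
    intro ε
    simp only [Function.uncurry_def]
    fun_prop
  have hbdd := hs.exists_bound_of_continuous hc
  obtain ⟨C, hC⟩ := hbdd
  have hle : ∀ ε, eLpNorm (fun k => poisson ε h k - h k) p volume ^ p.toReal ≤
      ∫⁻ s, eLpNorm (fun k => h (k + ε * s) - h k) p volume ^ p.toReal ∂cauchyLaw := by
    intro ε
    refine le_trans (le_of_eq ?_) (eLpNorm_integral_rpow_le (hcont ε) hp hp')
    congr 2
    ext k
    rw [integral_sub]
    · simp [poisson]
    · refine Integrable.of_bound (Continuous.aestronglyMeasurable (by fun_prop)) C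
        (ae_of_all _ fun s => hC _)
    · exact integrable_const _
  have hlim : Tendsto (fun ε : ℝ => ∫⁻ s, eLpNorm (fun k => h (k + ε * s) - h k) p volume ^ p.toReal
      ∂cauchyLaw) (𝓝 0) (𝓝 (∫⁻ _, 0 ∂cauchyLaw)) := by
    refine tendsto_lintegral_filter_of_dominated_convergence'
      (fun _ => (2 * eLpNorm h p volume) ^ p.toReal) ?_ ?_ ?_ ?_
    · refine Eventually.of_forall fun ε => ?_
      have hpow : ∀ g : ℝ → ℂ,
          eLpNorm g p volume ^ p.toReal = ∫⁻ x, ‖g x‖ₑ ^ p.toReal := by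
        intro g
        rw [eLpNorm_eq_lintegral_rpow_enorm_toReal hp0 hp', ← ENNReal.rpow_mul,
          one_div_mul_cancel hpr.ne', ENNReal.rpow_one]
      simp only [hpow]
      refine (Measurable.lintegral_prod_left'
        (f := fun q : ℝ × ℝ => ‖h (q.1 + ε * q.2) - h q.1‖ₑ ^ p.toReal) ?_).aemeasurable
      exact (ENNReal.continuous_rpow_const.comp (hcont ε).enorm).measurable
    · refine Eventually.of_forall fun ε => ae_of_all _ fun s => ?_
      gcongr
      refine (eLpNorm_sub_le (Continuous.aestronglyMeasurable (by fun_prop))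
        hc.aestronglyMeasurable hp).trans ?_
      rw [eLpNorm_translate hc, two_mul]
    · simpa using (ENNReal.rpow_lt_top_of_nonneg hpr.le
        (ENNReal.mul_lt_top (by simp) hmem.2).ne).ne
    · refine ae_of_all _ fun s => ?_
      have h1 : Tendsto (fun ε : ℝ => ε * s) (𝓝 0) (𝓝 0) := by
        have : Continuous fun ε : ℝ => ε * s := by fun_prop
        simpa using this.tendsto 0
      have h2 := ((tendsto_eLpNorm_translate_sub hc hs hp hp').comp h1)
      have h3 := (ENNReal.continuous_rpow_const (y := p.toReal)).tendsto 0 |>.comp h2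
      simpa [hpr, Function.comp_def] using h3
  rw [lintegral_zero] at hlim
  have h1 := tendsto_of_tendsto_of_tendsto_of_le_of_le tendsto_const_nhds hlim
    (fun _ => zero_le) hle
  have h2 := (ENNReal.continuous_rpow_const (y := p.toReal⁻¹)).tendsto 0 |>.comp h1
  have h3 : ∀ x : ℝ≥0∞, (x ^ p.toReal) ^ p.toReal⁻¹ = x := fun x =>
    ENNReal.rpow_rpow_inv hpr.ne' x
  simpa [Function.comp_def, h3, hpr] using h2

/-- The approximation `± (2 π i)⁻¹ ∫ f(x) / (x - (k ± i ε)) dx` of a Riesz projection. -/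
def rieszApprox (s : ℝ) (f : ℝ → ℂ) (ε k : ℝ) : ℂ :=
  (s : ℂ) / (2 * Real.pi * Complex.I) *
    cauchyTransform f ((k : ℂ) + (s : ℂ) * (ε : ℂ) * Complex.I)

lemma poisson_eq_integral (h : ℝ → ℂ) {ε : ℝ} (hε : 0 < ε) (k : ℝ) :
    poisson ε h k = ∫ y : ℝ, h y * (ε / Real.pi * ((y - k) ^ 2 + ε ^ 2)⁻¹ : ℝ) := by
  rw [poisson, integral_cauchyLaw]
  have h1 := Measure.integral_comp_mul_left (fun t : ℝ => h (k + t) *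
    (ε / Real.pi * ((k + t - k) ^ 2 + ε ^ 2)⁻¹ : ℝ)) ε
  rw [integral_add_left_eq_self (fun y => h y * (ε / Real.pi * ((y - k) ^ 2 + ε ^ 2)⁻¹ : ℝ)) k,
    abs_of_pos (inv_pos.2 hε)] at h1
  have h2 : ∫ y : ℝ, h y * (ε / Real.pi * ((y - k) ^ 2 + ε ^ 2)⁻¹ : ℝ) =
    ε • ∫ x : ℝ, h (k + ε * x) * (ε / Real.pi * ((k + ε * x - k) ^ 2 + ε ^ 2)⁻¹ : ℝ) := by
    rw [h1, smul_smul, mul_inv_cancel₀ hε.ne', one_smul]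
  rw [h2, ← integral_smul]
  refine integral_congr_ae (ae_of_all _ fun s => ?_)
  have e : Real.pi⁻¹ * (s ^ 2 + 1)⁻¹ =
      ε * (ε / Real.pi * ((k + ε * s - k) ^ 2 + ε ^ 2)⁻¹) := by
    have : (k + ε * s - k) ^ 2 + ε ^ 2 = ε ^ 2 * (s ^ 2 + 1) := by ring
    rw [this]
    have : s ^ 2 + 1 ≠ 0 := by positivity
    field_simp
  simp only [e, Complex.real_smul]
  push_cast
  ring

lemma poissonKernel_eq {ε : ℝ} (hε : 0 < ε) (y k : ℝ) :
    ((ε / Real.pi * ((y - k) ^ 2 + ε ^ 2)⁻¹ : ℝ) : ℂ) = 1 / (2 * Real.pi * Complex.I) *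
      (((y : ℂ) - (k + ε * Complex.I))⁻¹ - ((y : ℂ) - (k - ε * Complex.I))⁻¹) := by
  have h1 := ofReal_sub_ne_zero (z := k + ε * Complex.I) (by simpa using hε.ne') y
  have h2 := ofReal_sub_ne_zero (z := k - ε * Complex.I) (by simpa using hε.ne') y
  have h3 : ((y : ℂ) - k) ^ 2 + (ε : ℂ) ^ 2 =
      ((y : ℂ) - (k + ε * Complex.I)) * ((y : ℂ) - (k - ε * Complex.I)) := by
    linear_combination ((ε : ℂ) ^ 2) * Complex.I_sq
  push_cast
  rw [h3]
  have hpi : (Real.pi : ℂ) ≠ 0 := by exact_mod_cast Real.pi_ne_zero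
  field_simp [Complex.I_ne_zero]
  ring

/-- The jump of the Cauchy kernel across the real line, divided by `2πi`, is the Poisson kernel. In
the limit this becomes `P₊ + P₋ = 1`. -/
lemma poisson_eq_rieszApprox {h : ℝ → ℂ} (hh : CauchyIntegrable h) {ε : ℝ} (hε : 0 < ε) (k : ℝ) :
    poisson ε h k = rieszApprox 1 h ε k + rieszApprox (-1) h ε k := by
  rw [poisson_eq_integral h hε]
  simp only [poissonKernel_eq hε, rieszApprox, cauchyTransform]
  have e1 : ((k : ℂ) + ε * Complex.I).im ≠ 0 := by simpa using hε.ne'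
  have e2 : ((k : ℂ) - ε * Complex.I).im ≠ 0 := by simpa using hε.ne'
  have h1 := (hh.integrable e1).sub (hh.integrable e2)
  have : ∀ y : ℝ, h y * (1 / (2 * Real.pi * Complex.I) *
      (((y : ℂ) - (k + ε * Complex.I))⁻¹ - ((y : ℂ) - (k - ε * Complex.I))⁻¹)) =
      1 / (2 * Real.pi * Complex.I) * (h y / ((y : ℂ) - (k + ε * Complex.I)) -
        h y / ((y : ℂ) - (k - ε * Complex.I))) := fun y => by ring
  simp only [this]
  rw [integral_const_mul, integral_sub (hh.integrable e1) (hh.integrable e2)]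
  push_cast
  simp only [neg_mul, one_mul, ← sub_eq_add_neg]
  ring

lemma cauchyIntegrable_of_continuous {h : ℝ → ℂ} (hc : Continuous h) (hs : HasCompactSupport h) :
    CauchyIntegrable h :=
  cauchyIntegrable_of_memLp le_rfl ENNReal.one_ne_top (hc.memLp_of_hasCompactSupport hs)

/-- The Cauchy transform of a Poisson integral. -/
lemma cauchyTransform_poisson {h : ℝ → ℂ} (hc : Continuous h) (hs : HasCompactSupport h)
    {ε : ℝ} (hε : 0 < ε) {z : ℂ} (hz : z.im ≠ 0) :
    cauchyTransform (poisson ε h) z =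
      cauchyTransform h (z + Real.sign z.im * ε * Complex.I) := by
  have hL1 : Integrable h := hc.integrable_of_hasCompactSupport hs
  have hQ : Integrable fun t : ℝ => ((ε / Real.pi * (t ^ 2 + ε ^ 2)⁻¹ : ℝ) : ℂ) := by
    have h1 : Integrable fun t : ℝ => (1 / (2 * Real.pi * Complex.I) * (2 * ε * Complex.I)) *
        (((t : ℂ) - ε * Complex.I)⁻¹ * ((t : ℂ) - (-ε * Complex.I))⁻¹) :=
      (integrable_inv_mul_inv (by simpa using hε.ne') (by simpa using hε.ne')).const_mul _
    refine h1.congr (ae_of_all _ fun t => ?_)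
    have h2 := poissonKernel_eq hε t 0
    simp only [sub_zero, Complex.ofReal_zero, zero_add] at h2
    simp only
    rw [h2]
    have e1 := ofReal_sub_ne_zero (z := ε * Complex.I) (by simpa using hε.ne') t
    have e2 := ofReal_sub_ne_zero (z := -ε * Complex.I) (by simpa using hε.ne') t
    have e3 : (t : ℂ) - (0 - ε * Complex.I) = t - (-ε * Complex.I) := by ring
    rw [e3, inv_sub_inv e1 e2,
      show (t : ℂ) - (-ε * Complex.I) - (t - ε * Complex.I) = 2 * ε * Complex.I by ring,
      div_eq_mul_inv (2 * (ε : ℂ) * Complex.I), mul_inv]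
    ring
  have hprod := (hL1.convolution_integrand (ContinuousLinearMap.mul ℂ ℂ) hQ).mul_bdd
    (g := fun q : ℝ × ℝ => ((q.1 : ℂ) - z)⁻¹) (c := |z.im|⁻¹)
    (((continuous_inv_ofReal_sub hz).comp continuous_fst).aestronglyMeasurable)
    (ae_of_all _ fun q => norm_inv_ofReal_sub_le hz q.1)
  have hswap := integral_integral_swap (f := fun x y : ℝ => h y *
    ((ε / Real.pi * ((x - y) ^ 2 + ε ^ 2)⁻¹ : ℝ) : ℂ) * ((x : ℂ) - z)⁻¹) (by
      simpa [Function.uncurry_def] using hprod)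
  have e1 : cauchyTransform (poisson ε h) z = ∫ x : ℝ, ∫ y : ℝ, h y *
      ((ε / Real.pi * ((x - y) ^ 2 + ε ^ 2)⁻¹ : ℝ) : ℂ) * ((x : ℂ) - z)⁻¹ := by
    refine integral_congr_ae (ae_of_all _ fun x => ?_)
    simp only
    rw [integral_mul_const, poisson_eq_integral h hε, div_eq_mul_inv]
    simp only [sub_sq_comm x]
  rw [e1, hswap]
  -- The null set removed here is where `y ± i ε` could coincide with `z`, a case excluded from
  -- `integral_inv_mul_inv`.
  have hne : ∀ᵐ y : ℝ, y ≠ z.re := by simp [ae_iff]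
  refine integral_congr_ae (hne.mono fun y hy => ?_)
  simp only [mul_assoc (h y), div_eq_mul_inv (h y)]
  rw [integral_const_mul]
  congr 1
  have i1 : ((y : ℂ) + ε * Complex.I).im ≠ 0 := by simpa using hε.ne'
  have i2 : ((y : ℂ) - ε * Complex.I).im ≠ 0 := by simpa using hε.ne'
  have n1 : (y : ℂ) + ε * Complex.I ≠ z := fun h => hy (by simp [← h])
  have n2 : (y : ℂ) - ε * Complex.I ≠ z := fun h => hy (by simp [← h])
  have j1 := integral_inv_mul_inv i1 hz n1
  have j2 := integral_inv_mul_inv i2 hz n2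
  have e2 : ∀ x : ℝ, ((ε / Real.pi * ((x - y) ^ 2 + ε ^ 2)⁻¹ : ℝ) : ℂ) * ((x : ℂ) - z)⁻¹ =
      1 / (2 * Real.pi * Complex.I) * (((x : ℂ) - (y + ε * Complex.I))⁻¹ * ((x : ℂ) - z)⁻¹ -
        ((x : ℂ) - (y - ε * Complex.I))⁻¹ * ((x : ℂ) - z)⁻¹) := by
    intro x
    rw [poissonKernel_eq hε]
    ring
  rw [integral_congr_ae (ae_of_all _ e2)]
  rw [integral_const_mul, integral_sub (integrable_inv_mul_inv i1 hz)
    (integrable_inv_mul_inv i2 hz), j1, j2]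
  have s1 : Real.sign ((y : ℂ) + ε * Complex.I).im = 1 := Real.sign_of_pos (by simpa using hε)
  have s2 : Real.sign ((y : ℂ) - ε * Complex.I).im = -1 := Real.sign_of_neg (by simpa using hε)
  rw [s1, s2]
  have hpi : (Real.pi : ℂ) ≠ 0 := by exact_mod_cast Real.pi_ne_zero
  have m1 := sub_ne_zero.2 n1
  have m2 := sub_ne_zero.2 n2
  rcases lt_or_gt_of_ne hz with h | h
  · rw [Real.sign_of_neg h]
    have e3 : (y : ℂ) - (z + ((-1 : ℝ) : ℂ) * ε * Complex.I) = y + ε * Complex.I - z := by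
      push_cast; ring
    rw [e3]
    push_cast
    field_simp [Complex.I_ne_zero]
    ring
  · rw [Real.sign_of_pos h]
    have e3 : (y : ℂ) - (z + ((1 : ℝ) : ℂ) * ε * Complex.I) = y - ε * Complex.I - z := by
      push_cast; ring
    rw [e3]
    push_cast
    field_simp [Complex.I_ne_zero]
    ring

/-! ### Injectivity of the Cauchy transform -/

lemma tendsto_poisson {g : ℝ → ℂ} (hc : Continuous g) {C : ℝ} (hC : ∀ x, ‖g x‖ ≤ C) (k : ℝ) :
    Tendsto (fun ε => poisson ε g k) (𝓝 0) (𝓝 (g k)) := by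
  have h1 : ∫ _ : ℝ, g k ∂cauchyLaw = g k := by simp
  rw [← h1]
  refine tendsto_integral_filter_of_dominated_convergence (fun _ => C)
    (Eventually.of_forall fun ε => Continuous.aestronglyMeasurable (by fun_prop))
    (Eventually.of_forall fun ε => ae_of_all _ fun s => hC _) (integrable_const _)
    (ae_of_all _ fun s => ?_)
  have : Continuous fun ε : ℝ => g (k + ε * s) := by fun_prop
  simpa using this.tendsto 0

lemma norm_poisson_le {g : ℝ → ℂ} {C : ℝ} (hC : ∀ x, ‖g x‖ ≤ C) (ε k : ℝ) :
    ‖poisson ε g k‖ ≤ C := by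
  have := norm_integral_le_of_norm_le_const (μ := cauchyLaw)
    (ae_of_all _ fun s => hC (k + ε * s))
  simpa [poisson] using this

lemma continuous_poisson {g : ℝ → ℂ} (hc : Continuous g) {C : ℝ} (hC : ∀ x, ‖g x‖ ≤ C) (ε : ℝ) :
    Continuous (poisson ε g) :=
  continuous_of_dominated (fun k => Continuous.aestronglyMeasurable (by fun_prop))
    (fun k => ae_of_all _ fun s => hC _) (integrable_const C) (ae_of_all _ fun s => by fun_prop)

/-- The Cauchy transform and minus the Cauchy transform at the conjugate point are adjoint. -/
lemma integral_mul_cauchyTransform {f g : ℝ → ℂ} {w : ℂ}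
    (hfg : Integrable (fun q : ℝ × ℝ => f q.1 * g q.2 * ((q.2 : ℂ) - q.1 - w)⁻¹)
      (volume.prod volume)) :
    ∫ k : ℝ, f k * cauchyTransform g (k + w) = -∫ y : ℝ, g y * cauchyTransform f (y - w) := by
  have h1 := integral_integral_swap
    (f := fun k y : ℝ => f k * g y * ((y : ℂ) - k - w)⁻¹) (by simpa [Function.uncurry_def] using hfg)
  have e1 : ∀ k : ℝ, ∫ y : ℝ, f k * g y * ((y : ℂ) - k - w)⁻¹ =
      f k * cauchyTransform g (k + w) := by
    intro k
    rw [cauchyTransform, ← integral_const_mul]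
    refine integral_congr_ae (ae_of_all _ fun y => ?_)
    simp only [div_eq_mul_inv, mul_assoc, sub_sub]
  have e2 : ∀ y : ℝ, ∫ k : ℝ, f k * g y * ((y : ℂ) - k - w)⁻¹ =
      -(g y * cauchyTransform f (y - w)) := by
    intro y
    rw [cauchyTransform, ← integral_const_mul, ← integral_neg]
    refine integral_congr_ae (ae_of_all _ fun k => ?_)
    have : (y : ℂ) - k - w = -(k - (y - w)) := by ring
    simp only [this, inv_neg, div_eq_mul_inv]
    ring
  simp only [e1, e2, integral_neg] at h1
  exact h1

/-- Test against `g` smooth with compact support. Fubini moves the Cauchy kernel from `g` to `f`, so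
`∫ f · (Poisson integral of g) = 0`, and `ε ↓ 0` gives `∫ f g = 0`. Only small `ε` matter, so
vanishing in the strip `|Im z| < 1` suffices; the general case relies on this to avoid the point
`i`. -/
lemma ae_eq_zero_of_cauchyTransform_eq_zero_of_integrable {f : ℝ → ℂ} (hf : Integrable f)
    (h0 : ∀ z : ℂ, z.im ≠ 0 → |z.im| < 1 → cauchyTransform f z = 0) : f =ᵐ[volume] 0 := by
  refine ae_eq_zero_of_integral_contDiff_smul_eq_zero hf.locallyIntegrable fun g' hg' hs' => ?_
  set g : ℝ → ℂ := fun x => g' x with hg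
  have hc : Continuous g := Complex.continuous_ofReal.comp hg'.continuous
  have hs : HasCompactSupport g := hs'.comp_left (g := fun x : ℝ => (x : ℂ)) (by simp)
  obtain ⟨C, hC⟩ := hs.exists_bound_of_continuous hc
  have hgi : Integrable g := hc.integrable_of_hasCompactSupport hs
  have hlim : Tendsto (fun ε => ∫ k, f k * poisson ε g k) (𝓝[>] 0) (𝓝 (∫ k, f k * g k)) := by
    refine tendsto_integral_filter_of_dominated_convergence (fun k => ‖f k‖ * C)
      (Eventually.of_forall fun ε =>
        hf.aestronglyMeasurable.mul (continuous_poisson hc hC ε).aestronglyMeasurable)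
      (Eventually.of_forall fun ε => ae_of_all _ fun k => ?_) (hf.norm.mul_const _)
      (ae_of_all _ fun k => ((tendsto_poisson hc hC k).mono_left nhdsWithin_le_nhds).const_mul _)
    rw [norm_mul]
    gcongr
    exact norm_poisson_le hC ε k
  have hint : ∀ w : ℂ, w.im ≠ 0 → Integrable
      (fun q : ℝ × ℝ => f q.1 * g q.2 * ((q.2 : ℂ) - q.1 - w)⁻¹) (volume.prod volume) := by
    intro w hw
    have hne : ∀ q : ℝ × ℝ, (q.2 : ℂ) - q.1 - w = ((q.2 - q.1 : ℝ) : ℂ) - w := fun q => by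
      push_cast; rfl
    simp only [hne]
    exact (hf.mul_prod hgi).mul_bdd (c := |w.im|⁻¹)
      ((continuous_inv_ofReal_sub hw).comp (by fun_prop)).aestronglyMeasurable
      (ae_of_all _ fun q => norm_inv_ofReal_sub_le hw _)
  have hzero : ∀ᶠ ε in 𝓝[>] (0 : ℝ), ∫ k, f k * poisson ε g k = 0 := by
    filter_upwards [Ioo_mem_nhdsGT (zero_lt_one : (0 : ℝ) < 1)] with ε hε
    have hgc := cauchyIntegrable_of_continuous hc hs
    have key : ∀ s : ℝ, |s| = 1 → Integrable (fun k => f k * rieszApprox s g ε k) ∧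
        ∫ k, f k * rieszApprox s g ε k = 0 := by
      intro s hs1
      have him : ((s : ℂ) * ε * Complex.I).im = s * ε := by simp
      have habs : |s * ε| = ε := by rw [abs_mul, hs1, one_mul, abs_of_pos hε.1]
      have hw : ((s : ℂ) * ε * Complex.I).im ≠ 0 := by
        rw [him]
        exact abs_pos.1 (hε.1.trans_eq habs.symm)
      have e : ∀ k, f k * rieszApprox s g ε k = (s : ℂ) / (2 * Real.pi * Complex.I) *
          (f k * cauchyTransform g (k + (s : ℂ) * ε * Complex.I)) := fun k => by
        rw [rieszApprox]; ring
      simp only [e]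
      constructor
      · refine Integrable.const_mul ?_ _
        have := (hint _ hw).integral_prod_left
        refine this.congr (ae_of_all _ fun k => ?_)
        simp only [cauchyTransform, ← integral_const_mul]
        refine integral_congr_ae (ae_of_all _ fun y => ?_)
        simp only [div_eq_mul_inv, mul_assoc, sub_sub]
      · rw [integral_const_mul, integral_mul_cauchyTransform (hint _ hw)]
        have : ∀ y : ℝ, cauchyTransform f (y - (s : ℂ) * ε * Complex.I) = 0 := by
          intro y
          have e : ((y : ℂ) - (s : ℂ) * ε * Complex.I).im = -(s * ε) := by simp
          refine h0 _ ?_ ?_ <;> rw [e]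
          · rw [him] at hw
            exact neg_ne_zero.2 hw
          · rw [abs_neg, habs]
            exact hε.2
        simp [this]
    simp only [poisson_eq_rieszApprox hgc hε.1, mul_add]
    rw [integral_add (key 1 (by simp)).1 (key (-1) (by simp)).1, (key 1 (by simp)).2,
      (key (-1) (by simp)).2, add_zero]
  have := tendsto_nhds_unique (hlim.congr' hzero) tendsto_const_nhds
  rw [← this]
  refine integral_congr_ae (ae_of_all _ fun x => ?_)
  simp [hg, mul_comm]

/-- A function whose Cauchy transform vanishes off the real line vanishes almost everywhere. -/
lemma ae_eq_zero_of_cauchyTransform_eq_zero {f : ℝ → ℂ} (hf : CauchyIntegrable f)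
    (h0 : ∀ z : ℂ, z.im ≠ 0 → cauchyTransform f z = 0) : f =ᵐ[volume] 0 := by
  have hI : Complex.I.im ≠ 0 := by simp
  -- Division by `x - i` makes the function integrable, and partial fractions express its Cauchy
  -- transform at `z ≠ i` through `C f(z) - C f(i) = 0`.
  have h1 : (fun x : ℝ => f x / ((x : ℂ) - Complex.I)) =ᵐ[volume] 0 := by
    refine ae_eq_zero_of_cauchyTransform_eq_zero_of_integrable hf fun z hz hz1 => ?_
    have hzI : z - Complex.I ≠ 0 := by
      intro h
      rw [sub_eq_zero.1 h] at hz1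
      simp at hz1
    have h2 : ∀ x : ℝ, f x / ((x : ℂ) - Complex.I) / ((x : ℂ) - z) =
        (z - Complex.I)⁻¹ * (f x / ((x : ℂ) - z) - f x / ((x : ℂ) - Complex.I)) := by
      intro x
      have e1 := ofReal_sub_ne_zero hz x
      have e2 := ofReal_sub_ne_zero hI x
      field_simp
      ring
    simp only [cauchyTransform, h2]
    rw [integral_const_mul, integral_sub (hf.integrable hz) (hf.integrable hI)]
    have e1 := h0 z hz
    have e2 := h0 _ hI
    rw [cauchyTransform] at e1 e2
    simp [e1, e2]
  filter_upwards [h1] with x hx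
  simpa [ofReal_sub_ne_zero hI x] using hx

/-! ### Contour integrals in a half-plane -/

lemma norm_ge_of_le_im {b : ℝ} {z : ℂ} (h : b ≤ z.im) : b ≤ ‖z‖ :=
  h.trans ((le_abs_self _).trans (Complex.abs_im_le_norm z))

/-- The integral along a horizontal line of a function which is holomorphic above this line and
decays quadratically vanishes. -/
lemma integral_horizontal_eq_zero {G : ℂ → ℂ} {b C r : ℝ} (hb : 0 ≤ b)
    (hG : DifferentiableOn ℂ G {z | b ≤ z.im})
    (hi : Integrable fun x : ℝ => G (x + b * Complex.I))
    (hC : ∀ z : ℂ, b ≤ z.im → r ≤ ‖z‖ → ‖G z‖ ≤ C / ‖z‖ ^ 2) :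
    ∫ x : ℝ, G (x + b * Complex.I) = 0 := by
  have h1 := intervalIntegral_tendsto_integral hi tendsto_neg_atTop_atBot tendsto_id
  refine tendsto_nhds_unique h1 (squeeze_zero_norm' (a := fun R : ℝ => 4 * C / R) ?_
    (tendsto_const_nhds.div_atTop tendsto_id))
  filter_upwards [eventually_gt_atTop 0, eventually_ge_atTop r] with R hR hrR
  have hCR : ∀ z : ℂ, b ≤ z.im → R ≤ ‖z‖ → ‖G z‖ ≤ C / R ^ 2 := by
    intro z hz hRz
    have h2 := hC z hz (hrR.trans hRz)
    have hz0 : 0 < ‖z‖ := hR.trans_le hRz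
    have hC0 : 0 ≤ C := by
      have h3 := (norm_nonneg _).trans h2
      by_contra hneg
      exact absurd (div_neg_of_neg_of_pos (not_le.1 hneg) (pow_pos hz0 2)) (not_lt.2 h3)
    exact h2.trans (by gcongr)
  -- The rectangle has base `[-R, R] + i b` and height `R`. On its other three sides, of lengths
  -- `2R`, `R`, `R`, the modulus of the variable is at least `R`, so they contribute at most `4R · C
  -- / R²`.
  have hrect := Complex.integral_boundary_rect_eq_zero_of_differentiableOn G
    ⟨-R, b⟩ ⟨R, b + R⟩ (hG.mono (by
      intro z hz
      have := hz.2
      rw [Set.mem_preimage, Set.uIcc_of_le (by simpa using hR.le)] at this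
      exact this.1))
  simp only at hrect
  have hT : ‖∫ x : ℝ in (-R)..R, G (x + (b + R : ℝ) * Complex.I)‖ ≤ C / R ^ 2 * |R - -R| := by
    refine intervalIntegral.norm_integral_le_of_norm_le_const fun x _ => hCR _ ?_ ?_
    · simp [hR.le]
    · exact norm_ge_of_le_im (by simp [hb])
  have hS : ∀ c : ℝ, |c| = R →
      ‖∫ y : ℝ in b..(b + R), G (c + y * Complex.I)‖ ≤ C / R ^ 2 * |b + R - b| := by
    intro c hc
    refine intervalIntegral.norm_integral_le_of_norm_le_const fun y hy => hCR _ ?_ ?_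
    · rw [Set.uIoc_of_le (by linarith)] at hy
      simpa using hy.1.le
    · have := Complex.abs_re_le_norm ((c : ℂ) + y * Complex.I)
      simpa [hc] using this
  have hR1 := hS R (abs_of_pos hR)
  have hR2 := hS (-R) (by rw [abs_neg, abs_of_pos hR])
  have e : (∫ x : ℝ in (-R)..R, G (x + b * Complex.I)) =
      (∫ x : ℝ in (-R)..R, G (x + (b + R : ℝ) * Complex.I)) -
      Complex.I • (∫ y : ℝ in b..(b + R), G (R + y * Complex.I)) +
      Complex.I • (∫ y : ℝ in b..(b + R), G ((-R : ℝ) + y * Complex.I)) := by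
    linear_combination hrect
  simp only [id]
  rw [e]
  have h4 := (norm_add_le _ _).trans (add_le_add_left (norm_sub_le
    (∫ x : ℝ in (-R)..R, G (x + (b + R : ℝ) * Complex.I))
    (Complex.I • (∫ y : ℝ in b..(b + R), G (R + y * Complex.I))))
    ‖Complex.I • (∫ y : ℝ in b..(b + R), G ((-R : ℝ) + y * Complex.I))‖)
  refine h4.trans ?_
  rw [norm_smul, norm_smul, Complex.norm_I, one_mul, one_mul]
  have a1 : |R - -R| = 2 * R := by rw [abs_of_pos] <;> linarith
  have a2 : |b + R - b| = R := by rw [add_sub_cancel_left, abs_of_pos hR]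
  rw [a1] at hT
  rw [a2] at hR1 hR2
  have e5 : C / R ^ 2 * (2 * R) + C / R ^ 2 * R + C / R ^ 2 * R = 4 * C / R := by
    field_simp
    ring
  linarith

lemma ofReal_add_sub_eq (x b : ℝ) (z : ℂ) :
    (x : ℂ) + b * Complex.I - z = x - (z - b * Complex.I) := by ring

lemma norm_le_two_mul_norm_sub {t z : ℂ} {r : ℝ} (hz : ‖z‖ ≤ r) (ht : 2 * r + 1 ≤ ‖t‖) :
    ‖t‖ ≤ 2 * ‖t - z‖ := by
  have := norm_sub_norm_le t z
  have := norm_nonneg z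
  linarith

lemma memLp_horizontal {G : ℂ → ℂ} {b C : ℝ} (hb : 0 < b)
    (hG : DifferentiableOn ℂ G {z | b ≤ z.im})
    (hC : ∀ z : ℂ, b ≤ z.im → ‖G z‖ ≤ C / ‖z‖) {p : ℝ≥0∞} (hp : 1 < p) :
    MemLp (fun x : ℝ => G (x + b * Complex.I)) p volume := by
  have hc : Continuous fun x : ℝ => G (x + b * Complex.I) :=
    hG.continuousOn.comp_continuous (by fun_prop) (fun x => by simp)
  refine MemLp.of_le_mul (c := C) (memLp_inv_ofReal_sub (z := -(b * Complex.I))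
    (by simpa using hb.ne') hp) hc.aestronglyMeasurable (ae_of_all _ fun x => ?_)
  have := hC (x + b * Complex.I) (by simp)
  rwa [norm_inv, ← div_eq_mul_inv, sub_neg_eq_add]

lemma integral_horizontal_div_of_lt {G : ℂ → ℂ} {b C : ℝ} (hb : 0 < b)
    (hG : DifferentiableOn ℂ G {z | b ≤ z.im})
    (hC : ∀ z : ℂ, b ≤ z.im → ‖G z‖ ≤ C / ‖z‖) {w : ℂ} (hw : w.im < b) :
    ∫ x : ℝ, G (x + b * Complex.I) / (x + b * Complex.I - w) = 0 := by
  have hC0 : 0 ≤ C := by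
    have h := (norm_nonneg _).trans (hC (b * Complex.I) (by simp))
    by_contra hneg
    exact absurd (div_neg_of_neg_of_pos (not_le.1 hneg) (by simpa using hb.ne'))
      (not_lt.2 h)
  refine integral_horizontal_eq_zero (G := fun t => G t / (t - w)) (C := 2 * C)
    (r := 2 * ‖w‖ + 1) hb.le ?_ ?_ ?_
  · refine hG.div (by fun_prop) fun t ht h => ?_
    rw [sub_eq_zero.1 h] at ht
    exact absurd ht (not_le.2 hw)
  · have h1 : (w - b * Complex.I).im ≠ 0 := by simpa using (sub_neg.2 hw).ne
    have h2 := (memLp_horizontal hb hG hC (p := 2) (by norm_num)).integrable_mul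
      (memLp_inv_ofReal_sub h1 (q := 2) (by norm_num))
    refine h2.congr (ae_of_all _ fun x => ?_)
    simp only [ofReal_add_sub_eq, div_eq_mul_inv, Pi.mul_apply]
  · intro t ht hr
    have h1 := hC t ht
    have h2 := norm_le_two_mul_norm_sub le_rfl hr
    have h3 : 0 < ‖t‖ := by
      have := norm_nonneg w
      linarith
    rw [norm_div]
    have h4 : ‖t‖ / 2 ≤ ‖t - w‖ := by linarith
    calc ‖G t‖ / ‖t - w‖ ≤ (C / ‖t‖) / (‖t‖ / 2) := by gcongr
      _ = 2 * C / ‖t‖ ^ 2 := by field_simp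

/-- Cauchy's integral formula in a half-plane. -/
lemma integral_horizontal_div_of_gt {G : ℂ → ℂ} {b C : ℝ} (hb : 0 < b)
    (hG : DifferentiableOn ℂ G {z | b ≤ z.im})
    (hC : ∀ z : ℂ, b ≤ z.im → ‖G z‖ ≤ C / ‖z‖) {w : ℂ} (hw : b < w.im) :
    ∫ x : ℝ, G (x + b * Complex.I) / (x + b * Complex.I - w) =
      2 * Real.pi * Complex.I * G w := by
  have hC0 : 0 ≤ C := by
    have h := (norm_nonneg _).trans (hC (b * Complex.I) (by simp))
    by_contra hneg
    exact absurd (div_neg_of_neg_of_pos (not_le.1 hneg) (by simpa using hb.ne'))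
      (not_lt.2 h)
  set v : ℂ := conj w with hv
  have hvim : v.im = -w.im := by simp [hv]
  have hne : ∀ t : ℂ, b ≤ t.im → t - v ≠ 0 := by
    intro t ht h
    rw [sub_eq_zero.1 h, hvim] at ht
    linarith
  -- With `v = w̄` below the line, the subtracted term makes `F` vanish at `w` without spoiling
  -- holomorphy above the line or the decay `1 / |t|`. Then `F(t) / (t - w)` is the holomorphic
  -- function `dslope F w` with quadratic decay, its integral vanishes, and the subtracted term has
  -- an explicit integral.
  set F : ℂ → ℂ := fun t => G t - G w * (w - v) / (t - v) with hF
  have hFw : F w = 0 := by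
    have := hne w hw.le
    simp only [hF]
    field_simp
    ring
  have hnhds : {z : ℂ | b ≤ z.im} ∈ 𝓝 w := by
    filter_upwards [(Complex.continuous_im.isOpen_preimage _ isOpen_Ioi).mem_nhds hw] with z hz
    exact le_of_lt hz
  have hFd : DifferentiableOn ℂ (dslope F w) {z | b ≤ z.im} :=
    (Complex.differentiableOn_dslope hnhds).2
      (hG.sub ((differentiableOn_const _).div (by fun_prop) hne))
  have hxne : ∀ x : ℝ, (x : ℂ) + b * Complex.I ≠ w := by
    intro x h
    have : ((x : ℂ) + b * Complex.I).im = w.im := by rw [h]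
    simp at this
    linarith
  have h1 : (w - b * Complex.I).im ≠ 0 := by simpa using (sub_pos.2 hw).ne'
  have h1' : (v - b * Complex.I).im ≠ 0 := by
    have : (v - b * Complex.I).im = -w.im - b := by simp [hvim]
    rw [this]
    linarith
  have hi1 : Integrable fun x : ℝ => G (x + b * Complex.I) / (x + b * Complex.I - w) := by
    have h2 := (memLp_horizontal hb hG hC (p := 2) (by norm_num)).integrable_mul
      (memLp_inv_ofReal_sub h1 (q := 2) (by norm_num))
    refine h2.congr (ae_of_all _ fun x => ?_)
    simp only [ofReal_add_sub_eq, div_eq_mul_inv, Pi.mul_apply]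
  have hi2 := (integrable_inv_mul_inv h1 h1').const_mul (G w * (w - v))
  have hds : ∀ x : ℝ, dslope F w (x + b * Complex.I) =
      G (x + b * Complex.I) / (x + b * Complex.I - w) - G w * (w - v) *
        (((x : ℂ) - (w - b * Complex.I))⁻¹ * ((x : ℂ) - (v - b * Complex.I))⁻¹) := by
    intro x
    rw [dslope_of_ne _ (hxne x), slope_def_field, hFw, sub_zero, hF]
    simp only [ofReal_add_sub_eq]
    ring
  have h2 := integral_horizontal_eq_zero (G := dslope F w)
    (C := 2 * (C + 2 * ‖G w * (w - v)‖)) (r := 2 * ‖w‖ + 1) hb.le hFd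
    ((hi1.sub hi2).congr (ae_of_all _ fun x => (hds x).symm)) (by
      intro t ht hr
      have h3 : 0 < ‖t‖ := by
        have := norm_nonneg w
        linarith
      have htw : t ≠ w := by
        rintro rfl
        have := norm_nonneg t
        linarith
      have h4 : ‖t‖ / 2 ≤ ‖t - w‖ := by linarith [norm_le_two_mul_norm_sub le_rfl hr]
      have h5 : ‖t‖ / 2 ≤ ‖t - v‖ := by
        have : ‖v‖ ≤ ‖w‖ := by simp [hv]
        linarith [norm_le_two_mul_norm_sub this hr]
      have h6 : ‖F t‖ ≤ (C + 2 * ‖G w * (w - v)‖) / ‖t‖ := by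
        calc ‖F t‖ ≤ ‖G t‖ + ‖G w * (w - v) / (t - v)‖ := norm_sub_le _ _
          _ ≤ C / ‖t‖ + ‖G w * (w - v)‖ / (‖t‖ / 2) := by
            rw [norm_div]
            gcongr
            exact hC t ht
          _ = _ := by field_simp
      rw [dslope_of_ne _ htw, slope_def_field, hFw, sub_zero, norm_div]
      calc ‖F t‖ / ‖t - w‖ ≤ (C + 2 * ‖G w * (w - v)‖) / ‖t‖ / (‖t‖ / 2) := by gcongr
        _ = _ := by field_simp)
  simp only [hds] at h2
  have hwv : w - v ≠ 0 := hne w hw.le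
  rw [integral_sub hi1 hi2, integral_const_mul, integral_inv_mul_inv h1 h1' (by
    intro h; exact hwv (sub_eq_zero.2 (sub_left_injective h)))] at h2
  have s1 : Real.sign (w - b * Complex.I).im = 1 := Real.sign_of_pos (by simpa using hw)
  have s2 : Real.sign (v - b * Complex.I).im = -1 := Real.sign_of_neg (by
    have : (v - b * Complex.I).im = -w.im - b := by simp [hvim]
    rw [this]
    linarith)
  rw [s1, s2, sub_sub_sub_cancel_right] at h2
  rw [sub_eq_zero.1 h2]
  push_cast
  field_simp
  ring

/-! ### Cauchy transforms of continuous functions with compact support -/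

/-- Far from the support, `|x - z|` is at least `|z| / 2`; in the remaining bounded region `|x - z|
≥ |Im z| ≥ b`. The decay `1 / |z|` is what the contour arguments require. -/
lemma exists_norm_cauchyTransform_le {h : ℝ → ℂ} (hc : Continuous h) (hs : HasCompactSupport h)
    {b : ℝ} (hb : 0 < b) :
    ∃ C, 0 ≤ C ∧ ∀ z : ℂ, b ≤ |z.im| → ‖cauchyTransform h z‖ ≤ C / ‖z‖ := by
  obtain ⟨r, hr⟩ := hs.isCompact.isBounded.subset_closedBall (0 : ℝ)
  have hi : Integrable h := hc.integrable_of_hasCompactSupport hs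
  set J := ∫ x, ‖h x‖ with hJ
  have hJ0 : 0 ≤ J := integral_nonneg fun _ => norm_nonneg _
  set r' := max r 0 with hr'
  have hr0 : 0 ≤ r' := le_max_right _ _
  have hbound : ∀ (z : ℂ) (c : ℝ), 0 < c → (∀ x : ℝ, h x ≠ 0 → c ≤ ‖(x : ℂ) - z‖) →
      ‖cauchyTransform h z‖ ≤ J / c := by
    intro z c hc0 hle
    rw [hJ, ← integral_div]
    refine norm_integral_le_of_norm_le (hi.norm.div_const _) (ae_of_all _ fun x => ?_)
    rw [norm_div]
    by_cases hx : h x = 0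
    · simp [hx]
    · gcongr
      exact hle x hx
  refine ⟨J * (2 * r' + 1) / b + 2 * J, by positivity, fun z hz => ?_⟩
  have hz0 : 0 < ‖z‖ := hb.trans_le (hz.trans (Complex.abs_im_le_norm z))
  rcases le_total (2 * r' + 1) ‖z‖ with h1 | h1
  · have h2 : ‖cauchyTransform h z‖ ≤ J / (‖z‖ / 2) := by
      refine hbound z _ (by positivity) fun x hx => ?_
      have hx' : ‖(x : ℂ)‖ ≤ r' := by
        have := hr (subset_tsupport _ (Function.mem_support.2 hx))
        rw [Metric.mem_closedBall, dist_zero_right] at this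
        rw [Complex.norm_real]
        exact this.trans (le_max_left _ _)
      have := norm_le_two_mul_norm_sub hx' h1
      rw [norm_sub_rev]
      linarith
    refine h2.trans ?_
    rw [div_div_eq_mul_div]
    gcongr
    have : 0 ≤ J * (2 * r' + 1) / b := by positivity
    linarith
  · have h2 : ‖cauchyTransform h z‖ ≤ J / b :=
      hbound z b hb fun x _ => hz.trans (abs_im_le_norm_ofReal_sub x z)
    refine h2.trans ?_
    rw [le_div_iff₀ hz0]
    calc J / b * ‖z‖ ≤ J / b * (2 * r' + 1) := by gcongr
      _ = J * (2 * r' + 1) / b := by ring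
      _ ≤ _ := by linarith

/-! ### M. Riesz's theorem for the exponents 2 and 4 -/

lemma memLp_rieszApprox_of_continuous {h : ℝ → ℂ} (hc : Continuous h) (hs : HasCompactSupport h)
    {ε : ℝ} (hε : 0 < ε) {p : ℝ≥0∞} (hp : 1 < p) : MemLp (rieszApprox 1 h ε) p volume := by
  obtain ⟨C, -, hC⟩ := exists_norm_cauchyTransform_le hc hs hε
  have := (memLp_horizontal hε ((cauchyIntegrable_of_continuous hc hs).differentiableOn
    fun z hz => (hε.trans_le hz).ne') (fun z hz => hC z (hz.trans (le_abs_self _))) hp).const_mul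
    ((1 : ℝ) / (2 * Real.pi * Complex.I))
  refine this.congr_norm ?_ (ae_of_all _ fun k => ?_)
  · refine AEStronglyMeasurable.congr this.1 (ae_of_all _ fun k => ?_)
    simp [rieszApprox]
  · simp [rieszApprox]

/-- The approximation is the restriction to `Im z = ε` of a holomorphic function of size `1 / |z|`;
its `n`-th power decays at least quadratically because `n ≥ 2`, so the contour can be pushed to
infinity. -/
lemma integral_rieszApprox_pow {h : ℝ → ℂ} (hc : Continuous h) (hs : HasCompactSupport h)
    {ε : ℝ} (hε : 0 < ε) {n : ℕ} (hn : 2 ≤ n) :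
    Integrable (fun k => rieszApprox 1 h ε k ^ n) ∧ ∫ k, rieszApprox 1 h ε k ^ n = 0 := by
  obtain ⟨C, hC0, hC⟩ := exists_norm_cauchyTransform_le hc hs hε
  have hi : Integrable (fun k => rieszApprox 1 h ε k ^ n) := by
    have h1 := memLp_rieszApprox_of_continuous hc hs hε (p := n) (by exact_mod_cast hn)
    have h2 := h1.integrable_norm_pow (by omega)
    refine h2.mono' (h1.1.pow n) (ae_of_all _ fun k => by simp)
  refine ⟨hi, ?_⟩
  set c : ℂ := (1 : ℝ) / (2 * Real.pi * Complex.I) with hcdef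
  have e : ∀ k : ℝ, rieszApprox 1 h ε k = c * cauchyTransform h (k + ε * Complex.I) := by
    intro k
    simp [rieszApprox, hcdef]
  simp only [e] at hi ⊢
  refine integral_horizontal_eq_zero (G := fun z => (c * cauchyTransform h z) ^ n) (r := 0)
    (C := (‖c‖ * C) ^ n / ε ^ (n - 2)) hε.le
    ((((cauchyIntegrable_of_continuous hc hs).differentiableOn
      fun z hz => (hε.trans_le hz).ne').const_mul c).pow n) hi fun z hz _ => ?_
  have hεz : ε ≤ ‖z‖ := norm_ge_of_le_im hz
  have hz0 : 0 < ‖z‖ := hε.trans_le hεz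
  have h1 := hC z (hz.trans (le_abs_self _))
  rw [norm_pow, norm_mul]
  calc (‖c‖ * ‖cauchyTransform h z‖) ^ n ≤ (‖c‖ * (C / ‖z‖)) ^ n := by gcongr
    _ = (‖c‖ * C) ^ n / (‖z‖ ^ (n - 2) * ‖z‖ ^ 2) := by
      rw [← pow_add, Nat.sub_add_cancel hn, ← mul_div_assoc, div_pow]
    _ ≤ (‖c‖ * C) ^ n / (ε ^ (n - 2) * ‖z‖ ^ 2) := by gcongr
    _ = _ := by rw [div_div]

lemma eLpNorm_le_of_integral_pow_le {f g : ℝ → ℂ} {n : ℕ} (hn : n ≠ 0) (hf : MemLp f n volume)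
    (hg : MemLp g n volume) (h : ∫ x, ‖f x‖ ^ n ≤ ∫ x, ‖g x‖ ^ n) :
    eLpNorm f n volume ≤ eLpNorm g n volume := by
  rw [hf.eLpNorm_eq_integral_rpow_norm (by simpa) (by simp),
    hg.eLpNorm_eq_integral_rpow_norm (by simpa) (by simp)]
  simp only [ENNReal.toReal_natCast, Real.rpow_natCast]
  gcongr

/-- M. Riesz' theorem for an even integer exponent and for real-valued functions, given the
inequality on which its proof rests. -/
lemma eLpNorm_rieszApprox_le_of_real {n : ℕ} (hn : 2 ≤ n) {A B : ℝ} (hA : 1 ≤ A)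
    (hineq : ∀ z : ℂ, ‖z‖ ^ n ≤ A * |z.re| ^ n + B * (z ^ n).re) {h : ℝ → ℂ} (hc : Continuous h)
    (hs : HasCompactSupport h) (hr : ∀ x, conj (h x) = h x) {ε : ℝ} (hε : 0 < ε) :
    eLpNorm (rieszApprox 1 h ε) n volume ≤ ENNReal.ofReal A * eLpNorm h n volume := by
  have hn1 : (1 : ℝ≥0∞) < n := by exact_mod_cast hn
  set F := rieszApprox 1 h ε with hF
  have hFm : MemLp F n volume := memLp_rieszApprox_of_continuous hc hs hε hn1
  -- For real `h` the two approximations are complex conjugates, so twice the real part of `F` is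
  -- the Poisson integral, whose norm is already controlled.
  have hP : ∀ k, poisson ε h k = ((2 * (F k).re : ℝ) : ℂ) := by
    intro k
    rw [poisson_eq_rieszApprox (cauchyIntegrable_of_continuous hc hs) hε]
    have : rieszApprox (-1) h ε k = conj (F k) := by
      simp only [hF, rieszApprox, map_mul, map_div₀, Complex.conj_I, Complex.conj_ofReal, map_ofNat]
      rw [← cauchyTransform_conj]
      simp only [hr, map_add, map_mul, Complex.conj_I, Complex.conj_ofReal]
      push_cast
      ring_nf
    rw [this, Complex.add_conj]
  obtain ⟨C, hC⟩ := hs.exists_bound_of_continuous hc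
  have hPm : MemLp (poisson ε h) n volume :=
    ⟨(continuous_poisson hc hC ε).aestronglyMeasurable,
      (eLpNorm_poisson_le hc hn1.le (by simp) ε).trans_lt (hc.memLp_of_hasCompactSupport hs).2⟩
  have hpow := integral_rieszApprox_pow hc hs hε hn
  have hpowre : ∫ k, (F k ^ n).re = 0 := by
    have := integral_re hpow.1
    simp only [hpow.2] at this
    simpa using this
  have hi1 : Integrable fun k => ‖(A : ℂ) * poisson ε h k‖ ^ n :=
    (hPm.const_mul (A : ℂ)).integrable_norm_pow (by omega)
  have hi2 : Integrable fun k => B * (F k ^ n).re := hpow.1.re.const_mul B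
  have h1 : eLpNorm F n volume ≤ eLpNorm (fun k => (A : ℂ) * poisson ε h k) n volume := by
    refine eLpNorm_le_of_integral_pow_le (by omega) hFm (hPm.const_mul _) ?_
    -- On integrating the pointwise inequality, the term with `B` disappears because `∫ F ^ n = 0`.
    -- The wasteful bounds `|Re F| ≤ |2 Re F|` and `A ≤ A ^ n` put the right side in the form of an
    -- `n`-th power of a norm.
    calc ∫ k, ‖F k‖ ^ n ≤ ∫ k, (‖(A : ℂ) * poisson ε h k‖ ^ n + B * (F k ^ n).re) := by
          refine integral_mono (hFm.integrable_norm_pow (by omega)) (hi1.add hi2) fun k => ?_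
          refine (hineq (F k)).trans ?_
          gcongr
          rw [hP, norm_mul, Complex.norm_real, Complex.norm_real, Real.norm_eq_abs,
            Real.norm_eq_abs, mul_pow, abs_mul, abs_two, abs_of_pos (by linarith : 0 < A)]
          have h2 : |(F k).re| ^ n ≤ (2 * |(F k).re|) ^ n := by
            gcongr
            linarith [abs_nonneg (F k).re]
          have h3 : A ≤ A ^ n := le_self_pow₀ hA (by omega)
          gcongr
      _ = ∫ k, ‖(A : ℂ) * poisson ε h k‖ ^ n := by
          rw [integral_add hi1 hi2, integral_const_mul, hpowre, mul_zero, add_zero]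
  refine h1.trans ?_
  have h2 := eLpNorm_const_smul (A : ℂ) (poisson ε h) (n : ℝ≥0∞) volume
  have h3 : ‖(A : ℂ)‖ₑ = ENNReal.ofReal A := by
    rw [← ofReal_norm, Complex.norm_real, Real.norm_of_nonneg (by linarith)]
  calc _ = ENNReal.ofReal A * eLpNorm (poisson ε h) n volume := by rw [← h3, ← h2]; rfl
    _ ≤ _ := by
      gcongr
      exact eLpNorm_poisson_le hc hn1.le (by simp) ε

lemma rieszApprox_add {f g : ℝ → ℂ} (hf : CauchyIntegrable f) (hg : CauchyIntegrable g)
    {s ε k : ℝ} (hs : s ≠ 0) (hε : 0 < ε) :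
    rieszApprox s (fun x => f x + g x) ε k = rieszApprox s f ε k + rieszApprox s g ε k := by
  rw [rieszApprox, cauchyTransform_add hf hg (by simp [hs, hε.ne'])]
  simp only [rieszApprox]
  ring

lemma rieszApprox_sub {f g : ℝ → ℂ} (hf : CauchyIntegrable f) (hg : CauchyIntegrable g)
    {s ε k : ℝ} (hs : s ≠ 0) (hε : 0 < ε) :
    rieszApprox s (fun x => f x - g x) ε k = rieszApprox s f ε k - rieszApprox s g ε k := by
  rw [rieszApprox, cauchyTransform_sub hf hg (by simp [hs, hε.ne'])]
  simp only [rieszApprox]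
  ring

lemma rieszApprox_const_mul (c : ℂ) (f : ℝ → ℂ) (s ε k : ℝ) :
    rieszApprox s (fun x => c * f x) ε k = c * rieszApprox s f ε k := by
  rw [rieszApprox, cauchyTransform_const_mul]
  simp only [rieszApprox]
  ring

lemma rieszApprox_conj (f : ℝ → ℂ) (s ε k : ℝ) :
    rieszApprox s (fun x => conj (f x)) ε k = conj (rieszApprox (-s) f ε k) := by
  simp only [rieszApprox, map_mul, map_div₀, Complex.conj_I, Complex.conj_ofReal, map_ofNat]
  rw [← cauchyTransform_conj]
  simp only [map_add, map_mul, Complex.conj_I, Complex.conj_ofReal]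
  push_cast
  ring_nf

/-- The approximations of the Riesz projection `P₊` are uniformly bounded in `L^p`, on continuous
functions with compact support. -/
def RieszBound (p : ℝ≥0∞) (A : ℝ≥0∞) : Prop :=
  ∀ h : ℝ → ℂ, Continuous h → HasCompactSupport h → ∀ ε : ℝ, 0 < ε →
    eLpNorm (rieszApprox 1 h ε) p volume ≤ A * eLpNorm h p volume

lemma rieszBound_of_inequality {n : ℕ} (hn : 2 ≤ n) {A B : ℝ} (hA : 1 ≤ A)
    (hineq : ∀ z : ℂ, ‖z‖ ^ n ≤ A * |z.re| ^ n + B * (z ^ n).re) :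
    RieszBound n (ENNReal.ofReal A * 2) := by
  intro h hc hs ε hε
  have hn1 : (1 : ℝ≥0∞) < n := by exact_mod_cast hn
  set h₁ : ℝ → ℂ := fun x => ((h x).re : ℂ) with hh₁
  set h₂ : ℝ → ℂ := fun x => ((h x).im : ℂ) with hh₂
  have c₁ : Continuous h₁ := by fun_prop
  have c₂ : Continuous h₂ := by fun_prop
  have s₁ : HasCompactSupport h₁ := hs.comp_left (g := fun z : ℂ => (z.re : ℂ)) (by simp)
  have s₂ : HasCompactSupport h₂ := hs.comp_left (g := fun z : ℂ => (z.im : ℂ)) (by simp)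
  have b₁ := eLpNorm_rieszApprox_le_of_real hn hA hineq c₁ s₁ (fun x => by simp [hh₁]) hε
  have b₂ := eLpNorm_rieszApprox_le_of_real hn hA hineq c₂ s₂ (fun x => by simp [hh₂]) hε
  have n₁ : eLpNorm h₁ n volume ≤ eLpNorm h n volume :=
    eLpNorm_mono fun x => by simpa [hh₁] using Complex.abs_re_le_norm (h x)
  have n₂ : eLpNorm h₂ n volume ≤ eLpNorm h n volume :=
    eLpNorm_mono fun x => by simpa [hh₂] using Complex.abs_im_le_norm (h x)
  have m₁ := memLp_rieszApprox_of_continuous c₁ s₁ hε hn1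
  have m₂ := memLp_rieszApprox_of_continuous c₂ s₂ hε hn1
  have e : rieszApprox 1 h ε =
      rieszApprox 1 h₁ ε + Complex.I • rieszApprox 1 h₂ ε := by
    ext k
    have i₁ := cauchyIntegrable_of_continuous c₁ s₁
    have i₂ := cauchyIntegrable_of_continuous c₂ s₂
    have := rieszApprox_add (k := k) i₁ (i₂.const_mul Complex.I) one_ne_zero hε
    rw [rieszApprox_const_mul] at this
    rw [Pi.add_apply, Pi.smul_apply, smul_eq_mul, ← this]
    congr 1
    ext x
    simp only [hh₁, hh₂]
    rw [mul_comm, Complex.re_add_im]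
  rw [e]
  refine (eLpNorm_add_le m₁.1 (m₂.const_smul Complex.I).1 hn1.le).trans ?_
  rw [eLpNorm_const_smul]
  have : ‖Complex.I‖ₑ = 1 := by rw [← ofReal_norm]; simp
  rw [this, one_mul, mul_assoc, two_mul, mul_add]
  exact add_le_add (b₁.trans (by gcongr)) (b₂.trans (by gcongr))

lemma rieszBound_two : ∃ A : ℝ≥0∞, A ≠ ∞ ∧ RieszBound 2 A := by
  -- These constants give the identity `|z|² = 2 (Re z)² - Re z²`.
  refine ⟨_, ?_, rieszBound_of_inequality (n := 2) (A := 2) (B := -1) le_rfl (by norm_num)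
    fun z => ?_⟩
  · finiteness
  · rw [Complex.sq_norm, Complex.normSq_apply, sq_abs, sq z, Complex.mul_re]
    nlinarith

lemma rieszBound_four : ∃ A : ℝ≥0∞, A ≠ ∞ ∧ RieszBound 4 A := by
  -- With `z = x + i y`, these constants make the right side minus the left side equal to `49 x⁴ -
  -- 14 x² y² + y⁴ = (y² - 7 x²)²`.
  refine ⟨_, ?_, rieszBound_of_inequality (n := 4) (A := 48) (B := 2) (by norm_num)
    (by norm_num) fun z => ?_⟩
  · finiteness
  · have h1 : ‖z‖ ^ 4 = (z.re * z.re + z.im * z.im) ^ 2 := by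
      rw [← Complex.normSq_apply, ← Complex.sq_norm]
      ring
    have h2 : |z.re| ^ 4 = z.re ^ 4 := by
      rw [show (4 : ℕ) = 2 * 2 from rfl, pow_mul, sq_abs, pow_mul]
    have h3 : (z ^ 4).re = (z.re * z.re - z.im * z.im) ^ 2 - (2 * z.re * z.im) ^ 2 := by
      rw [show z ^ 4 = (z * z) * (z * z) by ring]
      simp only [Complex.mul_re, Complex.mul_im]
      ring
    rw [h1, h2, h3]
    nlinarith [sq_nonneg (z.im ^ 2 - 7 * z.re ^ 2)]

/-! ### Duality -/

lemma exists_seq_tendsto_eLpNorm {f : ℝ → ℂ} {p : ℝ≥0∞} (hp' : p ≠ ∞) (hf : MemLp f p volume) :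
    ∃ u : ℕ → ℝ → ℂ, (∀ n, Continuous (u n)) ∧ (∀ n, HasCompactSupport (u n)) ∧
      Tendsto (fun n => eLpNorm (fun x => f x - u n x) p volume) atTop (𝓝 0) := by
  have h : ∀ n : ℕ, ∃ g : ℝ → ℂ, HasCompactSupport g ∧
      eLpNorm (f - g) p volume ≤ ((n : ℝ≥0∞))⁻¹ ∧ Continuous g ∧ MemLp g p volume := fun n =>
    hf.exists_hasCompactSupport_eLpNorm_sub_le hp' (by simp)
  choose u hu using h
  exact ⟨u, fun n => (hu n).2.2.1, fun n => (hu n).1,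
    tendsto_of_tendsto_of_tendsto_of_le_of_le tendsto_const_nhds ENNReal.tendsto_inv_nat_nhds_zero
      (fun _ => zero_le) fun n => (hu n).2.1⟩

lemma enorm_integral_mul_le {f g : ℝ → ℂ} (p q : ℝ≥0∞) [p.HolderConjugate q]
    (hf : AEStronglyMeasurable f volume) (hg : AEStronglyMeasurable g volume) :
    ‖∫ x, f x * g x‖ₑ ≤ eLpNorm f p volume * eLpNorm g q volume := by
  refine (enorm_integral_le_lintegral_enorm _).trans ?_
  rw [← eLpNorm_one_eq_lintegral_enorm]
  have h := eLpNorm_smul_le_mul_eLpNorm (p := p) (q := q) (r := 1) (f := g) (φ := f) hg hf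
  rwa [smul_eq_mul] at h

/-- The `L^p` norm of a function is bounded by its pairings with continuous functions with compact
support. -/
lemma eLpNorm_le_of_forall_enorm_integral_le {p q : ℝ≥0∞} [hpq : p.HolderConjugate q] (hp : 1 < p)
    (hp' : p ≠ ∞) {F : ℝ → ℂ} (hF : MemLp F p volume) {c : ℝ≥0∞} (hc : c ≠ ∞)
    (h : ∀ g : ℝ → ℂ, Continuous g → HasCompactSupport g →
      ‖∫ x, F x * g x‖ₑ ≤ c * eLpNorm g q volume) : eLpNorm F p volume ≤ c := by
  have hq1 : 1 ≤ q := ENNReal.HolderConjugate.one_le q p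
  have hq' : q ≠ ∞ := by
    have := (ENNReal.HolderConjugate.ne_top_iff_ne_one q p).2 hp.ne'
    exact this
  -- Density extends the bound to all of `L^q`, so that the extremal function of Hölder's inequality
  -- may be used as a test function.
  have hall : ∀ g : ℝ → ℂ, MemLp g q volume → ‖∫ x, F x * g x‖ₑ ≤ c * eLpNorm g q volume := by
    intro g hg
    obtain ⟨u, uc, us, hu⟩ := exists_seq_tendsto_eLpNorm hq' hg
    have hum : ∀ n, MemLp (u n) q volume := fun n => (uc n).memLp_of_hasCompactSupport (us n)
    have hle : ∀ n, ‖∫ x, F x * g x‖ₑ ≤ c * eLpNorm g q volume +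
        (c + eLpNorm F p volume) * eLpNorm (fun x => g x - u n x) q volume := by
      intro n
      have e : ∫ x, F x * g x = (∫ x, F x * u n x) + ∫ x, F x * (g x - u n x) := by
        refine (integral_congr_ae (ae_of_all _ fun x => ?_)).trans
          (integral_add (hF.integrable_mul (hum n)) (hF.integrable_mul (hg.sub (hum n))))
        ring
      rw [e]
      refine (enorm_add_le _ _).trans ?_
      have e1 := h (u n) (uc n) (us n)
      have e2 := enorm_integral_mul_le p q hF.1 (hg.sub (hum n)).1
      have e3 : eLpNorm (u n) q volume ≤ eLpNorm g q volume +
          eLpNorm (fun x => g x - u n x) q volume := by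
        have := eLpNorm_sub_le hg.1 (hg.sub (hum n)).1 hq1
        rwa [sub_sub_cancel] at this
      calc _ ≤ c * (eLpNorm g q volume + eLpNorm (fun x => g x - u n x) q volume) +
            eLpNorm F p volume * eLpNorm (fun x => g x - u n x) q volume :=
          add_le_add (e1.trans (by gcongr)) e2
        _ = _ := by ring
    have hlim := (ENNReal.Tendsto.const_mul hu (Or.inr (show c + eLpNorm F p volume ≠ ∞ from
      ENNReal.add_ne_top.2 ⟨hc, hF.2.ne⟩))).const_add (c * eLpNorm g q volume)
    rw [mul_zero, add_zero] at hlim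
    exact ge_of_tendsto hlim (Eventually.of_forall hle)
  have hpr : 1 < p.toReal := by
    rw [← ENNReal.toReal_one]
    exact (ENNReal.toReal_lt_toReal ENNReal.one_ne_top hp').2 hp
  have hp0 : p ≠ 0 := (zero_lt_one.trans hp).ne'
  set r := p.toReal - 1 with hr
  have hr0 : 0 < r := by linarith
  have hqr : q * ENNReal.ofReal r = p := by
    have h1 : ENNReal.ofReal r = p - 1 := by
      rw [hr, ENNReal.ofReal_sub _ zero_le_one, ENNReal.ofReal_toReal hp', ENNReal.ofReal_one]
    have h2 := ENNReal.HolderConjugate.sub_one_mul_inv (p := p) (q := q) hp'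
    have hq0 : q ≠ 0 := (zero_lt_one.trans_le hq1).ne'
    have h3 : (p - 1) = q⁻¹ * p := by
      rw [← h2, mul_assoc, ENNReal.inv_mul_cancel hp0 hp', mul_one]
    rw [h1, h3, ← mul_assoc, ENNReal.mul_inv_cancel hq0 hq', one_mul]
  -- The extremal function `F̄ |F|^{p-2}`: its product with `F` is `|F|^p`, and its `L^q` norm is
  -- the `L^p` norm of `F` to the power `p - 1`.
  set g : ℝ → ℂ := fun x => conj (F x) * ((‖F x‖ ^ (r - 1) : ℝ) : ℂ) with hg
  have hgn : ∀ x, ‖g x‖ = ‖F x‖ ^ r := by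
    intro x
    simp only [hg]
    rw [norm_mul, RCLike.norm_conj, Complex.norm_real, Real.norm_of_nonneg (by positivity)]
    rcases eq_or_ne (‖F x‖) 0 with h0 | h0
    · rw [h0, zero_mul, Real.zero_rpow hr0.ne']
    · rw [Real.rpow_sub_one h0]
      field_simp
  have hgm : AEStronglyMeasurable g volume := by
    have h1 : AEMeasurable F volume := hF.1.aemeasurable
    refine AEMeasurable.aestronglyMeasurable ?_
    exact (Complex.continuous_conj.measurable.comp_aemeasurable h1).mul
      (Complex.measurable_ofReal.comp_aemeasurable (h1.norm.pow_const _))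
  have hgN : eLpNorm g q volume = eLpNorm F p volume ^ r := by
    have h1 := eLpNorm_norm_rpow (p := q) (μ := volume) F hr0
    rw [hqr] at h1
    rw [← h1]
    refine eLpNorm_congr_norm_ae (ae_of_all _ fun x => ?_)
    rw [hgn, Real.norm_of_nonneg (by positivity)]
  have hgq : MemLp g q volume :=
    ⟨hgm, by rw [hgN]; exact ENNReal.rpow_lt_top_of_nonneg hr0.le hF.2.ne⟩
  have h1 := hall g hgq
  have h2 : ‖∫ x, F x * g x‖ₑ = eLpNorm F p volume ^ p.toReal := by
    have e : ∀ x, F x * g x = ((‖F x‖ ^ p.toReal : ℝ) : ℂ) := by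
      intro x
      simp only [hg]
      rw [← mul_assoc, Complex.mul_conj, ← Complex.ofReal_mul, Complex.normSq_eq_norm_sq]
      congr 1
      rcases eq_or_ne (‖F x‖) 0 with h0 | h0
      · rw [h0, Real.zero_rpow (x := p.toReal) (by linarith)]
        simp
      · have h3 : 0 < ‖F x‖ := by positivity
        rw [← Real.rpow_natCast, ← Real.rpow_add h3]
        congr 1
        push_cast
        linarith
    simp only [e]
    rw [integral_complex_ofReal, hF.eLpNorm_eq_integral_rpow_norm hp0 hp',
      ENNReal.ofReal_rpow_of_nonneg (by positivity) (by linarith), ← Real.rpow_mul (by positivity),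
      inv_mul_cancel₀ (by linarith), Real.rpow_one, ← ofReal_norm, Complex.norm_real,
      Real.norm_of_nonneg (by positivity)]
  rw [h2, hgN] at h1
  rcases eq_or_ne (eLpNorm F p volume) 0 with h0 | h0
  · rw [h0]
    exact zero_le
  · have e : p.toReal = 1 + r := by linarith
    rw [e, ENNReal.rpow_add _ _ h0 hF.2.ne, ENNReal.rpow_one] at h1
    refine (ENNReal.mul_le_mul_iff_left ?_ ?_).1 h1
    · exact (ENNReal.rpow_pos (pos_iff_ne_zero.2 h0) hF.2.ne).ne'
    · exact (ENNReal.rpow_lt_top_of_nonneg hr0.le hF.2.ne).ne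

/-- The dual of a bound for the approximations of the Riesz projections. -/
lemma RieszBound.dual {p q A : ℝ≥0∞} [hpq : p.HolderConjugate q] (hp : 1 < p) (hp' : p ≠ ∞)
    (hA : A ≠ ∞) (h : RieszBound q A) : RieszBound p A := by
  intro f fc fs ε hε
  have hfm : MemLp f p volume := fc.memLp_of_hasCompactSupport fs
  have hfi : Integrable f := fc.integrable_of_hasCompactSupport fs
  refine eLpNorm_le_of_forall_enorm_integral_le (q := q) hp hp'
    (memLp_rieszApprox_of_continuous fc fs hε hp) (ENNReal.mul_ne_top hA hfm.2.ne)
    fun g gc gs => ?_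
  have hgi : Integrable g := gc.integrable_of_hasCompactSupport gs
  have hw : ((1 : ℝ) * (ε : ℂ) * Complex.I).im ≠ 0 := by simpa using hε.ne'
  have hint : Integrable (fun r : ℝ × ℝ => g r.1 * f r.2 *
      ((r.2 : ℂ) - r.1 - (1 : ℝ) * (ε : ℂ) * Complex.I)⁻¹) (volume.prod volume) := by
    have hne : ∀ r : ℝ × ℝ, (r.2 : ℂ) - r.1 - (1 : ℝ) * (ε : ℂ) * Complex.I =
        ((r.2 - r.1 : ℝ) : ℂ) - (1 : ℝ) * (ε : ℂ) * Complex.I := fun r => by push_cast; rfl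
    simp only [hne]
    exact (hgi.mul_prod hfi).mul_bdd
      ((continuous_inv_ofReal_sub hw).comp (by fun_prop)).aestronglyMeasurable
      (ae_of_all _ fun r => norm_inv_ofReal_sub_le hw _)
  have h1 := integral_mul_cauchyTransform hint
  -- The transpose of the approximation of `P₊` is that of `P₋`, which conjugation turns back into
  -- one of `P₊`; so the same bound serves the conjugate exponent.
  have e : ∫ x, rieszApprox 1 f ε x * g x = ∫ y, f y * rieszApprox (-1) g ε y := by
    have e1 : ∀ x, rieszApprox 1 f ε x * g x = (1 : ℝ) / (2 * Real.pi * Complex.I) *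
        (g x * cauchyTransform f (x + (1 : ℝ) * (ε : ℂ) * Complex.I)) := fun x => by
      rw [rieszApprox]; ring
    have e2 : ∀ y, f y * rieszApprox (-1) g ε y = (1 : ℝ) / (2 * Real.pi * Complex.I) *
        -(f y * cauchyTransform g (y - (1 : ℝ) * (ε : ℂ) * Complex.I)) := fun y => by
      rw [rieszApprox]
      push_cast
      rw [show (y : ℂ) + -1 * ε * Complex.I = y - 1 * ε * Complex.I by ring]
      ring
    simp only [e1, e2]
    rw [integral_const_mul, integral_const_mul, h1, integral_neg]
  have e3 : eLpNorm (rieszApprox (-1) g ε) q volume =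
      eLpNorm (rieszApprox 1 (fun x => conj (g x)) ε) q volume := by
    rw [← eLpNorm_conj]
    refine eLpNorm_congr_ae (ae_of_all _ fun k => ?_)
    rw [rieszApprox_conj]
    rfl
  have gc' : Continuous fun x => conj (g x) := Complex.continuous_conj.comp gc
  have gs' : HasCompactSupport fun x => conj (g x) := gs.comp_left (map_zero _)
  have hgm : AEStronglyMeasurable (rieszApprox (-1) g ε) volume := by
    have h2 := (memLp_rieszApprox_of_continuous gc' gs' hε hp).1
    have h3 := Complex.continuous_conj.comp_aestronglyMeasurable h2
    refine h3.congr (ae_of_all _ fun k => ?_)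
    simp [rieszApprox_conj]
  rw [e]
  refine (enorm_integral_mul_le p q hfm.1 hgm).trans ?_
  rw [e3]
  calc _ ≤ eLpNorm f p volume * (A * eLpNorm (fun x => conj (g x)) q volume) := by
        gcongr
        exact h _ gc' gs' ε hε
    _ = _ := by
        have : eLpNorm (fun x => conj (g x)) q volume = eLpNorm g q volume := eLpNorm_conj g q volume
        rw [this]
        ring

/-! ### The Riesz projections on `L^p` -/

/-- An exponent for which the theorem of M. Riesz is available. -/
def RieszExponent (p : ℝ≥0∞) : Prop := 1 < p ∧ p ≠ ∞ ∧ ∃ A : ℝ≥0∞, A ≠ ∞ ∧ RieszBound p A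

lemma rieszExponent_two : RieszExponent 2 := ⟨by norm_num, by simp, rieszBound_two⟩

lemma rieszExponent_four : RieszExponent 4 := ⟨by norm_num, by simp, rieszBound_four⟩

lemma RieszExponent.dual {p q : ℝ≥0∞} [hpq : p.HolderConjugate q] (hq : RieszExponent q) :
    RieszExponent p := by
  obtain ⟨h1, h2, A, hA, hAb⟩ := hq
  have hp : 1 < p := (ENNReal.HolderConjugate.lt_top_iff_one_lt q p).1 h2.lt_top
  have hp' : p ≠ ∞ := (ENNReal.HolderConjugate.ne_top_iff_ne_one p q).2 h1.ne'
  exact ⟨hp, hp', A, hA, hAb.dual hp hp' hA⟩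

lemma continuous_rieszApprox {f : ℝ → ℂ} (hf : CauchyIntegrable f) {s ε : ℝ} (hs : s ≠ 0)
    (hε : 0 < ε) : Continuous (rieszApprox s f ε) := by
  refine continuous_const.mul (continuous_iff_continuousAt.2 fun k => ?_)
  refine ContinuousAt.comp (f := fun k : ℝ => (k : ℂ) + s * ε * Complex.I)
    (hf.hasDerivAt ?_).continuousAt (by fun_prop)
  simp [hs, hε.ne']

lemma tendsto_cauchyTransform {f : ℝ → ℂ} {u : ℕ → ℝ → ℂ} {p : ℝ≥0∞} (hp : 1 ≤ p) (hp' : p ≠ ∞)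
    (hf : MemLp f p volume) (hu : ∀ n, MemLp (u n) p volume)
    (h : Tendsto (fun n => eLpNorm (fun x => f x - u n x) p volume) atTop (𝓝 0)) {z : ℂ}
    (hz : z.im ≠ 0) :
    Tendsto (fun n => cauchyTransform (u n) z) atTop (𝓝 (cauchyTransform f z)) := by
  have : p.HolderConjugate p.conjExponent := ENNReal.HolderConjugate.conjExponent hp
  rw [tendsto_iff_edist_tendsto_0]
  have h1 := ENNReal.Tendsto.mul_const (b := eLpNorm (fun x : ℝ => ((x : ℂ) - z)⁻¹)
    p.conjExponent volume) h (Or.inr (memLp_inv_ofReal_sub hz (one_lt_conjExponent hp')).2.ne)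
  rw [zero_mul] at h1
  refine tendsto_of_tendsto_of_tendsto_of_le_of_le tendsto_const_nhds h1 (fun _ => zero_le)
    fun n => ?_
  have h2 := norm_cauchyTransform_le hp hp' (hf.sub (hu n)) hz
  rw [edist_comm, edist_eq_enorm_sub, ← ofReal_norm]
  have h3 := cauchyTransform_sub (cauchyIntegrable_of_memLp hp hp' hf)
    (cauchyIntegrable_of_memLp hp hp' (hu n)) hz
  rw [← h3]
  exact h2

/-- For fixed `ε` the approximations of an `L^p`-convergent sequence converge pointwise, so Fatou's
lemma carries the bound from test functions to `L^p`. Conjugation interchanges the signs. -/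
lemma RieszBound.eLpNorm_le {p A : ℝ≥0∞} (hp : 1 < p) (hp' : p ≠ ∞) (hA : A ≠ ∞)
    (h : RieszBound p A) {f : ℝ → ℂ} (hf : MemLp f p volume) {s : ℝ} (hs : s = 1 ∨ s = -1)
    {ε : ℝ} (hε : 0 < ε) : eLpNorm (rieszApprox s f ε) p volume ≤ A * eLpNorm f p volume := by
  have key : ∀ g : ℝ → ℂ, MemLp g p volume →
      eLpNorm (rieszApprox 1 g ε) p volume ≤ A * eLpNorm g p volume := by
    intro g hg
    obtain ⟨u, uc, us, hu⟩ := exists_seq_tendsto_eLpNorm hp' hg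
    have hum : ∀ n, MemLp (u n) p volume := fun n => (uc n).memLp_of_hasCompactSupport (us n)
    have hδ : ∀ δ : ℝ≥0∞, 0 < δ →
        eLpNorm (rieszApprox 1 g ε) p volume ≤ A * (eLpNorm g p volume + δ) := by
      intro δ hδ
      refine Lp.eLpNorm_le_of_ae_tendsto (u := atTop) (f := fun n => rieszApprox 1 (u n) ε) ?_
        (fun n => (memLp_rieszApprox_of_continuous (uc n) (us n) hε hp).1) (ae_of_all _ fun k => ?_)
      · filter_upwards [(tendsto_order.1 hu).2 δ hδ] with n hn
        refine (h _ (uc n) (us n) ε hε).trans ?_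
        gcongr
        have := eLpNorm_sub_le hg.1 (hg.sub (hum n)).1 hp.le
        simp only [sub_sub_cancel] at this
        exact this.trans (by gcongr; exact hn.le)
      · exact (tendsto_cauchyTransform hp.le hp' hg hum hu (by simp [hε.ne'])).const_mul _
    have hlim : Tendsto (fun δ : ℝ≥0∞ => A * (eLpNorm g p volume + δ)) (𝓝[>] 0)
        (𝓝 (A * (eLpNorm g p volume + 0))) := by
      refine Tendsto.mono_left ?_ nhdsWithin_le_nhds
      exact ENNReal.Tendsto.const_mul (tendsto_id.const_add _) (Or.inr hA)
    rw [add_zero] at hlim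
    exact ge_of_tendsto hlim (eventually_mem_nhdsWithin.mono hδ)
  rcases hs with rfl | rfl
  · exact key f hf
  · have h1 := key (fun x => conj (f x)) hf.star
    have e1 : eLpNorm (fun x => conj (f x)) p volume = eLpNorm f p volume := eLpNorm_conj f p volume
    have e2 : eLpNorm (rieszApprox 1 (fun x => conj (f x)) ε) p volume =
        eLpNorm (rieszApprox (-1) f ε) p volume := by
      rw [← eLpNorm_conj]
      refine eLpNorm_congr_ae (ae_of_all _ fun k => ?_)
      simp [rieszApprox_conj]
    rwa [e1, e2] at h1

lemma memLp_rieszApprox {p : ℝ≥0∞} (hp : RieszExponent p) {f : ℝ → ℂ} (hf : MemLp f p volume)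
    {s : ℝ} (hs : s = 1 ∨ s = -1) {ε : ℝ} (hε : 0 < ε) : MemLp (rieszApprox s f ε) p volume := by
  obtain ⟨h1, h2, A, hA, hAb⟩ := hp
  refine ⟨(continuous_rieszApprox (cauchyIntegrable_of_memLp h1.le h2 hf) ?_ hε).aestronglyMeasurable,
    (hAb.eLpNorm_le h1 h2 hA hf hs hε).trans_lt (ENNReal.mul_lt_top hA.lt_top hf.2)⟩
  rcases hs with rfl | rfl <;> norm_num

/-- A semigroup property: smoothing at height `δ` and then evaluating at height `ε` is evaluation at
height `ε + δ`. It reduces comparison of two heights to the approximate identity. -/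
lemma rieszApprox_poisson {h : ℝ → ℂ} (hc : Continuous h) (hs : HasCompactSupport h) {s : ℝ}
    (hs1 : s = 1 ∨ s = -1) {ε δ : ℝ} (hε : 0 < ε) (hδ : 0 < δ) :
    rieszApprox s (poisson δ h) ε = rieszApprox s h (ε + δ) := by
  ext k
  have e : ((k : ℂ) + s * ε * Complex.I).im = s * ε := by simp
  have hsign : Real.sign (s * ε) = s := by
    rcases hs1 with rfl | rfl
    · exact Real.sign_of_pos (by linarith)
    · exact Real.sign_of_neg (by linarith)
  have hs0 : s ≠ 0 := by rcases hs1 with rfl | rfl <;> norm_num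
  rw [rieszApprox, cauchyTransform_poisson hc hs hδ (by rw [e]; exact mul_ne_zero hs0 hε.ne'), e,
    hsign, rieszApprox]
  push_cast
  ring_nf

lemma exists_continuous_eLpNorm_sub_le {f : ℝ → ℂ} {p : ℝ≥0∞} (hp' : p ≠ ∞) (hf : MemLp f p volume)
    {A δ : ℝ≥0∞} (hA : A ≠ ∞) (hδ : 0 < δ) :
    ∃ h : ℝ → ℂ, Continuous h ∧ HasCompactSupport h ∧
      A * eLpNorm (fun x => f x - h x) p volume ≤ δ := by
  obtain ⟨u, uc, us, hu⟩ := exists_seq_tendsto_eLpNorm hp' hf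
  have h1 := ENNReal.Tendsto.const_mul hu (Or.inr hA)
  rw [mul_zero] at h1
  obtain ⟨n, hn⟩ := ((tendsto_order.1 h1).2 δ hδ).exists
  exact ⟨u n, uc n, us n, hn.le⟩

/-- The theorem of M. Riesz: the Riesz projections are defined on `L^p`. -/
lemma exists_isRieszProj {p : ℝ≥0∞} (hp : RieszExponent p) {f : ℝ → ℂ} (hf : MemLp f p volume)
    {s : ℝ} (hs : s = 1 ∨ s = -1) :
    ∃ F : ℝ → ℂ, MemLp F p volume ∧
      Tendsto (fun ε => eLpNorm (fun k => rieszApprox s f ε k - F k) p volume) (𝓝[>] 0) (𝓝 0) := by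
  have hpe := hp
  obtain ⟨h1, h2, A, hA, hAb⟩ := hp
  have hs0 : s ≠ 0 := by rcases hs with rfl | rfl <;> norm_num
  have : Fact (1 ≤ p) := ⟨h1.le⟩
  set T : ℝ → Lp ℂ p (volume : Measure ℝ) := fun ε =>
    if h : 0 < ε then (memLp_rieszApprox hpe hf hs h).toLp _ else 0 with hT
  -- A Cauchy estimate in three pieces: replacing `f` by a test function `h` costs `δ` at each
  -- height. For `h`, the semigroup property bounds the difference between heights by `A` times the
  -- distance of `h` from its Poisson integral at `ε' - ε`.
  have hdist : ∀ δ : ℝ≥0∞, 0 < δ → ∃ e > 0, ∀ ε ε' : ℝ, 0 < ε → ε ≤ ε' → ε' < e →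
      edist (T ε) (T ε') ≤ 3 * δ := by
    intro δ hδ
    obtain ⟨h, hc, hsup, hle⟩ := exists_continuous_eLpNorm_sub_le h2 hf hA hδ
    have hm : MemLp h p volume := hc.memLp_of_hasCompactSupport hsup
    obtain ⟨C, hC⟩ := hsup.exists_bound_of_continuous hc
    have hlim := ENNReal.Tendsto.const_mul (tendsto_eLpNorm_poisson_sub hc hsup h1.le h2)
      (Or.inr hA)
    rw [mul_zero] at hlim
    obtain ⟨e, he, hball⟩ := Metric.eventually_nhds_iff.1 ((tendsto_order.1 hlim).2 δ hδ)
    refine ⟨e, he, fun ε ε' hε hεε' hε' => ?_⟩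
    have hε'0 := hε.trans_le hεε'
    have b1 : ∀ t : ℝ, 0 < t →
        eLpNorm (fun k => rieszApprox s f t k - rieszApprox s h t k) p volume ≤ δ := by
      intro t ht
      have e1 := hAb.eLpNorm_le h1 h2 hA (hf.sub hm) hs ht
      refine le_trans (le_of_eq ?_) (e1.trans hle)
      congr 1
      ext k
      exact (rieszApprox_sub (cauchyIntegrable_of_memLp h1.le h2 hf)
        (cauchyIntegrable_of_memLp h1.le h2 hm) hs0 ht).symm
    have b2 : eLpNorm (fun k => rieszApprox s h ε k - rieszApprox s h ε' k) p volume ≤ δ := by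
      rcases hεε'.eq_or_lt with rfl | hlt
      · simp
      have hPm : MemLp (poisson (ε' - ε) h) p volume :=
        ⟨(continuous_poisson hc hC _).aestronglyMeasurable,
          (eLpNorm_poisson_le hc h1.le h2 _).trans_lt hm.2⟩
      have e1 := hAb.eLpNorm_le h1 h2 hA (hm.sub hPm) hs hε
      have e2 : rieszApprox s h ε' = rieszApprox s (poisson (ε' - ε) h) ε := by
        rw [rieszApprox_poisson hc hsup hs hε (sub_pos.2 hlt), add_sub_cancel]
      have e3 := hball (y := ε' - ε) (by
        rw [Real.dist_eq, sub_zero, abs_of_pos (sub_pos.2 hlt)]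
        linarith)
      refine le_trans (le_of_eq ?_) (e1.trans ?_)
      · congr 1
        ext k
        rw [e2]
        exact (rieszApprox_sub (cauchyIntegrable_of_memLp h1.le h2 hm)
          (cauchyIntegrable_of_memLp h1.le h2 hPm) hs0 hε).symm
      · have : eLpNorm (h - poisson (ε' - ε) h) p volume =
            eLpNorm (fun k => poisson (ε' - ε) h k - h k) p volume := eLpNorm_sub_comm _ _ _ _
        rw [this]
        exact e3.le
    simp only [hT, dif_pos hε, dif_pos hε'0]
    rw [Lp.edist_toLp_toLp]
    have m1 := memLp_rieszApprox hpe hf hs hε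
    have m2 := memLp_rieszApprox hpe hf hs hε'0
    have m3 := memLp_rieszApprox hpe hm hs hε
    have m4 := memLp_rieszApprox hpe hm hs hε'0
    have e : rieszApprox s f ε - rieszApprox s f ε' =
        ((fun k => rieszApprox s f ε k - rieszApprox s h ε k) +
          fun k => rieszApprox s h ε k - rieszApprox s h ε' k) -
        fun k => rieszApprox s f ε' k - rieszApprox s h ε' k := by
      ext k
      simp
    rw [e]
    refine (eLpNorm_sub_le ((m1.sub m3).add (m3.sub m4)).1 (m2.sub m4).1 h1.le).trans ?_
    calc _ ≤ (δ + δ) + δ := add_le_add ((eLpNorm_add_le (m1.sub m3).1 (m3.sub m4).1 h1.le).trans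
          (add_le_add (b1 ε hε) b2)) (b1 ε' hε'0)
      _ = 3 * δ := by ring
  have hcauchy : Cauchy (map T (𝓝[>] 0)) := by
    refine EMetric.cauchy_iff.2 ⟨NeBot.ne inferInstance, fun r hr => ?_⟩
    obtain ⟨δ, hδ, hδr⟩ : ∃ δ : ℝ≥0∞, 0 < δ ∧ 3 * δ < r := by
      obtain ⟨r', hr'0, hr'⟩ := exists_between hr
      refine ⟨r' / 3, ENNReal.div_pos hr'0.ne' (by simp), ?_⟩
      rwa [ENNReal.mul_div_cancel (by simp) (by simp)]
    obtain ⟨e, he, hle⟩ := hdist δ hδ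
    refine ⟨T '' Set.Ioo 0 e, image_mem_map (Ioo_mem_nhdsGT he), ?_⟩
    rintro _ ⟨ε, hε, rfl⟩ _ ⟨ε', hε', rfl⟩
    rcases le_total ε ε' with h | h
    · exact (hle ε ε' hε.1 h hε'.2).trans_lt hδr
    · rw [edist_comm]
      exact (hle ε' ε hε'.1 h hε.2).trans_lt hδr
  obtain ⟨F, hF⟩ := cauchy_map_iff_exists_tendsto.1 hcauchy
  refine ⟨F, Lp.memLp F, ?_⟩
  rw [Lp.tendsto_Lp_iff_tendsto_eLpNorm'] at hF
  refine hF.congr' ?_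
  filter_upwards [eventually_mem_nhdsWithin] with ε hε
  refine eLpNorm_congr_ae ?_
  simp only [hT, dif_pos (show 0 < ε from hε)]
  filter_upwards [(memLp_rieszApprox hpe hf hs hε).coeFn_toLp] with k hk
  simp [hk]

/-- Convergence in either norm implies convergence in measure, where limits are unique. This makes
the Riesz projection independent of the exponent used to define it. -/
lemma ae_eq_of_tendsto_eLpNorm {p q : ℝ≥0∞} (hp : p ≠ 0) (hq : q ≠ 0) {T : ℝ → ℝ → ℂ}
    {F G : ℝ → ℂ} (hT : ∀ᶠ ε in 𝓝[>] (0 : ℝ), AEStronglyMeasurable (T ε) volume)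
    (hF : AEStronglyMeasurable F volume) (hG : AEStronglyMeasurable G volume)
    (h1 : Tendsto (fun ε => eLpNorm (fun k => T ε k - F k) p volume) (𝓝[>] 0) (𝓝 0))
    (h2 : Tendsto (fun ε => eLpNorm (fun k => T ε k - G k) q volume) (𝓝[>] 0) (𝓝 0)) :
    F =ᵐ[volume] G := by
  classical
  -- The uniqueness argument is applied to a family measurable for every `ε`, so members that fail
  -- this are replaced by `0`; near `0⁺` nothing changes.
  set T' : ℝ → ℝ → ℂ := fun ε => if AEStronglyMeasurable (T ε) volume then T ε else 0 with hT'
  have hm : ∀ ε, AEStronglyMeasurable (T' ε) volume := by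
    intro ε
    simp only [hT']
    split_ifs with h
    · exact h
    · exact aestronglyMeasurable_zero
  have he : ∀ᶠ ε in 𝓝[>] (0 : ℝ), T ε = T' ε := hT.mono fun ε h => by simp [hT', h]
  refine tendstoInMeasure_ae_unique (f := T') (u := 𝓝[>] (0 : ℝ))
    (tendstoInMeasure_of_tendsto_eLpNorm hp hm hF (h1.congr' ?_))
    (tendstoInMeasure_of_tendsto_eLpNorm hq hm hG (h2.congr' ?_))
  · exact he.mono fun ε h => by simp only [h]; rfl
  · exact he.mono fun ε h => by simp only [h]; rfl

/-- The limit chosen by `rieszProj` comes with an unspecified exponent; uniqueness identifies it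
with the limit in the prescribed `L^p`. -/
lemma rieszProj_spec {p : ℝ≥0∞} (hp : RieszExponent p) {f : ℝ → ℂ} (hf : MemLp f p volume)
    {s : ℝ} (hs : s = 1 ∨ s = -1) :
    MemLp (rieszProj s f) p volume ∧
      Tendsto (fun ε => eLpNorm (fun k => rieszApprox s f ε k - rieszProj s f k) p volume)
        (𝓝[>] 0) (𝓝 0) := by
  obtain ⟨F, hFm, hF⟩ := exists_isRieszProj hp hf hs
  have hs0 : s ≠ 0 := by rcases hs with rfl | rfl <;> norm_num
  have hex : ∃ F, IsRieszProj s f F := ⟨F, p, hp.1, hp.2.1.lt_top, hf, hFm, hF⟩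
  have hch : rieszProj s f = hex.choose := by rw [rieszProj, dif_pos hex]
  obtain ⟨q, hq1, hq2, hfq, hGm, hG⟩ := hex.choose_spec
  rw [← hch] at hGm hG
  have hae : F =ᵐ[volume] rieszProj s f := by
    refine ae_eq_of_tendsto_eLpNorm (T := rieszApprox s f) (zero_lt_one.trans hp.1).ne'
      (zero_lt_one.trans hq1).ne' ?_ hFm.1 hGm.1 hF hG
    filter_upwards [eventually_mem_nhdsWithin] with ε hε
    exact (continuous_rieszApprox (cauchyIntegrable_of_memLp hp.1.le hp.2.1 hf) hs0
      hε).aestronglyMeasurable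
  refine ⟨hFm.ae_eq hae, hF.congr fun ε => eLpNorm_congr_ae ?_⟩
  filter_upwards [hae] with k hk
  rw [hk]

/-- The Riesz projections are complementary. -/
lemma rieszPlus_add_rieszMinus {p : ℝ≥0∞} (hp : RieszExponent p) {f : ℝ → ℂ}
    (hf : MemLp f p volume) : ∀ᵐ k : ℝ, rieszPlus f k + rieszMinus f k = f k := by
  have hplus := rieszProj_spec hp hf (Or.inl rfl)
  have hminus := rieszProj_spec hp hf (Or.inr rfl)
  have hpe := hp
  obtain ⟨h1, h2, A, hA, hAb⟩ := hp
  set T : ℝ → ℝ → ℂ := fun ε k => rieszApprox 1 f ε k + rieszApprox (-1) f ε k with hT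
  have hTm : ∀ ε : ℝ, 0 < ε → MemLp (T ε) p volume := fun ε hε =>
    (memLp_rieszApprox hpe hf (Or.inl rfl) hε).add (memLp_rieszApprox hpe hf (Or.inr rfl) hε)
  have l1 : Tendsto (fun ε => eLpNorm (fun k => T ε k - (rieszPlus f k + rieszMinus f k)) p volume)
      (𝓝[>] 0) (𝓝 0) := by
    have := hplus.2.add hminus.2
    rw [add_zero] at this
    refine tendsto_of_tendsto_of_tendsto_of_le_of_le' tendsto_const_nhds this
      (Eventually.of_forall fun _ => zero_le) ?_
    filter_upwards [eventually_mem_nhdsWithin] with ε hε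
    refine le_trans (le_of_eq ?_) (eLpNorm_add_le
      ((memLp_rieszApprox hpe hf (Or.inl rfl) hε).sub hplus.1).1
      ((memLp_rieszApprox hpe hf (Or.inr rfl) hε).sub hminus.1).1 h1.le)
    congr 1
    ext k
    simp only [hT, rieszPlus, rieszMinus, Pi.add_apply]
    ring
  have l2 : Tendsto (fun ε => eLpNorm (fun k => T ε k - f k) p volume) (𝓝[>] 0) (𝓝 0) := by
    refine ENNReal.tendsto_nhds_zero.2 fun δ hδ => ?_
    have hδ2 : 0 < δ / 2 := ENNReal.div_pos hδ.ne' (by simp)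
    -- The error `f - h` enters three times: through two approximations, at cost `A` each, and once
    -- directly.
    obtain ⟨h, hc, hsup, hle⟩ := exists_continuous_eLpNorm_sub_le (A := 2 * A + 1) h2 hf
      (by finiteness) hδ2
    have hm : MemLp h p volume := hc.memLp_of_hasCompactSupport hsup
    obtain ⟨C, hC⟩ := hsup.exists_bound_of_continuous hc
    have hlim := (tendsto_order.1 ((tendsto_eLpNorm_poisson_sub hc hsup h1.le h2).mono_left
      (nhdsWithin_le_nhds (s := Set.Ioi 0)))).2 _ hδ2
    filter_upwards [hlim, eventually_mem_nhdsWithin] with ε hε hε0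
    have hε0 : 0 < ε := hε0
    have ci := cauchyIntegrable_of_memLp h1.le h2 hf
    have ch := cauchyIntegrable_of_memLp h1.le h2 hm
    have mfh : MemLp (fun x => f x - h x) p volume := hf.sub hm
    have hPm : MemLp (poisson ε h) p volume :=
      ⟨(continuous_poisson hc hC _).aestronglyMeasurable,
        (eLpNorm_poisson_le hc h1.le h2 _).trans_lt hm.2⟩
    have e : (fun k => T ε k - f k) = (rieszApprox 1 (fun x => f x - h x) ε +
        rieszApprox (-1) (fun x => f x - h x) ε - fun x => f x - h x) +
        fun k => poisson ε h k - h k := by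
      ext k
      simp only [hT, Pi.add_apply, Pi.sub_apply]
      rw [rieszApprox_sub ci ch one_ne_zero hε0, rieszApprox_sub ci ch (by norm_num) hε0,
        poisson_eq_rieszApprox ch hε0]
      ring
    have m1 := memLp_rieszApprox hpe mfh (Or.inl rfl) hε0
    have m2 := memLp_rieszApprox hpe mfh (Or.inr rfl) hε0
    rw [e]
    refine (eLpNorm_add_le ((m1.add m2).sub mfh).1 (hPm.sub hm).1 h1.le).trans ?_
    calc _ ≤ (2 * A + 1) * eLpNorm (fun x => f x - h x) p volume + δ / 2 := by
          refine add_le_add ((eLpNorm_sub_le (m1.add m2).1 mfh.1 h1.le).trans ?_) hε.le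
          refine (add_le_add_left ((eLpNorm_add_le m1.1 m2.1 h1.le).trans (add_le_add
            (hAb.eLpNorm_le h1 h2 hA mfh (Or.inl rfl) hε0)
            (hAb.eLpNorm_le h1 h2 hA mfh (Or.inr rfl) hε0))) _).trans (le_of_eq ?_)
          ring
      _ ≤ δ / 2 + δ / 2 := by gcongr
      _ = δ := ENNReal.add_halves δ
  refine ae_eq_of_tendsto_eLpNorm (zero_lt_one.trans h1).ne' (zero_lt_one.trans h1).ne' ?_
    (hplus.1.1.add hminus.1.1) hf.1 l1 l2
  filter_upwards [eventually_mem_nhdsWithin] with ε hε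
  exact (hTm ε hε).1

/-! ### Cauchy transforms of products of Riesz projections -/

lemma tendsto_cauchyTransform_of_eLpNorm_one {ι : Type*} {l : Filter ι} {f : ℝ → ℂ}
    {u : ι → ℝ → ℂ} (hf : Integrable f) (hu : ∀ᶠ n in l, Integrable (u n))
    (h : Tendsto (fun n => eLpNorm (fun x => u n x - f x) 1 volume) l (𝓝 0)) {z : ℂ}
    (hz : z.im ≠ 0) :
    Tendsto (fun n => cauchyTransform (u n) z) l (𝓝 (cauchyTransform f z)) := by
  rw [tendsto_iff_edist_tendsto_0]
  have : (1 : ℝ≥0∞).HolderConjugate (1 : ℝ≥0∞).conjExponent :=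
    ENNReal.HolderConjugate.conjExponent le_rfl
  have h1 := ENNReal.Tendsto.mul_const (b := eLpNorm (fun x : ℝ => ((x : ℂ) - z)⁻¹)
    (1 : ℝ≥0∞).conjExponent volume) h
    (Or.inr (memLp_inv_ofReal_sub hz (one_lt_conjExponent ENNReal.one_ne_top)).2.ne)
  rw [zero_mul] at h1
  refine tendsto_of_tendsto_of_tendsto_of_le_of_le' tendsto_const_nhds h1
    (Eventually.of_forall fun _ => zero_le) ?_
  filter_upwards [hu] with n hn
  have hf' := memLp_one_iff_integrable.2 hf
  have hn' := memLp_one_iff_integrable.2 hn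
  have h2 := norm_cauchyTransform_le le_rfl ENNReal.one_ne_top (hn'.sub hf') hz
  rw [edist_eq_enorm_sub, ← ofReal_norm]
  have h3 := cauchyTransform_sub (cauchyIntegrable_of_memLp le_rfl ENNReal.one_ne_top hn')
    (cauchyIntegrable_of_memLp le_rfl ENNReal.one_ne_top hf') hz
  rw [← h3]
  exact h2

lemma eLpNorm_mul_le (p q : ℝ≥0∞) [p.HolderConjugate q] {f g : ℝ → ℂ}
    (hf : AEStronglyMeasurable f volume) (hg : AEStronglyMeasurable g volume) :
    eLpNorm (fun x => f x * g x) 1 volume ≤ eLpNorm f p volume * eLpNorm g q volume := by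
  have h := eLpNorm_smul_le_mul_eLpNorm (p := p) (q := q) (r := 1) (f := g) (φ := f) hg hf
  rwa [smul_eq_mul] at h

lemma integrable_mul_of_memLp (p q : ℝ≥0∞) [p.HolderConjugate q] {f g : ℝ → ℂ}
    (hf : MemLp f p volume) (hg : MemLp g q volume) : Integrable fun x => f x * g x :=
  hf.integrable_mul hg

/-- The Cauchy transform of a product depends continuously on the factors. -/
lemma tendsto_cauchyTransform_mul {ι : Type*} {l : Filter ι} {p q : ℝ≥0∞} [p.HolderConjugate q]
    {f g : ℝ → ℂ} {u v : ι → ℝ → ℂ} (hf : MemLp f p volume) (hg : MemLp g q volume)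
    (hu : ∀ᶠ n in l, MemLp (u n) p volume) (hv : ∀ᶠ n in l, MemLp (v n) q volume)
    (huf : Tendsto (fun n => eLpNorm (fun x => u n x - f x) p volume) l (𝓝 0))
    (hvg : Tendsto (fun n => eLpNorm (fun x => v n x - g x) q volume) l (𝓝 0)) {z : ℂ}
    (hz : z.im ≠ 0) :
    Tendsto (fun n => cauchyTransform (fun x => u n x * v n x) z) l
      (𝓝 (cauchyTransform (fun x => f x * g x) z)) := by
  refine tendsto_cauchyTransform_of_eLpNorm_one (integrable_mul_of_memLp p q hf hg)
    ((hu.and hv).mono fun n h => integrable_mul_of_memLp p q h.1 h.2) ?_ hz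
  have h1 : Tendsto (fun n => eLpNorm (fun x => u n x - f x) p volume *
      eLpNorm (fun x => v n x - g x) q volume) l (𝓝 0) := by
    simpa using ENNReal.Tendsto.mul huf (Or.inr ENNReal.zero_ne_top) hvg
      (Or.inr ENNReal.zero_ne_top)
  have h2 := ENNReal.Tendsto.mul_const (b := eLpNorm g q volume) huf (Or.inr hg.2.ne)
  have h3 := ENNReal.Tendsto.const_mul (a := eLpNorm f p volume) hvg (Or.inr hf.2.ne)
  have h4 := (h1.add h2).add h3
  simp only [zero_mul, mul_zero, add_zero] at h4
  refine tendsto_of_tendsto_of_tendsto_of_le_of_le' tendsto_const_nhds h4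
    (Eventually.of_forall fun _ => zero_le) ?_
  filter_upwards [hu, hv] with n hun hvn
  have m1 : MemLp (fun x => u n x - f x) p volume := hun.sub hf
  have m2 : MemLp (fun x => v n x - g x) q volume := hvn.sub hg
  have e : (fun x => u n x * v n x - f x * g x) =
      ((fun x => (u n x - f x) * (v n x - g x)) + fun x => (u n x - f x) * g x) +
        fun x => f x * (v n x - g x) := by
    ext x
    simp only [Pi.add_apply]
    ring
  rw [e]
  have a1 := (integrable_mul_of_memLp p q m1 m2).1
  have a2 := (integrable_mul_of_memLp p q m1 hg).1
  have a3 := (integrable_mul_of_memLp p q hf m2).1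
  refine (eLpNorm_add_le (a1.add a2) a3 le_rfl).trans ?_
  exact add_le_add ((eLpNorm_add_le a1 a2 le_rfl).trans (add_le_add
    (eLpNorm_mul_le p q m1.1 m2.1) (eLpNorm_mul_le p q m1.1 hg.1)))
    (eLpNorm_mul_le p q hf.1 m2.1)

/-- Shifting by `i ε` makes this the integral of `G(t) / (t - (z + i ε))` along `Im t = ε`, where `G
= C(a) C(b)` is holomorphic above. The pole lies above or below the line according to the sign of
`Im z`, hence the two cases. -/
lemma cauchyTransform_rieszApprox_mul_of_continuous {a b : ℝ → ℂ} (ac : Continuous a)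
    (as : HasCompactSupport a) (bc : Continuous b) (bs : HasCompactSupport b) {ε : ℝ} (hε : 0 < ε)
    {z : ℂ} (hz : z.im ≠ 0) :
    cauchyTransform (fun k => rieszApprox 1 a ε k * rieszApprox 1 b ε k) z =
      if 0 < z.im then 1 / (2 * Real.pi * Complex.I) *
        (cauchyTransform a (z + ε * Complex.I) * cauchyTransform b (z + ε * Complex.I)) else 0 := by
  obtain ⟨C₁, hC₁0, hC₁⟩ := exists_norm_cauchyTransform_le ac as hε
  obtain ⟨C₂, hC₂0, hC₂⟩ := exists_norm_cauchyTransform_le bc bs hε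
  set G : ℂ → ℂ := fun z => cauchyTransform a z * cauchyTransform b z with hG
  have hGd : DifferentiableOn ℂ G {z | ε ≤ z.im} :=
    ((cauchyIntegrable_of_continuous ac as).differentiableOn fun z hz => (hε.trans_le hz).ne').mul
      ((cauchyIntegrable_of_continuous bc bs).differentiableOn fun z hz => (hε.trans_le hz).ne')
  have hGb : ∀ z : ℂ, ε ≤ z.im → ‖G z‖ ≤ C₁ * C₂ / ε / ‖z‖ := by
    intro z hz
    have hεz : ε ≤ ‖z‖ := norm_ge_of_le_im hz
    have hz0 : 0 < ‖z‖ := hε.trans_le hεz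
    simp only [hG]
    rw [norm_mul]
    calc _ ≤ C₁ / ‖z‖ * (C₂ / ‖z‖) := by
          gcongr
          · exact hC₁ z (hz.trans (le_abs_self _))
          · exact hC₂ z (hz.trans (le_abs_self _))
      _ = C₁ * C₂ / (‖z‖ * ‖z‖) := by rw [div_mul_div_comm]
      _ ≤ C₁ * C₂ / (ε * ‖z‖) := by gcongr
      _ = _ := by rw [div_div]
  have hI : (2 * Real.pi * Complex.I : ℂ) ≠ 0 := Complex.two_pi_I_ne_zero
  have e : cauchyTransform (fun k => rieszApprox 1 a ε k * rieszApprox 1 b ε k) z =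
      (1 / (2 * Real.pi * Complex.I)) ^ 2 * ∫ x : ℝ, G (x + ε * Complex.I) /
        (x + ε * Complex.I - (z + ε * Complex.I)) := by
    rw [cauchyTransform, ← integral_const_mul]
    refine integral_congr_ae (ae_of_all _ fun x => ?_)
    simp only [rieszApprox, hG, add_sub_add_right_eq_sub, Complex.ofReal_one, one_mul]
    ring
  rw [e]
  split_ifs with h
  · rw [integral_horizontal_div_of_gt hε hGd hGb (by simpa using h)]
    simp only [hG]
    field_simp
  · rw [integral_horizontal_div_of_lt hε hGd hGb (by
      have : z.im < 0 := lt_of_le_of_ne (not_lt.1 h) hz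
      simpa using this), mul_zero]

lemma tendsto_eLpNorm_rieszApprox_sub {p : ℝ≥0∞} (hp : RieszExponent p) {f : ℝ → ℂ}
    {u : ℕ → ℝ → ℂ} (hf : MemLp f p volume) (hu : ∀ n, MemLp (u n) p volume)
    (h : Tendsto (fun n => eLpNorm (fun x => f x - u n x) p volume) atTop (𝓝 0)) {ε : ℝ}
    (hε : 0 < ε) :
    Tendsto (fun n => eLpNorm (fun k => rieszApprox 1 (u n) ε k - rieszApprox 1 f ε k) p volume)
      atTop (𝓝 0) := by
  obtain ⟨h1, h2, A, hA, hAb⟩ := hp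
  have hlim := ENNReal.Tendsto.const_mul h (Or.inr hA)
  rw [mul_zero] at hlim
  refine tendsto_of_tendsto_of_tendsto_of_le_of_le tendsto_const_nhds hlim (fun _ => zero_le)
    fun n => ?_
  refine le_trans (le_of_eq ?_) (hAb.eLpNorm_le h1 h2 hA (hf.sub (hu n)) (Or.inl rfl) hε)
  have e : rieszApprox 1 (f - u n) ε = rieszApprox 1 f ε - rieszApprox 1 (u n) ε := by
    ext k
    exact rieszApprox_sub (cauchyIntegrable_of_memLp h1.le h2 hf)
      (cauchyIntegrable_of_memLp h1.le h2 (hu n)) one_ne_zero hε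
  rw [e, eLpNorm_sub_comm]
  rfl

lemma cauchyTransform_rieszApprox_mul {p q : ℝ≥0∞} [p.HolderConjugate q] (hp : RieszExponent p)
    (hq : RieszExponent q) {a b : ℝ → ℂ} (ha : MemLp a p volume) (hb : MemLp b q volume) {ε : ℝ}
    (hε : 0 < ε) {z : ℂ} (hz : z.im ≠ 0) :
    cauchyTransform (fun k => rieszApprox 1 a ε k * rieszApprox 1 b ε k) z =
      if 0 < z.im then 1 / (2 * Real.pi * Complex.I) *
        (cauchyTransform a (z + ε * Complex.I) * cauchyTransform b (z + ε * Complex.I)) else 0 := by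
  obtain ⟨u, uc, us, hu⟩ := exists_seq_tendsto_eLpNorm hp.2.1 ha
  obtain ⟨v, vc, vs, hv⟩ := exists_seq_tendsto_eLpNorm hq.2.1 hb
  have hum : ∀ n, MemLp (u n) p volume := fun n => (uc n).memLp_of_hasCompactSupport (us n)
  have hvm : ∀ n, MemLp (v n) q volume := fun n => (vc n).memLp_of_hasCompactSupport (vs n)
  have hl := tendsto_cauchyTransform_mul (p := p) (q := q)
    (memLp_rieszApprox hp ha (Or.inl rfl) hε) (memLp_rieszApprox hq hb (Or.inl rfl) hε)
    (Eventually.of_forall fun n => memLp_rieszApprox hp (hum n) (Or.inl rfl) hε)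
    (Eventually.of_forall fun n => memLp_rieszApprox hq (hvm n) (Or.inl rfl) hε)
    (tendsto_eLpNorm_rieszApprox_sub hp ha hum hu hε)
    (tendsto_eLpNorm_rieszApprox_sub hq hb hvm hv hε) hz
  refine tendsto_nhds_unique hl ?_
  simp only [cauchyTransform_rieszApprox_mul_of_continuous (uc _) (us _) (vc _) (vs _) hε hz]
  split_ifs with h
  · have him : (z + ε * Complex.I).im ≠ 0 := by
      have : (z + ε * Complex.I).im = z.im + ε := by simp
      rw [this]
      linarith
    exact ((tendsto_cauchyTransform hp.1.le hp.2.1 ha hum hu him).mul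
      (tendsto_cauchyTransform hq.1.le hq.2.1 hb hvm hv him)).const_mul _
  · exact tendsto_const_nhds

/-- The Cauchy transform of a product of two functions with holomorphic extensions to the upper
half-plane. -/
lemma cauchyTransform_rieszPlus_mul {p q : ℝ≥0∞} [p.HolderConjugate q] (hp : RieszExponent p)
    (hq : RieszExponent q) {a b : ℝ → ℂ} (ha : MemLp a p volume) (hb : MemLp b q volume) {z : ℂ}
    (hz : z.im ≠ 0) :
    cauchyTransform (fun k => rieszPlus a k * rieszPlus b k) z =
      if 0 < z.im then 1 / (2 * Real.pi * Complex.I) *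
        (cauchyTransform a z * cauchyTransform b z) else 0 := by
  have sa := rieszProj_spec hp ha (Or.inl rfl)
  have sb := rieszProj_spec hq hb (Or.inl rfl)
  have hl := tendsto_cauchyTransform_mul (l := 𝓝[>] (0 : ℝ)) (p := p) (q := q) sa.1 sb.1
    (eventually_mem_nhdsWithin.mono fun ε hε => memLp_rieszApprox hp ha (Or.inl rfl) hε)
    (eventually_mem_nhdsWithin.mono fun ε hε => memLp_rieszApprox hq hb (Or.inl rfl) hε)
    sa.2 sb.2 hz
  refine tendsto_nhds_unique hl ?_
  refine Tendsto.congr' (eventually_mem_nhdsWithin.mono fun ε hε =>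
    (cauchyTransform_rieszApprox_mul hp hq ha hb hε hz).symm) ?_
  split_ifs with h
  · have hz' : Tendsto (fun ε : ℝ => z + ε * Complex.I) (𝓝[>] 0) (𝓝 z) := by
      have : Continuous fun ε : ℝ => z + ε * Complex.I := by fun_prop
      simpa using (this.tendsto 0).mono_left nhdsWithin_le_nhds
    have ca := ((cauchyIntegrable_of_memLp hp.1.le hp.2.1 ha).hasDerivAt hz).continuousAt
    have cb := ((cauchyIntegrable_of_memLp hq.1.le hq.2.1 hb).hasDerivAt hz).continuousAt
    exact ((ca.tendsto.comp hz').mul (cb.tendsto.comp hz')).const_mul _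
  · exact tendsto_const_nhds

lemma memLp_conj {p : ℝ≥0∞} {f : ℝ → ℂ} (hf : MemLp f p volume) :
    MemLp (fun x => conj (f x)) p volume := hf.star

/-- Conjugation exchanges the approximations from above and below, so each fact about `P₊` has its
mirror image for `P₋`. -/
lemma rieszMinus_ae_eq {p : ℝ≥0∞} (hp : RieszExponent p) {f : ℝ → ℂ} (hf : MemLp f p volume) :
    rieszMinus f =ᵐ[volume] fun k => conj (rieszPlus (fun x => conj (f x)) k) := by
  have s1 := rieszProj_spec hp (memLp_conj hf) (Or.inl rfl)
  have s2 := rieszProj_spec hp hf (Or.inr rfl)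
  have hp0 : p ≠ 0 := (zero_lt_one.trans hp.1).ne'
  refine ae_eq_of_tendsto_eLpNorm (T := rieszApprox (-1) f) hp0 hp0
    (eventually_mem_nhdsWithin.mono fun ε hε => (memLp_rieszApprox hp hf (Or.inr rfl) hε).1)
    s2.1.1 (memLp_conj s1.1).1 s2.2 (s1.2.congr fun ε => ?_)
  rw [← eLpNorm_conj]
  refine eLpNorm_congr_ae (ae_of_all _ fun k => ?_)
  simp [rieszApprox_conj, rieszPlus]

lemma cauchyTransform_rieszMinus_mul {p q : ℝ≥0∞} [p.HolderConjugate q] (hp : RieszExponent p)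
    (hq : RieszExponent q) {a b : ℝ → ℂ} (ha : MemLp a p volume) (hb : MemLp b q volume) {z : ℂ}
    (hz : z.im ≠ 0) :
    cauchyTransform (fun k => rieszMinus a k * rieszMinus b k) z =
      if 0 < z.im then 0 else -(1 / (2 * Real.pi * Complex.I) *
        (cauchyTransform a z * cauchyTransform b z)) := by
  have e : (fun k => rieszMinus a k * rieszMinus b k) =ᵐ[volume] fun k =>
      conj (rieszPlus (fun x => conj (a x)) k * rieszPlus (fun x => conj (b x)) k) := by
    filter_upwards [rieszMinus_ae_eq hp ha, rieszMinus_ae_eq hq hb] with k h1 h2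
    rw [h1, h2, map_mul]
  have h1 := cauchyTransform_conj (fun k => rieszPlus (fun x => conj (a x)) k *
    rieszPlus (fun x => conj (b x)) k) (conj z)
  rw [Complex.conj_conj] at h1
  rw [cauchyTransform_congr e, h1, cauchyTransform_rieszPlus_mul hp hq (memLp_conj ha)
    (memLp_conj hb) (by simpa using hz), cauchyTransform_conj, cauchyTransform_conj]
  rcases lt_or_gt_of_ne hz with h | h
  · rw [if_pos (by simpa using h), if_neg h.not_gt]
    simp only [map_mul, map_div₀, map_one, Complex.conj_conj, Complex.conj_I,
      Complex.conj_ofReal, map_ofNat]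
    ring
  · rw [if_neg (by simpa using h.le), if_pos h, map_zero]

/-! ### The expression `L u` -/

/-- Exponents for which all the products in the expression `L u` are integrable. -/
structure AdmissibleExponents (φ ψ : L2R) (p q : ℝ≥0∞) : Prop where
  holder : p.HolderConjugate q
  left : RieszExponent p
  right : RieszExponent q
  memLp_left : MemLp φ p volume
  memLp_mul : ∀ u : L2R, MemLp (fun x => ψ x * u x) q volume
  memLp_mul_conj : MemLp (fun x => ψ x * conj (φ x)) 2 volume

lemma memLp_mul_of_holderTriple (p q r : ℝ≥0∞) [p.HolderTriple q r] {f g : ℝ → ℂ}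
    (hf : MemLp f p volume) (hg : MemLp g q volume) : MemLp (fun x => f x * g x) r volume :=
  hg.mul hf

/-- If `ψ` is bounded, then `ψ u ∈ L²` and both exponents are `2`. If `φ, ψ ∈ L⁴`, then `ψ u ∈
L^{4/3}`, which is paired with `φ ∈ L⁴`; Riesz's theorem for `4/3` is the dual of the one for `4`.
-/
lemma exists_admissibleExponents (φ ψ : L2R)
    (h : MemLp ψ ∞ volume ∨ (MemLp φ 4 volume ∧ MemLp ψ 4 volume)) :
    ∃ p q : ℝ≥0∞, AdmissibleExponents φ ψ p q := by
  rcases h with h | ⟨h1, h2⟩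
  · have : (∞ : ℝ≥0∞).HolderTriple 2 2 := inferInstance
    exact ⟨2, 2, inferInstance, rieszExponent_two, rieszExponent_two, Lp.memLp φ,
      fun u => memLp_mul_of_holderTriple ∞ 2 2 h (Lp.memLp u),
      memLp_mul_of_holderTriple ∞ 2 2 h (memLp_conj (Lp.memLp φ))⟩
  · have e44 : (4 : ℝ≥0∞)⁻¹ + 4⁻¹ = 2⁻¹ := by
      rw [← two_mul, show (4 : ℝ≥0∞) = 2 * 2 by norm_num,
        ENNReal.mul_inv (by simp) (by simp), ← mul_assoc,
        ENNReal.mul_inv_cancel (by simp) (by simp), one_mul]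
    have i1 : (4 : ℝ≥0∞).HolderTriple 4 2 := ⟨e44⟩
    have i2 : (4 : ℝ≥0∞).HolderTriple 2 (4⁻¹ + 2⁻¹)⁻¹ := ⟨by rw [inv_inv]⟩
    have i3 : (4 : ℝ≥0∞).HolderConjugate (4⁻¹ + 2⁻¹)⁻¹ := by
      refine ENNReal.holderConjugate_iff.2 ?_
      rw [inv_inv, ← add_assoc, e44, ENNReal.inv_two_add_inv_two]
    exact ⟨4, (4⁻¹ + 2⁻¹)⁻¹, i3, rieszExponent_four, rieszExponent_four.dual, h1,
      fun u => memLp_mul_of_holderTriple 4 2 _ h2 (Lp.memLp u),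
      memLp_mul_of_holderTriple 4 4 2 h2 (memLp_conj h1)⟩

namespace AdmissibleExponents

variable {φ ψ : L2R} {p q : ℝ≥0∞}

/-- The expression `L u` in terms of the boundary values of holomorphic functions. -/
lemma exprL_ae_eq (h : AdmissibleExponents φ ψ p q) (u : L2R) :
    exprL φ ψ u =ᵐ[volume] fun k =>
      ((rieszPlus (fun x => conj (φ x)) k * rieszPlus (fun x => ψ x * u x) k +
        -1 * (rieszPlus (fun x => ψ x * conj (φ x)) k * rieszPlus u k)) +
      (rieszMinus (fun x => ψ x * conj (φ x)) k * rieszMinus u k +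
        -1 * (rieszMinus (fun x => conj (φ x)) k * rieszMinus (fun x => ψ x * u x) k))) := by
  filter_upwards [rieszPlus_add_rieszMinus rieszExponent_two (Lp.memLp u),
    rieszPlus_add_rieszMinus rieszExponent_two h.memLp_mul_conj,
    rieszPlus_add_rieszMinus h.left (memLp_conj h.memLp_left),
    rieszPlus_add_rieszMinus h.right (h.memLp_mul u)] with k h1 h2 h3 h4
  rw [exprL, multiplier]
  -- The four relations `P₊ f + P₋ f = f`, for `u`, `ψ φ̄`, `φ̄` and `ψ u`, cancel every mixed
  -- product of a `P₊` and a `P₋`.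
  linear_combination (rieszPlus (fun x => ψ x * conj (φ x)) k) * h1 -
    (rieszMinus u k) * h2 + (rieszMinus (fun x => ψ x * u x) k) * h3 -
    (rieszPlus (fun x => conj (φ x)) k) * h4

lemma memLp_exprL (h : AdmissibleExponents φ ψ p q) (u : L2R) :
    MemLp (exprL φ ψ u) 1 volume := by
  have := h.holder
  have hu := fun s hs => (rieszProj_spec (s := s) rieszExponent_two (Lp.memLp u) hs).1
  have hm := fun s hs => (rieszProj_spec (s := s) rieszExponent_two h.memLp_mul_conj hs).1
  have hφ := fun s hs => (rieszProj_spec (s := s) h.left (memLp_conj h.memLp_left) hs).1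
  have hw := fun s hs => (rieszProj_spec (s := s) h.right (h.memLp_mul u) hs).1
  refine MemLp.ae_eq (h.exprL_ae_eq u).symm (memLp_one_iff_integrable.2 ?_)
  exact ((integrable_mul_of_memLp p q (hφ 1 (Or.inl rfl)) (hw 1 (Or.inl rfl))).add
    ((integrable_mul_of_memLp 2 2 (hm 1 (Or.inl rfl)) (hu 1 (Or.inl rfl))).const_mul _)).add
    ((integrable_mul_of_memLp 2 2 (hm _ (Or.inr rfl)) (hu _ (Or.inr rfl))).add
      ((integrable_mul_of_memLp p q (hφ _ (Or.inr rfl)) (hw _ (Or.inr rfl))).const_mul _))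

/-- In the upper half-plane only the products of `P₊` parts contribute, in the lower one only those
of `P₋` parts. The opposite signs in the expression and in Cauchy's formula compensate, so one
formula holds on both sides. -/
lemma cauchyTransform_exprL (h : AdmissibleExponents φ ψ p q) (u : L2R) {z : ℂ}
    (hz : z.im ≠ 0) :
    cauchyTransform (exprL φ ψ u) z = 1 / (2 * Real.pi * Complex.I) *
      (cauchyTransform (fun x => conj (φ x)) z * cauchyTransform (fun x => ψ x * u x) z -
        cauchyTransform (fun x => ψ x * conj (φ x)) z * cauchyTransform u z) := by
  have := h.holder
  have hu := fun s hs => (rieszProj_spec (s := s) rieszExponent_two (Lp.memLp u) hs).1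
  have hm := fun s hs => (rieszProj_spec (s := s) rieszExponent_two h.memLp_mul_conj hs).1
  have hφ := fun s hs => (rieszProj_spec (s := s) h.left (memLp_conj h.memLp_left) hs).1
  have hw := fun s hs => (rieszProj_spec (s := s) h.right (h.memLp_mul u) hs).1
  have ci : ∀ {f : ℝ → ℂ}, Integrable f → CauchyIntegrable f := fun hf =>
    cauchyIntegrable_of_memLp le_rfl ENNReal.one_ne_top (memLp_one_iff_integrable.2 hf)
  have c1 := ci (integrable_mul_of_memLp p q (hφ 1 (Or.inl rfl)) (hw 1 (Or.inl rfl)))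
  have c2 := ci (integrable_mul_of_memLp 2 2 (hm 1 (Or.inl rfl)) (hu 1 (Or.inl rfl)))
  have c3 := ci (integrable_mul_of_memLp 2 2 (hm _ (Or.inr rfl)) (hu _ (Or.inr rfl)))
  have c4 := ci (integrable_mul_of_memLp p q (hφ _ (Or.inr rfl)) (hw _ (Or.inr rfl)))
  have e1 := cauchyTransform_rieszPlus_mul h.left h.right (memLp_conj h.memLp_left)
    (h.memLp_mul u) hz
  have e2 := cauchyTransform_rieszPlus_mul rieszExponent_two rieszExponent_two h.memLp_mul_conj
    (Lp.memLp u) hz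
  have e3 := cauchyTransform_rieszMinus_mul rieszExponent_two rieszExponent_two h.memLp_mul_conj
    (Lp.memLp u) hz
  have e4 := cauchyTransform_rieszMinus_mul h.left h.right (memLp_conj h.memLp_left)
    (h.memLp_mul u) hz
  rw [cauchyTransform_congr (h.exprL_ae_eq u)]
  refine (cauchyTransform_add (c1.add (c2.const_mul (-1))) (c3.add (c4.const_mul (-1))) hz).trans ?_
  refine (congrArg₂ (· + ·) (cauchyTransform_add c1 (c2.const_mul (-1)) hz)
    (cauchyTransform_add c3 (c4.const_mul (-1)) hz)).trans ?_
  simp only [cauchyTransform_const_mul]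
  refine (congrArg₂ (· + ·) (congrArg₂ (fun a b => a + -1 * b) e1 e2)
    (congrArg₂ (fun a b => a + -1 * b) e3 e4)).trans ?_
  split_ifs with hpos <;> ring

/-- The eigenvalue equation for `L` in terms of Cauchy transforms. -/
lemma exprL_eq_iff (h : AdmissibleExponents φ ψ p q) (u : L2R) :
    (∀ᵐ k : ℝ, exprL φ ψ u k = 1 / (2 * Real.pi * Complex.I) * u k) ↔
      ∀ z : ℂ, z.im ≠ 0 →
        cauchyTransform u z * (1 + cauchyTransform (fun x => ψ x * conj (φ x)) z) -
          cauchyTransform (fun x => conj (φ x)) z * cauchyTransform (fun x => ψ x * u x) z = 0 := by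
  have cu : CauchyIntegrable u := cauchyIntegrable_of_memLp (by norm_num) (by simp) (Lp.memLp u)
  have cL : CauchyIntegrable (exprL φ ψ u) :=
    cauchyIntegrable_of_memLp le_rfl ENNReal.one_ne_top (h.memLp_exprL u)
  have hI := Complex.two_pi_I_ne_zero
  set c : ℂ := 1 / (2 * Real.pi * Complex.I) with hc
  have hc0 : c ≠ 0 := one_div_ne_zero hI
  have key : ∀ z : ℂ, z.im ≠ 0 → cauchyTransform (fun k => c * u k - exprL φ ψ u k) z =
      c * (cauchyTransform u z * (1 + cauchyTransform (fun x => ψ x * conj (φ x)) z) -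
        cauchyTransform (fun x => conj (φ x)) z * cauchyTransform (fun x => ψ x * u x) z) := by
    intro z hz
    rw [cauchyTransform_sub (cu.const_mul c) cL hz, cauchyTransform_const_mul,
      h.cauchyTransform_exprL u hz]
    ring
  have cE : CauchyIntegrable fun k => c * u k - exprL φ ψ u k := by
    have := (cu.const_mul c).add (cL.const_mul (-1))
    simpa [sub_eq_add_neg] using this
  constructor
  · intro hae z hz
    have h0 : (fun k => c * u k - exprL φ ψ u k) =ᵐ[volume] fun _ => 0 := by
      filter_upwards [hae] with k hk
      rw [hk, sub_self]
    have h1 := key z hz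
    rw [cauchyTransform_congr h0] at h1
    have h2 : cauchyTransform (fun _ => (0 : ℂ)) z = 0 := by simp [cauchyTransform]
    rw [h2] at h1
    exact (mul_eq_zero.1 h1.symm).resolve_left hc0
  · intro hz
    have h0 := ae_eq_zero_of_cauchyTransform_eq_zero cE fun z hz' => by
      rw [key z hz', hz z hz', mul_zero]
    filter_upwards [h0] with k hk
    exact (sub_eq_zero.1 hk).symm

end AdmissibleExponents

/-! ### Traces -/

lemma inner_eq_integral (f g : L2R) : inner ℂ f g = ∫ x, conj (f x) * g x := by
  rw [L2.inner_def]
  refine integral_congr_ae (ae_of_all _ fun x => ?_)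
  simp [mul_comm]

lemma integrable_conj_mul {f g : ℝ → ℂ} (hf : MemLp f 2 volume) (hg : MemLp g 2 volume) :
    Integrable fun x => conj (f x) * g x :=
  integrable_mul_of_memLp 2 2 (memLp_conj hf) hg

lemma locallyIntegrable_of_memLp {f : ℝ → ℂ} (hf : MemLp f 2 volume) :
    LocallyIntegrable f volume := hf.locallyIntegrable (by norm_num)

lemma intervalIntegrable_of_memLp {f : ℝ → ℂ} (hf : MemLp f 2 volume) (a b : ℝ) :
    IntervalIntegrable f volume a b :=
  ((locallyIntegrable_of_memLp hf).integrableOn_isCompact isCompact_uIcc).intervalIntegrable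

lemma HasTraceOne.add_smul {u v : L2R} {a b : ℂ} (hu : HasTraceOne u a) (hv : HasTraceOne v b)
    (t : ℂ) : HasTraceOne (u + t • v) (a + t * b) := by
  refine (hu.add (hv.const_mul t)).congr fun R => ?_
  rw [← intervalIntegral.integral_const_mul, ← intervalIntegral.integral_add
    (intervalIntegrable_of_memLp (Lp.memLp u) _ _)
    ((intervalIntegrable_of_memLp (Lp.memLp v) _ _).const_mul t)]
  refine intervalIntegral.integral_congr_ae ?_
  filter_upwards [Lp.coeFn_add u (t • v), Lp.coeFn_smul t v] with x h1 h2 _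
  rw [h1, Pi.add_apply, h2, Pi.smul_apply, smul_eq_mul]

lemma HasTraceTwo.add_smul {u v : L2R} {a b : ℂ} (hu : HasTraceTwo u a) (hv : HasTraceTwo v b)
    (t : ℂ) : HasTraceTwo (u + t • v) (a + t * b) := by
  refine (MemLp.add hu (MemLp.const_mul hv t)).ae_eq ?_
  filter_upwards [Lp.coeFn_add u (t • v), Lp.coeFn_smul t v] with x h1 h2
  simp only [h1, Pi.add_apply, h2, Pi.smul_apply, smul_eq_mul]
  ring

lemma HasTraceTwo.unique {u : L2R} {a b : ℂ} (ha : HasTraceTwo u a) (hb : HasTraceTwo u b) :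
    a = b := by
  have h : MemLp (fun _ : ℝ => a - b) 2 volume := by
    refine (MemLp.sub hb ha).ae_eq (ae_of_all _ fun x => ?_)
    simp
  rw [memLp_const_iff (by norm_num) (by simp)] at h
  simpa [sub_eq_zero] using h

lemma HasBoundaryValue.add_smul {B : ℂ} {u v : L2R} {a b : ℂ} (hu : HasBoundaryValue B u a)
    (hv : HasBoundaryValue B v b) (t : ℂ) : HasBoundaryValue B (u + t • v) (a + t * b) := by
  obtain ⟨a₁, a₂, h1, h2, rfl⟩ := hu
  obtain ⟨b₁, b₂, h3, h4, rfl⟩ := hv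
  exact ⟨_, _, h1.add_smul h3 t, h2.add_smul h4 t, by ring⟩

/-! ### The adjoint of the Friedrichs model -/

/-- Both `(x - i) f` and `(x - i)⁻¹` are in `L²`. -/
lemma integrable_of_hasTraceTwo_zero {f : L2R} (hf : HasTraceTwo f 0) : Integrable f := by
  have h1 : MemLp (fun x : ℝ => ((x : ℂ) - Complex.I) * f x) 2 volume := by
    have h := MemLp.sub hf ((Lp.memLp f).const_mul Complex.I)
    refine h.ae_eq (ae_of_all _ fun x => ?_)
    simp only [Pi.sub_apply]
    ring
  have hI : Complex.I.im ≠ 0 := by simp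
  have h2 := integrable_mul_of_memLp 2 2 (memLp_inv_ofReal_sub hI (by norm_num)) h1
  refine h2.congr (ae_of_all _ fun x => ?_)
  simp only
  rw [← mul_assoc, inv_mul_cancel₀ (ofReal_sub_ne_zero hI x), one_mul]

/-- The factor `x` stays with the element of the domain of `Ã`, because `x u` need not be in `L²`.
-/
lemma inner_eq_of_mem_opA {φ ψ : L2R} {p : L2R × L2R} (hp : p ∈ opATilde φ ψ) (u : L2R) :
    inner ℂ p.2 u = (∫ x : ℝ, conj ((x : ℂ) * p.1 x) * u x) +
      ∫ x : ℝ, conj (p.1 x) * (inner ℂ φ u * ψ x) := by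
  obtain ⟨h1, -, h3⟩ := hp
  have hx : MemLp (fun x : ℝ => (x : ℂ) * p.1 x) 2 volume := by simpa [HasTraceTwo] using h1
  have e1 : inner ℂ p.2 u = ∫ x : ℝ, (conj ((x : ℂ) * p.1 x) * u x +
      conj (inner ℂ ψ p.1) * (conj (φ x) * u x)) := by
    rw [inner_eq_integral]
    refine integral_congr_ae (h3.mono fun x hx => ?_)
    simp only [hx, map_add, map_mul]
    ring
  rw [e1, integral_add (integrable_conj_mul hx (Lp.memLp u))
    ((integrable_conj_mul (Lp.memLp φ) (Lp.memLp u)).const_mul _), integral_const_mul,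
    ← inner_eq_integral, inner_conj_symm, inner_eq_integral p.1 ψ, mul_comm, ← integral_const_mul]
  congr 1
  exact integral_congr_ae (ae_of_all _ fun x => by ring)

/-- The domain of `Ã` contains the compactly supported bounded functions of integral zero, and a
locally integrable function orthogonal to all of these is constant. -/
lemma exists_const_of_mem_adjoint {φ ψ u v : L2R} (h : (u, v) ∈ (opATilde φ ψ).adjoint) :
    ∃ c : ℂ, ∀ᵐ x : ℝ, v x = (x : ℂ) * u x - c + inner ℂ φ u * ψ x := by
  set w : ℝ → ℂ := fun x => (x : ℂ) * u x + inner ℂ φ u * ψ x - v x with hw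
  have hwl : LocallyIntegrable w volume :=
    (((locallyIntegrable_of_memLp (Lp.memLp u)).continuous_smul Complex.continuous_ofReal).add
      (locallyIntegrable_of_memLp ((Lp.memLp ψ).const_mul _))).sub
      (locallyIntegrable_of_memLp (Lp.memLp v))
  have key : ∀ K : Set ℝ, IsCompact K →
      ∫ x in K, w x = (volume.real K : ℂ) * ∫ x in Set.Icc (0 : ℝ) 1, w x := by
    intro K hK
    have hKm : MeasurableSet K := hK.measurableSet
    set m : ℂ := (volume.real K : ℂ) with hm
    -- The multiple of the indicator of `[0, 1]` gives `f` integral zero. Testing with `f` shows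
    -- that `∫_K w` is the measure of `K` times the mean of `w` over `[0, 1]`, the candidate for the
    -- constant.
    set f : ℝ → ℂ := fun x => K.indicator (fun _ => (1 : ℂ)) x -
      m * (Set.Icc (0 : ℝ) 1).indicator (fun _ => (1 : ℂ)) x with hf
    have mem : ∀ (s : Set ℝ), IsCompact s → ∀ g : ℝ → ℂ, Continuous g →
        MemLp (fun x => g x * s.indicator (fun _ => (1 : ℂ)) x) 2 volume := by
      intro s hs g hg
      have : (fun x => g x * s.indicator (fun _ => (1 : ℂ)) x) = s.indicator g := by
        ext x
        by_cases hx : x ∈ s <;> simp [hx]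
      rw [this, memLp_indicator_iff_restrict hs.measurableSet]
      obtain ⟨C, hC⟩ := hs.exists_bound_of_continuousOn hg.continuousOn
      have : IsFiniteMeasure (volume.restrict s) := ⟨by
        rw [Measure.restrict_apply_univ]; exact hs.measure_lt_top⟩
      exact MemLp.of_bound hg.aestronglyMeasurable C
        ((ae_restrict_iff' hs.measurableSet).2 (ae_of_all _ hC))
    have memf : ∀ g : ℝ → ℂ, Continuous g → MemLp (fun x => g x * f x) 2 volume := by
      intro g hg
      have h1 := (mem K hK g hg).sub ((mem (Set.Icc (0 : ℝ) 1) isCompact_Icc g hg).const_mul m)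
      refine h1.ae_eq (ae_of_all _ fun x => ?_)
      simp only [hf, Pi.sub_apply]
      ring
    have hf2 : MemLp f 2 volume := by simpa using memf (fun _ => 1) continuous_const
    have hxf := memf _ Complex.continuous_ofReal
    have hfconj : ∀ x, conj (f x) = f x := by
      intro x
      have : ∀ s : Set ℝ, conj (s.indicator (fun _ => (1 : ℂ)) x) =
          s.indicator (fun _ => (1 : ℂ)) x := by
        intro s
        by_cases hx : x ∈ s <;> simp [hx]
      simp only [hf, map_sub, map_mul, this, hm, Complex.conj_ofReal]
    have hind : ∀ (s : Set ℝ), IsCompact s → ∀ g : ℝ → ℂ, LocallyIntegrable g volume →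
        Integrable (fun x => s.indicator (fun _ => (1 : ℂ)) x * g x) ∧
        ∫ x, s.indicator (fun _ => (1 : ℂ)) x * g x = ∫ x in s, g x := by
      intro s hs g hg
      have : (fun x => s.indicator (fun _ => (1 : ℂ)) x * g x) = s.indicator g := by
        ext x
        by_cases hx : x ∈ s <;> simp [hx]
      rw [this]
      exact ⟨(integrable_indicator_iff hs.measurableSet).2 (hg.integrableOn_isCompact hs),
        integral_indicator hs.measurableSet⟩
    have hfg : ∀ g : ℝ → ℂ, LocallyIntegrable g volume → Integrable (fun x => f x * g x) ∧
        ∫ x, f x * g x = (∫ x in K, g x) - m * ∫ x in Set.Icc (0 : ℝ) 1, g x := by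
      intro g hg
      obtain ⟨i1, e1⟩ := hind K hK g hg
      obtain ⟨i2, e2⟩ := hind _ (isCompact_Icc (a := (0 : ℝ)) (b := 1)) g hg
      have e : (fun x => f x * g x) = fun x => K.indicator (fun _ => (1 : ℂ)) x * g x -
          m * ((Set.Icc (0 : ℝ) 1).indicator (fun _ => (1 : ℂ)) x * g x) := by
        ext x
        simp only [hf]
        ring
      rw [e]
      refine ⟨i1.sub (i2.const_mul m), ?_⟩
      rw [integral_sub i1 (i2.const_mul m), integral_const_mul, e1, e2]
    have hf0 : ∫ x, f x = 0 := by
      have h1 := (hfg (fun _ => 1) (locallyIntegrable_const _)).2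
      simpa [hm] using h1
    have hfi : Integrable f := by
      simpa using (hfg (fun _ => 1) (locallyIntegrable_const _)).1
    set F : L2R := hf2.toLp f with hF
    have hFae : F =ᵐ[volume] f := hf2.coeFn_toLp
    have hq : (F, hxf.toLp _ + inner ℂ ψ F • φ) ∈ opATilde φ ψ := by
      refine ⟨?_, ?_, ?_⟩
      · refine hxf.ae_eq ?_
        filter_upwards [hFae] with x hx
        simp [hx]
      · have := intervalIntegral_tendsto_integral hfi tendsto_neg_atTop_atBot tendsto_id
        rw [hf0] at this
        refine this.congr fun R => ?_
        refine intervalIntegral.integral_congr_ae ?_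
        filter_upwards [hFae] with x hx _
        exact hx.symm
      · filter_upwards [hFae, hxf.coeFn_toLp, Lp.coeFn_add (hxf.toLp _) (inner ℂ ψ F • φ),
          Lp.coeFn_smul (inner ℂ ψ F) φ] with x h1 h2 h3 h4
        simp only [h3, Pi.add_apply, h2, h4, Pi.smul_apply, smul_eq_mul, h1]
    have h1 := h _ hq
    rw [inner_eq_of_mem_opA hq] at h1
    simp only at h1
    rw [inner_eq_integral F v] at h1
    have a1 : ∫ x : ℝ, conj ((x : ℂ) * F x) * u x = ∫ x, f x * ((x : ℂ) * u x) := by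
      refine integral_congr_ae (hFae.mono fun x hx => ?_)
      simp only [hx, map_mul, hfconj, Complex.conj_ofReal]
      ring
    have a2 : ∫ x : ℝ, conj (F x) * (inner ℂ φ u * ψ x) = ∫ x, f x * (inner ℂ φ u * ψ x) :=
      integral_congr_ae (hFae.mono fun x hx => by simp only [hx, hfconj])
    have a3 : ∫ x : ℝ, conj (F x) * v x = ∫ x, f x * v x :=
      integral_congr_ae (hFae.mono fun x hx => by simp only [hx, hfconj])
    rw [a1, a2, a3] at h1
    have l1 : LocallyIntegrable (fun x : ℝ => (x : ℂ) * u x) volume :=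
      (locallyIntegrable_of_memLp (Lp.memLp u)).continuous_smul Complex.continuous_ofReal
    have l2 : LocallyIntegrable (fun x : ℝ => inner ℂ φ u * ψ x) volume :=
      locallyIntegrable_of_memLp ((Lp.memLp ψ).const_mul _)
    have l3 := locallyIntegrable_of_memLp (Lp.memLp v)
    have h2 : ∫ x, f x * w x = 0 := by
      have e : (fun x => f x * w x) = fun x =>
          f x * ((x : ℂ) * u x) + f x * (inner ℂ φ u * ψ x) - f x * v x := by
        ext x
        simp only [hw]
        ring
      have i : Integrable fun x => f x * ((x : ℂ) * u x) + f x * (inner ℂ φ u * ψ x) :=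
        (hfg _ l1).1.add (hfg _ l2).1
      rw [e, integral_sub i (hfg _ l3).1,
        integral_add (hfg _ l1).1 (hfg _ l2).1, h1, sub_self]
    rw [(hfg w hwl).2] at h2
    exact sub_eq_zero.1 h2
  set c : ℂ := ∫ x in Set.Icc (0 : ℝ) 1, w x with hc
  refine ⟨c, ?_⟩
  have h0 : ∀ᵐ x : ℝ, w x - c = 0 := by
    refine ae_eq_zero_of_forall_setIntegral_isCompact_eq_zero'
      (hwl.sub (locallyIntegrable_const c)) fun K hK => ?_
    rw [integral_sub (hwl.integrableOn_isCompact hK) (integrableOn_const hK.measure_lt_top.ne),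
      key K hK]
    simp
  filter_upwards [h0] with x hx
  simp only [hw] at hx
  linear_combination -hx

/-- Conversely, the constant is invisible to the domain of `Ã`, whose elements are integrable with
integral zero. -/
lemma mem_adjoint_iff {φ ψ : L2R} (p : L2R × L2R) :
    p ∈ (opATilde φ ψ).adjoint ↔
      ∃ c : ℂ, ∀ᵐ x : ℝ, p.2 x = (x : ℂ) * p.1 x - c + inner ℂ φ p.1 * ψ x := by
  refine ⟨fun h => exists_const_of_mem_adjoint h, ?_⟩
  rintro ⟨c, hc⟩ q hq
  obtain ⟨u, v⟩ := p
  simp only at hc ⊢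
  have hqi := integrable_of_hasTraceTwo_zero hq.1
  have hq0 : ∫ x, q.1 x = 0 := tendsto_nhds_unique
    (intervalIntegral_tendsto_integral hqi tendsto_neg_atTop_atBot tendsto_id) hq.2.1
  have hx : MemLp (fun x : ℝ => (x : ℂ) * q.1 x) 2 volume := by simpa [HasTraceTwo] using hq.1
  have i1 := integrable_conj_mul hx (Lp.memLp u)
  have i2 : Integrable fun x => conj (q.1 x) * c :=
    (LinearIsometryEquiv.integrable_comp_iff (L := Complex.conjLIE)).2 hqi |>.mul_const c
  have i3 := integrable_conj_mul (Lp.memLp q.1) ((Lp.memLp ψ).const_mul (inner ℂ φ u))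
  have e0 : ∫ x, conj (q.1 x) * c = 0 := by
    rw [integral_mul_const, integral_conj, hq0, map_zero, zero_mul]
  rw [inner_eq_of_mem_opA hq, inner_eq_integral q.1 v]
  have e : ∫ x, conj (q.1 x) * v x = ∫ x : ℝ, (conj ((x : ℂ) * q.1 x) * u x -
      conj (q.1 x) * c + conj (q.1 x) * (inner ℂ φ u * ψ x)) := by
    refine integral_congr_ae (hc.mono fun x hx => ?_)
    simp only [hx, map_mul, Complex.conj_ofReal]
    ring
  have i4 : Integrable fun x : ℝ => conj ((x : ℂ) * q.1 x) * u x - conj (q.1 x) * c := i1.sub i2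
  rw [e, integral_add i4 i3, integral_sub i1 i2, e0, sub_zero]

lemma adjoint_add_smul {T : Operator} {p q : L2R × L2R} (hp : p ∈ T.adjoint) (hq : q ∈ T.adjoint)
    (t : ℂ) : (p.1 + t • q.1, p.2 + t • q.2) ∈ T.adjoint := fun r hr => by
  simp only [inner_add_right, inner_smul_right, hp r hr, hq r hr]

/-! ### Solutions of `(Ã* - μ) v = 0` -/

lemma cauchyIntegrable_coeFn (u : L2R) : CauchyIntegrable u :=
  cauchyIntegrable_of_memLp (by norm_num) (by simp) (Lp.memLp u)

lemma cauchyIntegrable_conj (u : L2R) : CauchyIntegrable fun x => conj (u x) :=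
  cauchyIntegrable_of_memLp (by norm_num) (by simp) (memLp_conj (Lp.memLp u))

lemma cauchyIntegrable_mul_conj (u v : L2R) : CauchyIntegrable fun x => u x * conj (v x) :=
  cauchyIntegrable_of_memLp le_rfl ENNReal.one_ne_top (memLp_one_iff_integrable.2
    (integrable_mul_of_memLp 2 2 (Lp.memLp u) (memLp_conj (Lp.memLp v))))

/-- The function `1 + ⟨(x - z)⁻¹ ψ, φ⟩`. -/
def perturbation (φ ψ : L2R) (z : ℂ) : ℂ := 1 + cauchyTransform (fun x => ψ x * conj (φ x)) z

/-- The function whose vanishing off the real line means that `g` is orthogonal to the solutions of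
`(Ã* - z) v = 0`. -/
def pairing (φ ψ g : L2R) (z : ℂ) : ℂ :=
  cauchyTransform (fun x => conj (g x)) z * perturbation φ ψ z -
    cauchyTransform (fun x => conj (φ x)) z * cauchyTransform (fun x => ψ x * conj (g x)) z

/-- In the half-plane `0 < s * z.im`, this is the product of `perturbation φ ψ` and of the boundary
value of the solution `v` of `(Ã* - z) v = 0` with `Γ₂ v = 1`. -/
def boundaryFactor (φ ψ : L2R) (B : ℂ) (s : ℝ) (z : ℂ) : ℂ :=
  (s * Real.pi * Complex.I - B) * perturbation φ ψ z -
    cauchyTransform (fun x => conj (φ x)) z * cauchyTransform ψ z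

lemma exists_eq_of_mem_kerSub {φ ψ v : L2R} {μ : ℂ} (hμ : μ.im ≠ 0)
    (hv : v ∈ (opATilde φ ψ).adjoint.kerSub μ) :
    ∃ c : ℂ, HasTraceTwo v c ∧
      ∀ᵐ x : ℝ, v x = c / ((x : ℂ) - μ) - inner ℂ φ v * (ψ x / ((x : ℂ) - μ)) := by
  obtain ⟨c, hc⟩ := (mem_adjoint_iff _).1 hv
  simp only at hc
  have hc' : ∀ᵐ x : ℝ, μ * v x = (x : ℂ) * v x - c + inner ℂ φ v * ψ x := by
    filter_upwards [hc, Lp.coeFn_smul μ v] with x h1 h2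
    rw [← h1, h2]
    rfl
  refine ⟨c, ?_, ?_⟩
  · refine (((Lp.memLp v).const_mul μ).sub ((Lp.memLp ψ).const_mul (inner ℂ φ v))).ae_eq ?_
    filter_upwards [hc'] with x hx
    simp only [Pi.sub_apply]
    linear_combination hx
  · filter_upwards [hc'] with x hx
    have := ofReal_sub_ne_zero hμ x
    field_simp
    linear_combination -hx

lemma inner_eq_of_ae_eq {ψ v g : L2R} {μ c β : ℂ} (hμ : μ.im ≠ 0)
    (hv : ∀ᵐ x : ℝ, v x = c / ((x : ℂ) - μ) - β * (ψ x / ((x : ℂ) - μ))) :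
    inner ℂ g v = c * cauchyTransform (fun x => conj (g x)) μ -
      β * cauchyTransform (fun x => ψ x * conj (g x)) μ := by
  have i1 := (cauchyIntegrable_conj g).integrable hμ
  have i2 := (cauchyIntegrable_mul_conj ψ g).integrable hμ
  rw [inner_eq_integral, cauchyTransform, cauchyTransform, ← integral_const_mul,
    ← integral_const_mul, ← integral_sub (i1.const_mul c) (i2.const_mul β)]
  refine integral_congr_ae (hv.mono fun x hx => ?_)
  simp only [hx]
  ring

lemma hasTraceOne_of_ae_eq {ψ v : L2R} {μ c β : ℂ} (hμ : μ.im ≠ 0)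
    (hv : ∀ᵐ x : ℝ, v x = c / ((x : ℂ) - μ) - β * (ψ x / ((x : ℂ) - μ))) :
    HasTraceOne v (c * (Real.sign μ.im * Real.pi * Complex.I) - β * cauchyTransform ψ μ) := by
  have i2 := (cauchyIntegrable_coeFn ψ).integrable hμ
  have h1 := (tendsto_integral_inv_ofReal_sub hμ).const_mul c
  have h2 := (intervalIntegral_tendsto_integral i2 tendsto_neg_atTop_atBot tendsto_id).const_mul β
  refine (h1.sub h2).congr fun R => ?_
  simp only [id]
  rw [← intervalIntegral.integral_const_mul, ← intervalIntegral.integral_const_mul,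
    ← intervalIntegral.integral_sub]
  · refine intervalIntegral.integral_congr_ae (hv.mono fun x hx _ => ?_)
    rw [hx]
    ring
  · exact ((continuous_inv_ofReal_sub hμ).intervalIntegrable _ _).const_mul c
  · exact (i2.intervalIntegrable).const_mul β

/-- The pairings and the boundary value of a solution of `(Ã* - μ) v = 0`. -/
lemma exists_perturbation_mul_eq {φ ψ v : L2R} {B μ a : ℂ} (hμ : μ.im ≠ 0)
    (hv : v ∈ (opATilde φ ψ).adjoint.kerSub μ) (ha : HasBoundaryValue B v a) :
    ∃ c : ℂ, HasTraceTwo v c ∧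
      (∀ g : L2R, perturbation φ ψ μ * inner ℂ g v = c * pairing φ ψ g μ) ∧
      perturbation φ ψ μ * a = c * boundaryFactor φ ψ B (Real.sign μ.im) μ := by
  obtain ⟨c, hc, hvx⟩ := exists_eq_of_mem_kerSub hμ hv
  obtain ⟨a₁, a₂, h1, h2, rfl⟩ := ha
  have hβ := inner_eq_of_ae_eq (g := φ) hμ hvx
  have e1 := tendsto_nhds_unique h1 (hasTraceOne_of_ae_eq hμ hvx)
  have e2 := h2.unique hc
  refine ⟨c, hc, fun g => ?_, ?_⟩
  · rw [inner_eq_of_ae_eq (g := g) hμ hvx, pairing, perturbation]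
    linear_combination (-cauchyTransform (fun x => ψ x * conj (g x)) μ) * hβ
  · rw [e1, e2, boundaryFactor, perturbation]
    linear_combination (-cauchyTransform ψ μ) * hβ

lemma exists_mem_kerSub {φ ψ : L2R} (B : ℂ) {μ : ℂ} (hμ : μ.im ≠ 0)
    (hD : perturbation φ ψ μ ≠ 0) :
    ∃ v : L2R, v ∈ (opATilde φ ψ).adjoint.kerSub μ ∧ (∃ a, HasBoundaryValue B v a) ∧
      HasTraceTwo v 1 := by
  -- The value of `⟨v, φ⟩` forced by pairing the solution with `φ`, with `Γ₂ v` normalised to `1`.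
  set α : ℂ := cauchyTransform (fun x => conj (φ x)) μ / perturbation φ ψ μ with hα
  have hmem : MemLp (fun x : ℝ => 1 / ((x : ℂ) - μ) - α * (ψ x / ((x : ℂ) - μ))) 2 volume := by
    have h1 := memLp_inv_ofReal_sub hμ (q := 2) (by norm_num)
    have h2 : MemLp (fun x : ℝ => ((x : ℂ) - μ)⁻¹ * ψ x) 2 volume :=
      memLp_mul_of_holderTriple ∞ 2 2 (memLp_inv_ofReal_sub hμ (by simp)) (Lp.memLp ψ)
    refine (h1.sub (h2.const_mul α)).ae_eq (ae_of_all _ fun x => ?_)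
    simp only [Pi.sub_apply]
    ring
  set v : L2R := hmem.toLp _ with hv
  have hvx : ∀ᵐ x : ℝ, v x = 1 / ((x : ℂ) - μ) - α * (ψ x / ((x : ℂ) - μ)) := hmem.coeFn_toLp
  have hβ : inner ℂ φ v = α := by
    rw [inner_eq_of_ae_eq hμ hvx, hα]
    rw [perturbation] at hD ⊢
    field_simp
    ring
  have hvx' : ∀ᵐ x : ℝ, μ * v x = (x : ℂ) * v x - 1 + α * ψ x := by
    filter_upwards [hvx] with x hx
    have := ofReal_sub_ne_zero hμ x
    rw [hx]
    field_simp
    ring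
  have h2 : HasTraceTwo v 1 := by
    refine (((Lp.memLp v).const_mul μ).sub ((Lp.memLp ψ).const_mul α)).ae_eq ?_
    filter_upwards [hvx'] with x hx
    simp only [Pi.sub_apply]
    linear_combination hx
  refine ⟨v, (mem_adjoint_iff _).2 ⟨1, ?_⟩, ⟨_, _, _, hasTraceOne_of_ae_eq hμ hvx, h2, rfl⟩, h2⟩
  filter_upwards [hvx', Lp.coeFn_smul μ v] with x h3 h4
  rw [hβ, ← h3, h4]
  rfl

/-! ### Resolvents -/

/-- `R` is the resolvent of `T` at `z`. -/
def IsResolvent (T : Operator) (z : ℂ) (R : L2R →L[ℂ] L2R) : Prop :=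
  (∀ g : L2R, (R g, g + z • R g) ∈ T) ∧ ∀ u v : L2R, (u, v) ∈ T → R (v - z • u) = u

/-- Near `z₀` the resolvent is `R (1 - (z - z₀) R)⁻¹`. This gives openness of the resolvent set and
norm continuity without assuming anything about `T` beyond its graph. -/
lemma IsResolvent.exists_continuousAt {T : Operator} {z₀ : ℂ} {R : L2R →L[ℂ] L2R}
    (h : IsResolvent T z₀ R) :
    ∃ F : ℂ → L2R →L[ℂ] L2R, ContinuousAt F z₀ ∧ F z₀ = R ∧
      ∀ᶠ z in 𝓝 z₀, IsResolvent T z (F z) := by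
  set A : ℂ → L2R →L[ℂ] L2R := fun z => 1 - (z - z₀) • R with hA
  have hA0 : A z₀ = 1 := by simp [hA]
  have hAc : Continuous A := by fun_prop
  refine ⟨fun z => R * Ring.inverse (A z), ?_, ?_, ?_⟩
  · have h1 : ContinuousAt Ring.inverse (A z₀) := by
      rw [hA0]
      exact NormedRing.inverse_continuousAt 1
    exact continuousAt_const.mul (ContinuousAt.comp (f := A) h1 hAc.continuousAt)
  · simp [hA0]
  · have hev : ∀ᶠ z in 𝓝 z₀, IsUnit (A z) :=
      hAc.continuousAt.eventually (Units.isOpen.mem_nhds (by simp [hA0]))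
    filter_upwards [hev] with z hz
    have h1 : ∀ g, A z (Ring.inverse (A z) g) = g := fun g =>
      congrArg (fun X : L2R →L[ℂ] L2R => X g) (Ring.mul_inverse_cancel _ hz)
    have h2 : ∀ g, Ring.inverse (A z) (A z g) = g := fun g =>
      congrArg (fun X : L2R →L[ℂ] L2R => X g) (Ring.inverse_mul_cancel _ hz)
    have hAz : ∀ g, A z g = g - (z - z₀) • R g := fun g => rfl
    refine ⟨fun g => ?_, fun u v huv => ?_⟩
    · have h3 := h.1 (Ring.inverse (A z) g)
      have h4 := h1 g
      rw [hAz] at h4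
      set w := Ring.inverse (A z) g with hw
      have h5 : g + z • R w = w + z₀ • R w := by
        rw [← h4]
        module
      change (R w, g + z • R w) ∈ T
      rwa [h5]
    · have h3 := h.2 u v huv
      have h4 : v - z • u = A z (v - z₀ • u) := by
        rw [hAz, h3]
        module
      change R (Ring.inverse (A z) (v - z • u)) = u
      rw [h4, h2, h3]

lemma eventually_mem_resolventSet {T : Operator} {z₀ : ℂ} (h : z₀ ∈ T.resolventSet) :
    ∀ᶠ z in 𝓝 z₀, z ∈ T.resolventSet := by
  obtain ⟨R, hR⟩ := h
  obtain ⟨F, -, -, hF⟩ := IsResolvent.exists_continuousAt hR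
  exact hF.mono fun z hz => ⟨F z, hz⟩

section

variable {φ ψ : L2R} {B : ℂ}

/-- The correction `(μ - μ₁) R u` lies in the domain of `A_B`, so it moves the spectral parameter
and leaves the boundary value unchanged. -/
lemma IsResolvent.add_smul_mem {u : L2R} {μ₁ μ a : ℂ} {R : L2R →L[ℂ] L2R}
    (hR : IsResolvent (opAB φ ψ B) μ R) (hu : u ∈ (opATilde φ ψ).adjoint.kerSub μ₁)
    (ha : HasBoundaryValue B u a) :
    u + (μ - μ₁) • R u ∈ (opATilde φ ψ).adjoint.kerSub μ ∧
      HasBoundaryValue B (u + (μ - μ₁) • R u) a := by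
  obtain ⟨h1, h2⟩ := hR.1 u
  refine ⟨?_, by simpa using ha.add_smul h2 (μ - μ₁)⟩
  have h3 := adjoint_add_smul hu h1 (μ - μ₁)
  have h4 : μ • (u + (μ - μ₁) • R u) = μ₁ • u + (μ - μ₁) • (u + μ • R u) := by module
  change (u + (μ - μ₁) • R u, μ • (u + (μ - μ₁) • R u)) ∈ (opATilde φ ψ).adjoint
  rwa [h4]

lemma eq_zero_of_mem_resolventSet {v : L2R} {μ : ℂ} (hμ : μ ∈ (opAB φ ψ B).resolventSet)
    (hv : v ∈ (opATilde φ ψ).adjoint.kerSub μ) (h0 : HasBoundaryValue B v 0) : v = 0 := by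
  obtain ⟨R, -, hR⟩ := hμ
  have := hR v (μ • v) ⟨hv, h0⟩
  rw [sub_self, map_zero] at this
  exact this.symm

end

/-! ### Holomorphic functions on half-planes -/

lemma im_ne_zero_of_pos {s : ℝ} {z : ℂ} (h : 0 < s * z.im) : z.im ≠ 0 := by
  rintro h0
  simp [h0] at h

lemma eventually_im_pos {s : ℝ} {z₀ : ℂ} (h : 0 < s * z₀.im) : ∀ᶠ z in 𝓝 z₀, 0 < s * z.im :=
  (continuous_const.mul Complex.continuous_im).continuousAt.eventually (lt_mem_nhds h)

lemma isOpen_halfPlane (s : ℝ) : IsOpen {z : ℂ | 0 < s * z.im} :=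
  isOpen_lt continuous_const (continuous_const.mul Complex.continuous_im)

lemma isPreconnected_halfPlane (s : ℝ) : IsPreconnected {z : ℂ | 0 < s * z.im} := by
  refine Convex.isPreconnected fun x hx y hy a b ha hb hab => ?_
  simp only [Set.mem_ofPred_eq, Complex.add_im, Complex.real_smul, Complex.im_ofReal_mul] at *
  rcases ha.eq_or_lt with rfl | ha
  · simp only [zero_add] at hab
    simpa [hab] using hy
  · nlinarith [mul_pos ha hx, mul_nonneg hb hy.le]

lemma eq_zero_of_frequently_eq_zero {f : ℂ → ℂ} {s : ℝ} {z₀ : ℂ}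
    (hf : DifferentiableOn ℂ f {z | 0 < s * z.im}) (hz₀ : 0 < s * z₀.im)
    (h : ∃ᶠ z in 𝓝[≠] z₀, f z = 0) {z : ℂ} (hz : 0 < s * z.im) : f z = 0 :=
  (hf.analyticOnNhd (isOpen_halfPlane s)).eqOn_zero_of_preconnected_of_frequently_eq_zero
    (isPreconnected_halfPlane s) hz₀ h hz

lemma exists_sign_pos {z : ℂ} (hz : z.im ≠ 0) : ∃ s : ℝ, |s| = 1 ∧ 0 < s * z.im := by
  rcases hz.lt_or_gt with h | h
  · exact ⟨-1, by simp, by linarith⟩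
  · exact ⟨1, by simp, by linarith⟩

lemma sign_im_eq {s : ℝ} (hs : |s| = 1) {z : ℂ} (hz : 0 < s * z.im) : Real.sign z.im = s := by
  rcases (abs_eq zero_le_one).1 hs with rfl | rfl
  · exact Real.sign_of_pos (by linarith)
  · exact Real.sign_of_neg (by linarith)

section

variable (φ ψ : L2R)

lemma differentiableOn_perturbation {U : Set ℂ} (hU : ∀ z ∈ U, z.im ≠ 0) :
    DifferentiableOn ℂ (perturbation φ ψ) U :=
  ((cauchyIntegrable_mul_conj ψ φ).differentiableOn hU).const_add 1

lemma differentiableOn_pairing (g : L2R) {U : Set ℂ} (hU : ∀ z ∈ U, z.im ≠ 0) :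
    DifferentiableOn ℂ (pairing φ ψ g) U :=
  (((cauchyIntegrable_conj g).differentiableOn hU).mul
    (differentiableOn_perturbation φ ψ hU)).sub
    (((cauchyIntegrable_conj φ).differentiableOn hU).mul
      ((cauchyIntegrable_mul_conj ψ g).differentiableOn hU))

lemma differentiableOn_boundaryFactor (B : ℂ) (s : ℝ) {U : Set ℂ} (hU : ∀ z ∈ U, z.im ≠ 0) :
    DifferentiableOn ℂ (boundaryFactor φ ψ B s) U :=
  ((differentiableOn_perturbation φ ψ hU).const_mul _).sub
    (((cauchyIntegrable_conj φ).differentiableOn hU).mul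
      ((cauchyIntegrable_coeFn ψ).differentiableOn hU))

lemma tendsto_perturbation {s : ℝ} (hs : |s| = 1) :
    Tendsto (fun y : ℝ => perturbation φ ψ ((s * y : ℝ) * Complex.I)) atTop (𝓝 1) := by
  simpa [perturbation] using ((cauchyIntegrable_mul_conj ψ φ).tendsto_zero hs).const_add 1

lemma tendsto_pairing (g : L2R) {s : ℝ} (hs : |s| = 1) :
    Tendsto (fun y : ℝ => pairing φ ψ g ((s * y : ℝ) * Complex.I)) atTop (𝓝 0) := by
  simpa [pairing] using (((cauchyIntegrable_conj g).tendsto_zero hs).mul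
    (tendsto_perturbation φ ψ hs)).sub (((cauchyIntegrable_conj φ).tendsto_zero hs).mul
      ((cauchyIntegrable_mul_conj ψ g).tendsto_zero hs))

lemma tendsto_boundaryFactor (B : ℂ) {s : ℝ} (hs : |s| = 1) :
    Tendsto (fun y : ℝ => boundaryFactor φ ψ B s ((s * y : ℝ) * Complex.I)) atTop
      (𝓝 (s * Real.pi * Complex.I - B)) := by
  simpa [boundaryFactor] using ((tendsto_perturbation φ ψ hs).const_mul (s * Real.pi * Complex.I - B)).sub
    (((cauchyIntegrable_conj φ).tendsto_zero hs).mul ((cauchyIntegrable_coeFn ψ).tendsto_zero hs))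

lemma mul_im_pos_of_pos {s : ℝ} (hs : |s| = 1) {y : ℝ} (hy : 0 < y) :
    0 < s * (((s * y : ℝ) : ℂ) * Complex.I).im := by
  have : s * s = 1 := by rw [← abs_mul_abs_self, hs, one_mul]
  rw [Complex.im_ofReal_mul, Complex.I_im, mul_one, ← mul_assoc, this, one_mul]
  exact hy

/-- The function tends to `1` along the imaginary axis, so it is not identically zero in either
half-plane and its zeros are isolated. -/
lemma eventually_perturbation_ne_zero {z₀ : ℂ} (hz₀ : z₀.im ≠ 0) :
    ∀ᶠ z in 𝓝[≠] z₀, z.im ≠ 0 ∧ perturbation φ ψ z ≠ 0 := by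
  obtain ⟨s, hs, hpos⟩ := exists_sign_pos hz₀
  have h1 : ∀ᶠ z in 𝓝[≠] z₀, perturbation φ ψ z ≠ 0 := by
    by_contra hcon
    have h2 : ∃ᶠ z in 𝓝[≠] z₀, perturbation φ ψ z = 0 :=
      (not_eventually.1 hcon).mono fun z hz => not_not.1 hz
    have h3 : ∀ᶠ y : ℝ in atTop, perturbation φ ψ ((s * y : ℝ) * Complex.I) = 0 := by
      filter_upwards [eventually_gt_atTop 0] with y hy
      exact eq_zero_of_frequently_eq_zero (differentiableOn_perturbation φ ψ
        fun z hz => im_ne_zero_of_pos hz) hpos h2 (mul_im_pos_of_pos hs hy)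
    have h4 := tendsto_nhds_unique (tendsto_perturbation φ ψ hs)
      (tendsto_const_nhds.congr' (h3.mono fun y hy => hy.symm))
    exact one_ne_zero h4
  exact (((eventually_im_pos hpos).mono fun z hz => im_ne_zero_of_pos hz).filter_mono
    nhdsWithin_le_nhds).and h1

/-- Good parameters are dense in the whole plane. Points of the resolvent set that are real, or
zeros of `perturbation`, are thus reached by continuity. -/
lemma frequently_perturbation_ne_zero (μ : ℂ) :
    ∃ᶠ z in 𝓝 μ, z.im ≠ 0 ∧ perturbation φ ψ z ≠ 0 := by
  intro hcon
  have h1 : ∃ᶠ z : ℂ in 𝓝 μ, z.im ≠ 0 := by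
    have h : ∃ᶠ x in 𝓝 μ.im, x ∈ ({0} : Set ℝ)ᶜ :=
      mem_closure_iff_frequently.1 (dense_compl_singleton (0 : ℝ) μ.im)
    exact h.filter_mono (Complex.isOpenMap_im.nhds_le μ)
  obtain ⟨z, hz, h2⟩ := (h1.and_eventually hcon.eventually_nhds).exists
  obtain ⟨w, hw1, hw2⟩ := ((eventually_perturbation_ne_zero φ ψ hz).and
    (h2.filter_mono nhdsWithin_le_nhds)).exists
  exact hw2 hw1

end

lemma eq_zero_of_frequently {F : ℂ → ℂ} {μ : ℂ} (hF : ContinuousAt F μ)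
    (h : ∃ᶠ z in 𝓝 μ, F z = 0) : F μ = 0 := by
  by_contra hne
  obtain ⟨z, h1, h2⟩ := (h.and_eventually (hF.eventually_ne hne)).exists
  exact h2 h1

/-! ### The orthogonal complement of the detectable subspace -/

section

variable {φ ψ : L2R} {B : ℂ}

lemma pairing_eq_zero_of_forall_inner {g : L2R} {s : ℝ}
    (hρ : ∃ z ∈ (opAB φ ψ B).resolventSet, 0 < s * z.im)
    (h : ∀ μ ∈ (opAB φ ψ B).resolventSet, ∀ v ∈ ranSolution φ ψ B μ, inner ℂ g v = 0)
    {z : ℂ} (hz : 0 < s * z.im) : pairing φ ψ g z = 0 := by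
  obtain ⟨z₀, hz₀, hpos⟩ := hρ
  refine eq_zero_of_frequently_eq_zero (differentiableOn_pairing φ ψ g
    fun z hz => im_ne_zero_of_pos hz) hpos (Eventually.frequently ?_) hz
  filter_upwards [eventually_perturbation_ne_zero φ ψ (im_ne_zero_of_pos hpos),
    (eventually_mem_resolventSet hz₀).filter_mono nhdsWithin_le_nhds] with w ⟨hw, hD⟩ hwρ
  obtain ⟨v, hv, ⟨a, ha⟩, hv1⟩ := exists_mem_kerSub B hw hD
  obtain ⟨c, hc, h1, -⟩ := exists_perturbation_mul_eq hw hv ha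
  have h2 := h1 g
  rw [h w hwρ v ⟨a, hv, ha⟩, hc.unique hv1, mul_zero, one_mul] at h2
  exact h2.symm

/-- At nearby good parameters `z` the shifted solution is orthogonal to `g`, since `pairing`
vanishes and `perturbation` does not; letting `z` approach `μ` recovers `u`. -/
lemma inner_ranSolution_eq_zero {g : L2R} (hN : ∀ z : ℂ, z.im ≠ 0 → pairing φ ψ g z = 0)
    {μ : ℂ} (hμ : μ ∈ (opAB φ ψ B).resolventSet) {u : L2R} (hu : u ∈ ranSolution φ ψ B μ) :
    inner ℂ g u = 0 := by
  obtain ⟨a, hu, ha⟩ := hu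
  obtain ⟨R, hR⟩ := hμ
  obtain ⟨F, hFc, -, hF⟩ := IsResolvent.exists_continuousAt hR
  have hc : ContinuousAt (fun z => inner ℂ g (u + (z - μ) • F z u)) μ := by fun_prop
  have h0 := eq_zero_of_frequently hc ?_
  · simpa using h0
  · refine ((frequently_perturbation_ne_zero φ ψ μ).and_eventually hF).mono ?_
    rintro z ⟨⟨hz, hD⟩, hRz⟩
    obtain ⟨h1, h2⟩ := hRz.add_smul_mem hu ha
    obtain ⟨c, -, h3, -⟩ := exists_perturbation_mul_eq hz h1 h2
    have h4 := h3 g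
    rw [hN z hz, mul_zero] at h4
    exact (mul_eq_zero.1 h4).resolve_left hD

/-- Both `h` and its shift `h + (z - μ₀) R h` are orthogonal to `g`, hence so is `R h` for `z ≠ μ₀`.
Continuity covers `δ = μ₀`. -/
lemma inner_resolvent_eq_zero {g : L2R} (hN : ∀ z : ℂ, z.im ≠ 0 → pairing φ ψ g z = 0)
    {μ₀ δ : ℂ} (hμ₀ : μ₀ ∈ (opAB φ ψ B).resolventSet) (hδ : δ ∈ (opAB φ ψ B).resolventSet)
    {h v : L2R} (hh : h ∈ ranSolution φ ψ B μ₀) (hv : (v, h + δ • v) ∈ opAB φ ψ B) :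
    inner ℂ g v = 0 := by
  have hgh := inner_ranSolution_eq_zero hN hμ₀ hh
  obtain ⟨R, hR⟩ := hδ
  have hRv : R h = v := by simpa using hR.2 _ _ hv
  obtain ⟨F, hFc, hFδ, hF⟩ := IsResolvent.exists_continuousAt hR
  have hc : ContinuousAt (fun z => inner ℂ g (F z h)) δ := by fun_prop
  have h0 := eq_zero_of_frequently hc ?_
  · rwa [hFδ, hRv] at h0
  · have hne : ∃ᶠ z in 𝓝 δ, z ∈ ({μ₀} : Set ℂ)ᶜ :=
      mem_closure_iff_frequently.1 (dense_compl_singleton μ₀ δ)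
    refine (hne.and_eventually hF).mono ?_
    rintro z ⟨hz, hRz⟩
    obtain ⟨a, hh1, hh2⟩ := hh
    obtain ⟨h1, h2⟩ := hRz.add_smul_mem hh1 hh2
    have h3 := inner_ranSolution_eq_zero hN ⟨F z, hRz⟩ ⟨a, h1, h2⟩
    rw [inner_add_right, hgh, zero_add, inner_smul_right] at h3
    exact (mul_eq_zero.1 h3).resolve_left (sub_ne_zero.2 hz)

lemma hasTraceTwo_zero : HasTraceTwo 0 0 := by
  refine MemLp.ae_eq (ae_of_all _ fun x => ?_) (MemLp.zero (ε := ℂ))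
  simp

/-- Orthogonality to the vectors `R u` does not include orthogonality to `u` itself. The number `k =
⟨u, g⟩` is eliminated by asymptotics in both half-planes, which is where both half-planes are needed
together. -/
lemma pairing_eq_zero_of_forall_inner_resolvent {g : L2R} {μ₀ : ℂ}
    (hμ₀ : μ₀ ∈ (opAB φ ψ B).resolventSet)
    (hρ : ∀ s : ℝ, |s| = 1 → ∃ z ∈ (opAB φ ψ B).resolventSet, 0 < s * z.im)
    (h : ∀ δ ∈ (opAB φ ψ B).resolventSet, ∀ u ∈ ranSolution φ ψ B μ₀, ∀ v : L2R,
      (v, u + δ • v) ∈ opAB φ ψ B → inner ℂ g v = 0)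
    {z : ℂ} (hz : z.im ≠ 0) : pairing φ ψ g z = 0 := by
  -- A solution with nonzero boundary value: take one at a good parameter, where `Γ₂ = 1` and
  -- uniqueness exclude boundary value `0`, and shift it to `μ₀`.
  obtain ⟨u, a, ha0, hu, hua⟩ : ∃ (u : L2R) (a : ℂ), a ≠ 0 ∧
      u ∈ (opATilde φ ψ).adjoint.kerSub μ₀ ∧ HasBoundaryValue B u a := by
    obtain ⟨z₁, hz₁, -⟩ := hρ 1 (by simp)
    obtain ⟨δ, ⟨hδ, hD⟩, hδρ⟩ := ((frequently_perturbation_ne_zero φ ψ z₁).and_eventually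
      (eventually_mem_resolventSet hz₁)).exists
    obtain ⟨v, hv, ⟨a, ha⟩, hv1⟩ := exists_mem_kerSub B hδ hD
    obtain ⟨R, hR⟩ := hμ₀
    obtain ⟨h1, h2⟩ := IsResolvent.add_smul_mem hR hv ha
    refine ⟨_, a, ?_, h1, h2⟩
    rintro rfl
    rw [eq_zero_of_mem_resolventSet hδρ hv ha] at hv1
    exact one_ne_zero (hv1.unique hasTraceTwo_zero)
  set k : ℂ := inner ℂ g u with hk
  have key : ∀ s : ℝ, |s| = 1 → ∀ z : ℂ, 0 < s * z.im →
      k * boundaryFactor φ ψ B s z - a * pairing φ ψ g z = 0 := by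
    intro s hs z hz
    obtain ⟨z₀, hz₀, hpos⟩ := hρ s hs
    have hU : ∀ z ∈ {z : ℂ | 0 < s * z.im}, z.im ≠ 0 := fun z hz => im_ne_zero_of_pos hz
    refine eq_zero_of_frequently_eq_zero
      (((differentiableOn_boundaryFactor φ ψ B s hU).const_mul k).sub
      ((differentiableOn_pairing φ ψ g hU).const_mul a)) hpos (Eventually.frequently ?_) hz
    filter_upwards [eventually_perturbation_ne_zero φ ψ (im_ne_zero_of_pos hpos),
      (eventually_mem_resolventSet hz₀).filter_mono nhdsWithin_le_nhds,
      (eventually_im_pos hpos).filter_mono nhdsWithin_le_nhds] with w ⟨hw, hD⟩ ⟨R, hR⟩ hws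
    obtain ⟨h1, h2⟩ := IsResolvent.add_smul_mem hR hu hua
    obtain ⟨c, -, h3, h4⟩ := exists_perturbation_mul_eq hw h1 h2
    have h5 := h3 g
    rw [inner_add_right, inner_smul_right, h w ⟨R, hR⟩ u ⟨a, hu, hua⟩ (R u) (hR.1 u), mul_zero,
      add_zero, ← hk] at h5
    rw [sign_im_eq hs hws] at h4
    have hc : c ≠ 0 := by
      rintro rfl
      rw [zero_mul] at h4
      exact mul_ne_zero hD ha0 h4
    refine (mul_eq_zero.1 (?_ : c * (k * boundaryFactor φ ψ B s w - a * pairing φ ψ g w) = 0)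
      ).resolve_left hc
    linear_combination a * h5 - k * h4
  have hlim : ∀ s : ℝ, |s| = 1 → k * (s * Real.pi * Complex.I - B) = 0 := by
    intro s hs
    have h1 := ((tendsto_boundaryFactor φ ψ B hs).const_mul k).sub
      ((tendsto_pairing φ ψ g hs).const_mul a)
    rw [mul_zero, sub_zero] at h1
    refine tendsto_nhds_unique h1 (tendsto_const_nhds.congr' ?_)
    filter_upwards [eventually_gt_atTop 0] with y hy
    exact (key s hs _ (mul_im_pos_of_pos hs hy)).symm
  have hk0 : k = 0 := by
    have h1 := hlim 1 (by simp)
    have h2 := hlim (-1) (by simp)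
    push_cast at h1 h2
    -- Subtracting the two limits removes `B`, so `k = 0` whatever the boundary condition.
    have h3 : k * (2 * Real.pi * Complex.I) = 0 := by linear_combination h1 - h2
    exact (mul_eq_zero.1 h3).resolve_right Complex.two_pi_I_ne_zero
  obtain ⟨s, hs, hpos⟩ := exists_sign_pos hz
  have h1 := key s hs z hpos
  rw [hk0, zero_mul, zero_sub, neg_eq_zero] at h1
  exact (mul_eq_zero.1 h1).resolve_left ha0

lemma mem_orthogonal_closure_span_iff (A : Set L2R) (g : L2R) :
    g ∈ (Submodule.span ℂ A).topologicalClosureᗮ ↔ ∀ v ∈ A, inner ℂ g v = 0 := by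
  rw [Submodule.orthogonal_closure, Submodule.mem_orthogonal']
  refine ⟨fun h v hv => h v (Submodule.subset_span hv), fun h v hv => ?_⟩
  induction hv using Submodule.span_induction with
  | mem v hv => exact h v hv
  | zero => exact inner_zero_right g
  | add v w _ _ h1 h2 => rw [inner_add_right, h1, h2, add_zero]
  | smul c v _ h1 => rw [inner_smul_right, h1, mul_zero]

lemma mem_orthogonal_iff_pairing_eq_zero
    (hup : ∃ z ∈ (opAB φ ψ B).resolventSet, 0 < z.im)
    (hlow : ∃ z ∈ (opAB φ ψ B).resolventSet, z.im < 0) {S : Submodule ℂ L2R}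
    (hS : S = closureT φ ψ B ∨
      ∃ μ₀ ∈ (opAB φ ψ B).resolventSet, S = closureS φ ψ B μ₀) (g : L2R) :
    g ∈ Sᗮ ↔ ∀ z : ℂ, z.im ≠ 0 → pairing φ ψ g z = 0 := by
  have hρ : ∀ s : ℝ, |s| = 1 → ∃ z ∈ (opAB φ ψ B).resolventSet, 0 < s * z.im := by
    intro s hs
    rcases (abs_eq zero_le_one).1 hs with rfl | rfl
    · simpa using hup
    · simpa using hlow
  rcases hS with rfl | ⟨μ₀, hμ₀, rfl⟩
  · rw [closureT, mem_orthogonal_closure_span_iff]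
    refine ⟨fun h z hz => ?_, fun hN v => ?_⟩
    · obtain ⟨s, hs, hpos⟩ := exists_sign_pos hz
      exact pairing_eq_zero_of_forall_inner (hρ s hs) (fun μ hμ v hv => h v ⟨μ, hμ, hv⟩) hpos
    · rintro ⟨μ, hμ, hv⟩
      exact inner_ranSolution_eq_zero hN hμ hv
  · rw [closureS, mem_orthogonal_closure_span_iff]
    refine ⟨fun h z hz => ?_, fun hN v => ?_⟩
    · exact pairing_eq_zero_of_forall_inner_resolvent hμ₀ hρ
        (fun δ hδ u hu v hv => h v ⟨δ, hδ, u, hu, hv⟩) hz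
    · rintro ⟨δ, hδ, u, hu, hv⟩
      exact inner_resolvent_eq_zero hN hμ₀ hδ hu hv

/-- The subspace is closed, so it is proper exactly when its orthogonal complement is nonzero. -/
lemma ne_top_iff_exists_mem_orthogonal {S : Submodule ℂ L2R}
    (hS : S = closureT φ ψ B ∨
      ∃ μ₀ ∈ (opAB φ ψ B).resolventSet, S = closureS φ ψ B μ₀) :
    S ≠ ⊤ ↔ ∃ g ∈ Sᗮ, g ≠ 0 := by
  have hc : IsClosed (S : Set L2R) := by
    rcases hS with rfl | ⟨μ₀, -, rfl⟩ <;> exact Submodule.isClosed_topologicalClosure _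
  have : CompleteSpace S := hc.completeSpace_coe
  rw [← Submodule.ne_bot_iff, Ne, Ne, Submodule.orthogonal_eq_bot_iff]

end

/-! ### The orthogonal complement as a kernel -/

lemma star_ae_eq (g : L2R) : (star g : L2R) =ᵐ[volume] fun x => conj (g x) := Lp.coeFn_star g

lemma mem_kerSub_opL_iff {φ ψ u : L2R} {c : ℂ} :
    u ∈ (opL φ ψ).kerSub c ↔ ∀ᵐ k : ℝ, exprL φ ψ u k = c * u k := by
  change (∀ᵐ k : ℝ, (c • u : L2R) k = exprL φ ψ u k) ↔ _
  refine eventually_congr ?_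
  filter_upwards [Lp.coeFn_smul c u] with k hk
  rw [hk, Pi.smul_apply, smul_eq_mul, eq_comm]

lemma AdmissibleExponents.star_mem_kerSub_iff {φ ψ : L2R} {p q : ℝ≥0∞}
    (h : AdmissibleExponents φ ψ p q) (g : L2R) :
    star g ∈ (opL φ ψ).kerSub (1 / (2 * Real.pi * Complex.I)) ↔
      ∀ z : ℂ, z.im ≠ 0 → pairing φ ψ g z = 0 := by
  rw [mem_kerSub_opL_iff, h.exprL_eq_iff]
  refine forall₂_congr fun z _ => ?_
  have h1 : (fun x => ψ x * (star g : L2R) x) =ᵐ[volume] fun x => ψ x * conj (g x) :=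
    (star_ae_eq g).mono fun x hx => by simp only [hx]
  rw [cauchyTransform_congr (star_ae_eq g), cauchyTransform_congr h1]
  rfl

lemma star_ne_zero_of_ne_zero {g : L2R} (h : g ≠ 0) : star g ≠ 0 := by
  have h0 : star (0 : L2R) = 0 := by
    refine Lp.ext ?_
    filter_upwards [star_ae_eq 0] with x hx
    rw [hx]
    simp
  exact fun hg => h (by rw [← star_star g, hg, h0])

lemma exists_star_mem_kerSub_iff {T : Operator} {z : ℂ} :
    (∃ g, star g ∈ T.kerSub z ∧ g ≠ 0) ↔ z ∈ T.pointSpectrum := by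
  constructor
  · rintro ⟨g, hg, h0⟩
    exact ⟨star g, hg, star_ne_zero_of_ne_zero h0⟩
  · rintro ⟨u, hu, h0⟩
    exact ⟨star u, by rwa [star_star], star_ne_zero_of_ne_zero h0⟩

/-! ### The operator `𝓛` -/

section

variable {φ ψ : L2R} {η : ℝ → ℂ}

lemma mem_domCalL_of_memLp_mul (hη : MemLp (fun k => η k * conj (φ k)) ∞ volume) {u : L2R}
    (hu : MemLp (fun x => ψ x * u x) 2 volume) : u ∈ domCalL φ ψ η :=
  memLp_mul_of_holderTriple ∞ 2 2 hη (rieszProj_spec rieszExponent_two hu (Or.inr rfl)).1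

lemma memLp_rieszMinus_coeFn (u : L2R) : MemLp (rieszMinus u) 2 volume :=
  (rieszProj_spec rieszExponent_two (Lp.memLp u) (Or.inr rfl)).1

lemma domain_opCalL (hη : MemLp η ∞ volume)
    (h1 : MemLp (fun k => η k * multiplier φ ψ k) ∞ volume)
    (h2 : MemLp (fun k => η k * ψ k * conj (φ k)) ∞ volume) :
    (opCalL φ ψ η).domain = domCalL φ ψ η := by
  ext u
  refine ⟨fun ⟨v, hv⟩ => hv.1, fun hu => ?_⟩
  have m0 := memLp_mul_of_holderTriple ∞ 2 2 hη (Lp.memLp u)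
  have m1 := memLp_mul_of_holderTriple ∞ 2 2 h1 (Lp.memLp u)
  have m2 := memLp_mul_of_holderTriple ∞ 2 2 h2 (memLp_rieszMinus_coeFn u)
  have m := ((m1.sub (m0.const_mul (1 / (2 * Real.pi * Complex.I)))).add m2).sub hu
  refine ⟨m.toLp _, hu, m.coeFn_toLp.mono fun k hk => ?_⟩
  simp only [hk, Pi.sub_apply, Pi.add_apply]
  ring

/-- The functions `u ∈ L²` with `ψ u ∈ L²`. -/
def mulDomain (ψ : L2R) : Submodule ℂ L2R where
  carrier := {u | MemLp (fun x => ψ x * u x) 2 volume}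
  zero_mem' := MemLp.ae_eq (ae_of_all _ fun x => by simp) (MemLp.zero (ε := ℂ))
  add_mem' {u v} hu hv := MemLp.ae_eq ((Lp.coeFn_add u v).mono fun x hx => by
    simp only [hx, Pi.add_apply, mul_add]) (MemLp.add hu hv)
  smul_mem' c u hu := MemLp.ae_eq ((Lp.coeFn_smul c u).mono fun x hx => by
    simp only [hx, Pi.smul_apply, smul_eq_mul]
    ring) (MemLp.const_mul hu c)

/-- If `g` is orthogonal to this space, test it against its own truncation to `{|ψ| ≤ n}`: the
truncation vanishes for every `n`, and these sets exhaust the line. -/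
lemma dense_mulDomain (ψ : L2R) : Dense (mulDomain ψ : Set L2R) := by
  rw [Submodule.dense_iff_topologicalClosure_eq_top, Submodule.topologicalClosure_eq_top_iff,
    Submodule.eq_bot_iff]
  intro g hg
  set E : ℕ → Set ℝ := fun n => {x | ‖ψ x‖ ≤ n} with hE
  have hEm : ∀ n, MeasurableSet (E n) := fun n =>
    measurableSet_le (Lp.stronglyMeasurable ψ).measurable.norm measurable_const
  have h0 : ∀ n, ∀ᵐ x : ℝ, (E n).indicator g x = 0 := by
    intro n
    have hm : MemLp ((E n).indicator g) 2 volume := (Lp.memLp g).indicator (hEm n)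
    set u : L2R := hm.toLp _ with hu
    have hux : u =ᵐ[volume] (E n).indicator g := hm.coeFn_toLp
    have hmem : u ∈ mulDomain ψ := by
      refine MemLp.of_le_mul (c := n) (Lp.memLp g)
        ((Lp.aestronglyMeasurable ψ).mul (Lp.aestronglyMeasurable u)) ?_
      filter_upwards [hux] with x hx
      rw [hx, norm_mul]
      by_cases hxE : x ∈ E n
      · rw [Set.indicator_of_mem hxE]
        exact mul_le_mul_of_nonneg_right hxE (norm_nonneg _)
      · rw [Set.indicator_of_notMem hxE, norm_zero, mul_zero]
        positivity
    have h1 : inner ℂ u g = 0 := (Submodule.mem_orthogonal _ _).1 hg u hmem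
    have h2 : inner ℂ u u = (0 : ℂ) := by
      rw [← h1, inner_eq_integral, inner_eq_integral]
      refine integral_congr_ae (hux.mono fun x hx => ?_)
      by_cases hxE : x ∈ E n
      · simp [hx, hxE]
      · simp [hx, hxE]
    have h3 : u = 0 := inner_self_eq_zero.1 h2
    rw [h3] at hux
    filter_upwards [hux, Lp.coeFn_zero ℂ 2 (volume : Measure ℝ)] with x h4 h5
    rw [← h4, h5, Pi.zero_apply]
  refine (Lp.eq_zero_iff_ae_eq_zero).2 ?_
  filter_upwards [ae_all_iff.2 h0] with x hx
  obtain ⟨n, hn⟩ := exists_nat_ge ‖ψ x‖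
  have h1 := hx n
  rwa [Set.indicator_of_mem (show x ∈ E n from hn)] at h1

/-- Dividing by `η ≠ 0` gives one inclusion. For the other, the eigenvalue equation times `η` writes
`η φ̄ P₋(ψ u)` as a sum of `L²` terms, so an eigenfunction lies automatically in the domain of `𝓛`.
-/
lemma mem_kerSub_opCalL_iff (hη : MemLp η ∞ volume) (hη0 : ∀ᵐ k : ℝ, η k ≠ 0)
    (h1 : MemLp (fun k => η k * multiplier φ ψ k) ∞ volume)
    (h2 : MemLp (fun k => η k * ψ k * conj (φ k)) ∞ volume) (u : L2R) :
    u ∈ (opCalL φ ψ η).kerSub 0 ↔ u ∈ (opL φ ψ).kerSub (1 / (2 * Real.pi * Complex.I)) := by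
  rw [mem_kerSub_opL_iff]
  change (u ∈ domCalL φ ψ η ∧ ∀ᵐ k : ℝ, ((0 : ℂ) • u : L2R) k = _) ↔ _
  rw [zero_smul]
  have h0 := Lp.coeFn_zero ℂ 2 (volume : Measure ℝ)
  constructor
  · rintro ⟨-, h⟩
    filter_upwards [h, hη0, h0] with k hk hk0 hz
    rw [hz, Pi.zero_apply] at hk
    refine sub_eq_zero.1 ((mul_eq_zero.1 (?_ : η k * _ = 0)).resolve_left hk0)
    rw [exprL, hk]
    ring
  · intro h
    refine ⟨?_, ?_⟩
    · have m0 := memLp_mul_of_holderTriple ∞ 2 2 hη (Lp.memLp u)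
      have m1 := memLp_mul_of_holderTriple ∞ 2 2 h1 (Lp.memLp u)
      have m2 := memLp_mul_of_holderTriple ∞ 2 2 h2 (memLp_rieszMinus_coeFn u)
      refine MemLp.ae_eq ?_ ((m1.sub (m0.const_mul (1 / (2 * Real.pi * Complex.I)))).add m2)
      filter_upwards [h] with k hk
      rw [exprL] at hk
      simp only [Pi.sub_apply, Pi.add_apply]
      linear_combination η k * hk
    · filter_upwards [h, h0] with k hk hz
      rw [exprL] at hk
      rw [hz, Pi.zero_apply]
      linear_combination -η k * hk

end

end Friedrichs

end

theorem mainTheorem4 (φ ψ : Friedrichs.L2R)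
    (hφψ : MemLp ψ ∞ volume ∨ (MemLp φ 4 volume ∧ MemLp ψ 4 volume)) :
    (∀ u : Friedrichs.L2R, MemLp (Friedrichs.exprL φ ψ u) 1 volume) ∧
    ∀ B : ℂ,
      (∃ z ∈ (Friedrichs.opAB φ ψ B).resolventSet, 0 < z.im) →
      (∃ z ∈ (Friedrichs.opAB φ ψ B).resolventSet, z.im < 0) →
      ∀ S : Submodule ℂ Friedrichs.L2R,
        (S = Friedrichs.closureT φ ψ B ∨
          ∃ μ₀ ∈ (Friedrichs.opAB φ ψ B).resolventSet, S = Friedrichs.closureS φ ψ B μ₀) →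
        (S ≠ ⊤ ↔ 1 / (2 * Real.pi * Complex.I) ∈ (Friedrichs.opL φ ψ).pointSpectrum) ∧
        (Sᗮ : Set Friedrichs.L2R) =
          {g | star g ∈ (Friedrichs.opL φ ψ).kerSub (1 / (2 * Real.pi * Complex.I))} ∧
        ∀ η : ℝ → ℂ, MemLp η ∞ volume → (∀ᵐ k : ℝ, η k ≠ 0) →
          MemLp (fun k => η k * Friedrichs.multiplier φ ψ k) ∞ volume →
          MemLp (fun k => η k * ψ k * conj (φ k)) ∞ volume →
          MemLp (fun k => η k * conj (φ k)) ∞ volume →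
          (Friedrichs.opCalL φ ψ η).domain = Friedrichs.domCalL φ ψ η ∧
          Dense (Friedrichs.opCalL φ ψ η).domain ∧
          (S ≠ ⊤ ↔ 0 ∈ (Friedrichs.opCalL φ ψ η).pointSpectrum) ∧
          (Sᗮ : Set Friedrichs.L2R) = {g | star g ∈ (Friedrichs.opCalL φ ψ η).kerSub 0} ∧
          (MemLp ψ ∞ volume → (Friedrichs.opCalL φ ψ η).domain = Set.univ) := by
  obtain ⟨p, q, hpq⟩ := Friedrichs.exists_admissibleExponents φ ψ hφψ
  refine ⟨hpq.memLp_exprL, fun B hup hlow S hS => ?_⟩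
  have horth : ∀ g, g ∈ Sᗮ ↔
      star g ∈ (Friedrichs.opL φ ψ).kerSub (1 / (2 * Real.pi * Complex.I)) :=
    fun g => (Friedrichs.mem_orthogonal_iff_pairing_eq_zero hup hlow hS g).trans
      (hpq.star_mem_kerSub_iff g).symm
  have htop : ∀ {T : Friedrichs.Operator} {z : ℂ}, (∀ g, g ∈ Sᗮ ↔ star g ∈ T.kerSub z) →
      (S ≠ ⊤ ↔ z ∈ T.pointSpectrum) := by
    intro T z h
    rw [Friedrichs.ne_top_iff_exists_mem_orthogonal hS, ← Friedrichs.exists_star_mem_kerSub_iff]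
    simp only [h]
  refine ⟨htop horth, Set.ext horth, fun η hη hη0 h1 h2 h3 => ?_⟩
  have hdom := Friedrichs.domain_opCalL hη h1 h2
  have horth' : ∀ g, g ∈ Sᗮ ↔ star g ∈ (Friedrichs.opCalL φ ψ η).kerSub 0 :=
    fun g => (horth g).trans (Friedrichs.mem_kerSub_opCalL_iff hη hη0 h1 h2 _).symm
  refine ⟨hdom, ?_, htop horth', Set.ext horth', fun hψ => ?_⟩
  · rw [hdom]
    exact (Friedrichs.dense_mulDomain ψ).mono fun u hu => Friedrichs.mem_domCalL_of_memLp_mul h3 hu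
  · rw [hdom]
    exact Set.eq_univ_of_forall fun u => Friedrichs.mem_domCalL_of_memLp_mul h3
      (Friedrichs.memLp_mul_of_holderTriple ∞ 2 2 hψ (Lp.memLp u))
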